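/- A stochastic timed game (STG) is a timed automaton (finitely many locations and clocks; finitely many edges, each with a guard, a set of clocks to reset and a target; an invariant for every location; guards and invariants are finite conjunctions of constraints $x\bowtie k$ with $k\in\mathbb{Z}_{\ge 0}$ and $\bowtie\,\in\{<,\le,=,\ge,>\}$) whose locations are partitioned among Player $\Box$, Player $\Diamond$ and the stochastic player. At a state $s$ of Player $\Box$ or $\Diamond$ the owner chooses a delay and an edge by a deterministic strategy, which may depend on the whole run so far and is measurable in the delays. At a state $s$ of the stochastic player a delay is drawn from a given probability distribution on the set $I(s)$ of possible delays, and then an enabled edge is drawn with probability proportional to given positive integer edge weights. The game is a $1\frac12$-player game if no location belongs to Player $\Box$. It has uniform delay distributions if, for every state $s$, $I(s)$ is bounded and the delay distribution at $s$ (if $s$ is stochastic) is uniform on $I(s)$. The quantitative reachability problem asks, given an STG, a set $T$ of target locations, an initial state $s_0$ and a threshold $\bowtie p$ with $p\in\mathbb{Q}$, $0<p<1$, whether Player $\Diamond$ has a strategy such that for every strategy of Player $\Box$ the probability that the run from $s_0$ visits $T$ is $\bowtie p$. **Theorem.** For every $n\ge 4$, the quantitative reachability problem is undecidable for $1\frac12$-player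 stochastic timed games with $n$ clocks. It is undecidable already for nonblocking games with uniform delay distributions and rational initial states, and remains so for these games if the threshold is fixed to "$=\frac12$". -/

import Mathlib

open MeasureTheory
open scoped ENNReal

noncomputable section

namespace STG

/-! ## Clock constraints and timed automata -/

/-- The five comparison symbols. -/
inductive Cmp
  | lt | le | eq | ge | gt

/-- The meaning of a comparison symbol. -/
def Cmp.Holds {α : Type} [LT α] [LE α] : Cmp → α → α → Prop
  | .lt, a, b => a < b
  | .le, a, b => a ≤ b
  | .eq, a, b => a = b
  | .ge, a, b => b ≤ a
  | .gt, a, b => b < a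

/-- A clock constraint: a finite conjunction of atoms `x ⋈ k` with `k` a natural number. -/
abbrev Constraint (X : Type) : Type := List (X × Cmp × ℕ)

/-- The valuation `ν` satisfies the constraint `g`. -/
def Constraint.Sat {X : Type} (g : Constraint X) (ν : X → ℝ) : Prop :=
  ∀ a ∈ g, a.2.1.Holds (ν a.1) (a.2.2 : ℝ)

/-- The set of (nonnegative) valuations that a constraint defines. -/
def Constraint.toSet {X : Type} (g : Constraint X) : Set (X → ℝ) :=
  {ν | (∀ x, 0 ≤ ν x) ∧ g.Sat ν}

/-- A location together with a clock valuation. -/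
structure Config (L X : Type) where
  loc : L
  val : X → ℝ

/-- Let `t` time units pass. -/
def Config.delay {L X : Type} (s : Config L X) (t : ℝ) : Config L X :=
  ⟨s.loc, fun x => s.val x + t⟩

/-- A timed automaton with locations `L`, clocks `X` and edges `E`; an edge `e` stands for the
tuple (source, guard, set of clocks to reset, target). -/
structure TimedAutomaton (L X E : Type) where
  src : E → L
  guard : E → Constraint X
  reset : E → Set X
  tgt : E → L
  inv : L → Constraint X

namespace TimedAutomaton

variable {L X E : Type} (A : TimedAutomaton L X E)

/-- The edges form a set of tuples: distinct edges are distinct as tuples, where a guard counts as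
the set of valuations that it defines. -/
def EdgesDistinct : Prop :=
  Function.Injective fun e => (A.src e, (A.guard e).toSet, A.reset e, A.tgt e)

/-- States: the clocks are nonnegative and the invariant of the location holds. -/
def IsState (s : Config L X) : Prop :=
  (∀ x, 0 ≤ s.val x) ∧ (A.inv s.loc).Sat s.val

open Classical in
/-- The configuration after a delay `t` followed by the edge `e`. -/
def next (s : Config L X) (t : ℝ) (e : E) : Config L X :=
  ⟨A.tgt e, fun x => if x ∈ A.reset e then 0 else s.val x + t⟩

/-- There is a transition `(t, e)` from the state `s` (necessarily to the state `next s t e`). -/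
def CanStep (s : Config L X) (t : ℝ) (e : E) : Prop :=
  A.src e = s.loc ∧ 0 ≤ t ∧ (A.guard e).Sat (s.delay t).val ∧
    (∀ t', 0 ≤ t' → t' ≤ t → (A.inv s.loc).Sat (s.delay t').val) ∧
    A.IsState (A.next s t e)

/-- An edge is enabled in `s` if it can be taken without delay. -/
def Enabled (s : Config L X) (e : E) : Prop := A.CanStep s 0 e

/-- `I(s, e)`: the delays after which `e` can be taken from `s`. -/
def edgeDelays (s : Config L X) (e : E) : Set ℝ := {t | A.CanStep s t e}

/-- `I(s)`: the delays after which some edge can be taken from `s`. -/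
def delays (s : Config L X) : Set ℝ := ⋃ e, A.edgeDelays s e

/-- From every state some transition is possible. -/
def NonBlocking : Prop := ∀ s, A.IsState s → (A.delays s).Nonempty

end TimedAutomaton

/-- A sequence of pairs (delay, edge) from a start configuration, in chronological order. -/
structure Path (L X E : Type) where
  start : Config L X
  steps : List (ℝ × E)

/-- Extend a path by one step. -/
def Path.snoc {L X E : Type} (ρ : Path L X E) (p : ℝ × E) : Path L X E :=
  ⟨ρ.start, ρ.steps ++ [p]⟩

namespace TimedAutomaton

variable {L X E : Type} (A : TimedAutomaton L X E)

/-- The last configuration of a path. -/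
def last (ρ : Path L X E) : Config L X :=
  ρ.steps.foldl (fun s p => A.next s p.1 p.2) ρ.start

/-- Starting from `s`, the given steps are transitions between states. -/
def IsRunFrom : Config L X → List (ℝ × E) → Prop
  | s, [] => A.IsState s
  | s, p :: r => A.IsState s ∧ A.CanStep s p.1 p.2 ∧ IsRunFrom (A.next s p.1 p.2) r

/-- The path is a finite run. -/
def IsRun (ρ : Path L X E) : Prop := A.IsRunFrom ρ.start ρ.steps

end TimedAutomaton

/-! ## Stochastic timed games -/

/-- Who controls a location. -/
inductive Owner
  | box | diamond | stoch

/-- The data of a stochastic timed game: a timed automaton, a partition of its locations (`owner`),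
weights on the edges and distributions over the delays (the latter two matter only at the
locations of the stochastic player). -/
structure Game (L X E : Type) extends TimedAutomaton L X E where
  owner : L → Owner
  weight : E → ℕ
  delayDist : Config L X → Measure ℝ

namespace Game

variable {L X E : Type} (G : Game L X E)

/-- The conditions on the data of a stochastic timed game. -/
structure IsSTG : Prop where
  finite_loc : Finite L
  finite_clock : Finite X
  finite_edge : Finite E
  edges_distinct : G.EdgesDistinct
  weight_pos : ∀ e, G.owner (G.src e) = Owner.stoch → 0 < G.weight e
  /-- `delayDist s` is a probability measure over the set of possible delays. -/
  dist_delays : ∀ s, G.IsState s → G.owner s.loc = Owner.stoch →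
    G.delayDist s (G.delays s) = 1 ∧ G.delayDist s (G.delays s)ᶜ = 0
  dist_equiv : ∀ s, G.IsState s → G.owner s.loc = Owner.stoch → 0 < volume (G.delays s) →
    ∀ B, MeasurableSet B → B ⊆ G.delays s → (volume B = 0 ↔ G.delayDist s B = 0)

/-- The game has at most one proper player: no location belongs to Player `□`. -/
def IsOneAndHalfPlayer : Prop := ∀ l, G.owner l ≠ Owner.box

open Classical in
/-- The uniform distribution over a bounded finite union of intervals `I`: normalised Lebesgue
measure, and, if `I` is a Lebesgue null set (hence a finite set of points), normalised counting
measure. -/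
def uniformDist (I : Set ℝ) : Measure ℝ :=
  if volume I = 0 then ProbabilityTheory.cond Measure.count I
  else ProbabilityTheory.cond volume I

/-- The game is equipped with uniform distributions over delays. -/
def HasUniformDelays : Prop :=
  ∀ s, G.IsState s → Bornology.IsBounded (G.delays s) ∧
    (G.owner s.loc = Owner.stoch → G.delayDist s = uniformDist (G.delays s))

/-! ### Strategies -/

/-- `σ` is a strategy of player `o`: it proposes a possible transition after every finite run that
ends in a location of `o` (its values elsewhere are never used), and, for every start state and
every fixed sequence of edges, it depends measurably on the delays of the run. -/
structure IsStrategy (o : Owner) (σ : Path L X E → ℝ × E) : Prop where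
  legal : ∀ ρ, G.IsRun ρ → G.owner (G.last ρ).loc = o → G.CanStep (G.last ρ) (σ ρ).1 (σ ρ).2
  measurable_delay : ∀ (s : Config L X) (n : ℕ) (e : Fin n → E),
    Measurable fun τ : {τ : Fin n → ℝ // G.IsRun ⟨s, List.ofFn fun i => (τ i, e i)⟩ ∧
        G.owner (G.last ⟨s, List.ofFn fun i => (τ i, e i)⟩).loc = o} =>
      (σ ⟨s, List.ofFn fun i => (τ.1 i, e i)⟩).1
  measurable_edge : ∀ (s : Config L X) (n : ℕ) (e : Fin n → E) (e' : E),
    MeasurableSet {τ : {τ : Fin n → ℝ // G.IsRun ⟨s, List.ofFn fun i => (τ i, e i)⟩ ∧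
        G.owner (G.last ⟨s, List.ofFn fun i => (τ i, e i)⟩).loc = o} |
      (σ ⟨s, List.ofFn fun i => (τ.1 i, e i)⟩).2 = e'}

/-! ### The probability measure of a strategy profile -/

section Probability

variable [Fintype E]

open Classical in
/-- The probability with which the edge `e` is selected in `s`, among the enabled ones. -/
def edgeProb (s : Config L X) (e : E) : ℝ≥0∞ :=
  if G.Enabled s e then
    (G.weight e : ℝ≥0∞) / ∑ e' : E, if G.Enabled s e' then (G.weight e' : ℝ≥0∞) else 0
  else 0

open Classical in
/-- The probability that, after the finite run `ρ`, the edges of the given list are taken next, when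
Player `◇` plays `σ` and Player `□` plays `τ`. -/
def cylProb (σ τ : Path L X E → ℝ × E) : Path L X E → List E → ℝ≥0∞
  | _, [] => 1
  | ρ, e :: w =>
    match G.owner (G.last ρ).loc with
    | Owner.diamond => if (σ ρ).2 = e then cylProb σ τ (ρ.snoc (σ ρ)) w else 0
    | Owner.box => if (τ ρ).2 = e then cylProb σ τ (ρ.snoc (τ ρ)) w else 0
    | Owner.stoch =>
      ∫⁻ t in G.edgeDelays (G.last ρ) e,
        G.edgeProb ((G.last ρ).delay t) e * cylProb σ τ (ρ.snoc (t, e)) w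
          ∂(G.delayDist (G.last ρ))

end Probability

/-- The location reached from `l` by a sequence of edges. -/
def locAfter (l : L) (w : List E) : L := w.foldl (fun _ e => G.tgt e) l

/-- The sequence of edges `w` leads from `l` to `T`, and no proper prefix of it does. -/
def FirstHit (T : Set L) (l : L) (w : List E) : Prop :=
  G.locAfter l w ∈ T ∧ ∀ k < w.length, G.locAfter l (w.take k) ∉ T

/-- The probability that a run from `s` visits `T`: this event is the disjoint union of the cylinders
of the edge sequences that lead to `T` for the first time (see `IsRunMeasure.visits_eq`). -/
def reachProb [Fintype E] (σ τ : Path L X E → ℝ × E) (T : Set L) (s : Config L X) : ℝ≥0∞ :=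
  ∑' w : {w : List E // G.FirstHit T s.loc w}, G.cylProb σ τ ⟨s, []⟩ w.1

/-! The next few declarations check that `reachProb` is the measure of the event "visits `T`" for the
measure on infinite runs that extends `cylProb`. -/

/-- The first `n` steps of an infinite sequence of steps from `s`. -/
def initialPart (s : Config L X) (r : ℕ → ℝ × E) (n : ℕ) : Path L X E :=
  ⟨s, (List.range n).map r⟩

/-- The infinite runs from `s` that are generated by the strategies `σ` and `τ`. -/
def InfRun (σ τ : Path L X E → ℝ × E) (s : Config L X) : Type :=
  {r : ℕ → ℝ × E // ∀ n, G.IsRun (initialPart s r n) ∧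
    (G.owner (G.last (initialPart s r n)).loc = Owner.diamond → r n = σ (initialPart s r n)) ∧
    (G.owner (G.last (initialPart s r n)).loc = Owner.box → r n = τ (initialPart s r n))}

/-- The cylinder of a sequence of edges. -/
def cylinder (σ τ : Path L X E → ℝ × E) (s : Config L X) (w : List E) : Set (G.InfRun σ τ s) :=
  {r | (List.range w.length).map (fun i => (r.1 i).2) = w}

/-- The σ-algebra generated by the cylinders. -/
instance instMeasurableSpaceInfRun (σ τ : Path L X E → ℝ × E) (s : Config L X) :
    MeasurableSpace (G.InfRun σ τ s) :=
  MeasurableSpace.generateFrom (Set.range (G.cylinder σ τ s))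

/-- The infinite runs that visit `T`. -/
def visits (σ τ : Path L X E → ℝ × E) (s : Config L X) (T : Set L) : Set (G.InfRun σ τ s) :=
  {r | ∃ n, (G.last (initialPart s r.1 n)).loc ∈ T}

/-- `P` is the probability measure of the strategy profile, on the infinite runs from `s`. -/
def IsRunMeasure [Fintype E] (σ τ : Path L X E → ℝ × E) (s : Config L X)
    (P : Measure (G.InfRun σ τ s)) : Prop :=
  ∀ w, P (G.cylinder σ τ s w) = G.cylProb σ τ ⟨s, []⟩ w

theorem last_loc (s : Config L X) (r : List (ℝ × E)) :
    (G.last ⟨s, r⟩).loc = G.locAfter s.loc (r.map Prod.snd) := by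
  unfold TimedAutomaton.last locAfter
  induction r generalizing s with
  | nil => rfl
  | cons p r ih => exact ih (G.next s p.1 p.2)

theorem IsRunMeasure.visits_eq [Fintype E] {σ τ : Path L X E → ℝ × E} {s : Config L X}
    {P : Measure (G.InfRun σ τ s)} (hP : G.IsRunMeasure σ τ s P) (T : Set L) :
    P (G.visits σ τ s T) = G.reachProb σ τ T s := by
  have hloc : ∀ (r : G.InfRun σ τ s) (n : ℕ), (G.last (initialPart s r.1 n)).loc =
      G.locAfter s.loc ((List.range n).map fun i => (r.1 i).2) := by
    intro r n
    rw [initialPart, last_loc, List.map_map]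
    rfl
  have htake : ∀ (f : ℕ → E) (k n : ℕ), k ≤ n →
      ((List.range n).map f).take k = (List.range k).map f := by
    intro f k n h
    rw [← List.map_take, List.take_range, min_eq_left h]
  have hun : G.visits σ τ s T =
      ⋃ w : {w : List E // G.FirstHit T s.loc w}, G.cylinder σ τ s w.1 := by
    ext r
    simp only [visits, Set.mem_ofPred_eq, Set.mem_iUnion, cylinder, hloc]
    constructor
    · intro h
      classical
      refine ⟨⟨(List.range (Nat.find h)).map fun i => (r.1 i).2, Nat.find_spec h, ?_⟩, by simp⟩
      intro k hk
      have hk' : k < Nat.find h := by simpa using hk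
      rw [htake _ _ _ hk'.le]
      exact Nat.find_min h hk'
    · rintro ⟨⟨w, hw⟩, h⟩
      refine ⟨w.length, ?_⟩
      simp only at h
      rw [h]
      exact hw.1
  have hdis : Pairwise (Function.onFun Disjoint
      fun w : {w : List E // G.FirstHit T s.loc w} => G.cylinder σ τ s w.1) := by
    rintro ⟨v, hv⟩ ⟨w, hw⟩ hne
    refine Set.disjoint_left.2 fun r h1 h2 => ?_
    simp only [cylinder, Set.mem_ofPred_eq] at h1 h2
    have key : ∀ a b : List E, G.FirstHit T s.loc a → G.FirstHit T s.loc b →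
        (List.range a.length).map (fun i => (r.1 i).2) = a →
        (List.range b.length).map (fun i => (r.1 i).2) = b → ¬ a.length < b.length := by
      intro a b ha hb ra rb hlt
      apply hb.2 _ hlt
      rw [← rb, htake _ _ _ hlt.le, ra]
      exact ha.1
    have hlen : v.length = w.length :=
      le_antisymm (not_lt.1 (key w v hw hv h2 h1)) (not_lt.1 (key v w hv hw h1 h2))
    exact hne (Subtype.ext (h1.symm.trans (hlen ▸ h2)))
  rw [hun, measure_iUnion hdis]
  · exact tsum_congr fun w => hP w.1
  · exact fun w => MeasurableSpace.measurableSet_generateFrom ⟨w.1, rfl⟩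

/-! ### The reachability problem -/

/-- Player `◇` has a strategy such that, whatever Player `□` does, the probability to visit `T` from
`s` is in the relation `c` to `p`. -/
def CanReach [Fintype E] (T : Set L) (s : Config L X) (c : Cmp) (p : ℝ≥0∞) : Prop :=
  ∃ σ, G.IsStrategy Owner.diamond σ ∧ ∀ τ, G.IsStrategy Owner.box τ →
    c.Holds (G.reachProb σ τ T s) p

end Game

/-! ## Instances of the problem as finite data

Games with `n` clocks and uniform distributions over delays, a set of targets, a rational initial
state and a rational threshold. -/

/-- A location: its owner, its invariant, and whether it is a target. -/
structure LocCode (n : ℕ) where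
  owner : Owner
  inv : Constraint (Fin n)
  isTarget : Bool

/-- An edge: the numbers of its source and of its target, its guard, the clocks that it resets, and
its weight. -/
structure EdgeCode (n : ℕ) where
  src : ℕ
  tgt : ℕ
  guard : Constraint (Fin n)
  reset : List (Fin n)
  weight : ℕ

/-- An instance of the reachability problem. The locations are numbered, the initial one being
number `0`. The initial value of the clock `x` is `initVal x / initDen`, and the threshold is
`cmp (num / den)`. -/
structure Instance (n : ℕ) where
  initLoc : LocCode n
  otherLocs : List (LocCode n)
  edges : List (EdgeCode n)
  initVal : Fin n → ℕ
  initDen : ℕ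
  cmp : Cmp
  num : ℕ
  den : ℕ

/-- Comparison symbols as numbers. -/
def Cmp.equivFin : Cmp ≃ Fin 5 where
  toFun
    | .lt => 0
    | .le => 1
    | .eq => 2
    | .ge => 3
    | .gt => 4
  invFun := ![.lt, .le, .eq, .ge, .gt]
  left_inv c := by cases c <;> rfl
  right_inv i := by fin_cases i <;> rfl

/-- Owners as numbers. -/
def Owner.equivFin : Owner ≃ Fin 3 where
  toFun
    | .box => 0
    | .diamond => 1
    | .stoch => 2
  invFun := ![.box, .diamond, .stoch]
  left_inv c := by cases c <;> rfl
  right_inv i := by fin_cases i <;> rfl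

instance instPrimcodableCmp : Primcodable Cmp := Primcodable.ofEquiv _ Cmp.equivFin

instance instPrimcodableOwner : Primcodable Owner := Primcodable.ofEquiv _ Owner.equivFin

/-- Locations as tuples. -/
def LocCode.equivProd (n : ℕ) : LocCode n ≃ Owner × Constraint (Fin n) × Bool where
  toFun l := (l.owner, l.inv, l.isTarget)
  invFun p := ⟨p.1, p.2.1, p.2.2⟩
  left_inv _ := rfl
  right_inv _ := rfl

instance instPrimcodableLocCode (n : ℕ) : Primcodable (LocCode n) :=
  Primcodable.ofEquiv _ (LocCode.equivProd n)

/-- Edges as tuples. -/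
def EdgeCode.equivProd (n : ℕ) :
    EdgeCode n ≃ ℕ × ℕ × Constraint (Fin n) × List (Fin n) × ℕ where
  toFun e := (e.src, e.tgt, e.guard, e.reset, e.weight)
  invFun p := ⟨p.1, p.2.1, p.2.2.1, p.2.2.2.1, p.2.2.2.2⟩
  left_inv _ := rfl
  right_inv _ := rfl

instance instPrimcodableEdgeCode (n : ℕ) : Primcodable (EdgeCode n) :=
  Primcodable.ofEquiv _ (EdgeCode.equivProd n)

/-- Instances as tuples. -/
def Instance.equivProd (n : ℕ) :
    Instance n ≃ LocCode n × List (LocCode n) × List (EdgeCode n) × (Fin n → ℕ) × ℕ ×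
      Cmp × ℕ × ℕ where
  toFun c := (c.initLoc, c.otherLocs, c.edges, c.initVal, c.initDen, c.cmp, c.num, c.den)
  invFun p := ⟨p.1, p.2.1, p.2.2.1, p.2.2.2.1, p.2.2.2.2.1, p.2.2.2.2.2.1, p.2.2.2.2.2.2.1,
    p.2.2.2.2.2.2.2⟩
  left_inv _ := rfl
  right_inv _ := rfl

instance instPrimcodableInstance (n : ℕ) : Primcodable (Instance n) :=
  Primcodable.ofEquiv _ (Instance.equivProd n)

namespace Instance

variable {n : ℕ} (c : Instance n)

/-- The locations of the game. -/
abbrev Loc : Type := Fin (c.otherLocs.length + 1)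

/-- The edges of the game. -/
abbrev Edge : Type := Fin c.edges.length

/-- The description of a location. -/
def locCode (l : c.Loc) : LocCode n := (c.initLoc :: c.otherLocs).get l

/-- The timed automaton that the instance describes (numbers of locations are read modulo the number
of locations). -/
def automaton : TimedAutomaton c.Loc (Fin n) c.Edge where
  src e := Fin.ofNat _ (c.edges.get e).src
  guard e := (c.edges.get e).guard
  reset e := {x | x ∈ (c.edges.get e).reset}
  tgt e := Fin.ofNat _ (c.edges.get e).tgt
  inv l := (c.locCode l).inv

/-- The game that the instance describes, with uniform distributions over delays. -/
def game : Game c.Loc (Fin n) c.Edge where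
  toTimedAutomaton := c.automaton
  owner l := (c.locCode l).owner
  weight e := (c.edges.get e).weight
  delayDist s := Game.uniformDist (c.automaton.delays s)

/-- The target locations. -/
def targets : Set c.Loc := {l | (c.locCode l).isTarget = true}

/-- The initial state. -/
def init : Config c.Loc (Fin n) := ⟨0, fun x => (c.initVal x : ℝ) / (c.initDen : ℝ)⟩

/-- The threshold. -/
def threshold : ℝ≥0∞ := (c.num : ℝ≥0∞) / (c.den : ℝ≥0∞)

/-- The instances of the quantitative reachability problem for `1½`-player stochastic timed games with
`n` clocks and uniform distributions over delays: the game is a nonblocking stochastic timed game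
of this kind, the initial state is a state, and the threshold is strictly between `0` and `1`. -/
structure IsQuantitative : Prop where
  isSTG : c.game.IsSTG
  isOneAndHalfPlayer : c.game.IsOneAndHalfPlayer
  hasUniformDelays : c.game.HasUniformDelays
  nonBlocking : c.game.NonBlocking
  initDen_pos : 0 < c.initDen
  isState_init : c.game.IsState c.init
  threshold_pos : 0 < c.num
  threshold_lt_one : c.num < c.den

/-- The question: can Player `◇` make the probability to visit a target satisfy the threshold? -/
def IsPositive : Prop := c.game.CanReach c.targets c.init c.cmp c.threshold

end Instance

/-- The problem "does `a` have the property `Q`?", for the inputs `a` in `D`, is decidable: some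
total computable function gives the right answer on all inputs in `D`. -/
def DecidableOn {α : Type} [Primcodable α] (D Q : α → Prop) : Prop :=
  ∃ f : α → Bool, Computable f ∧ ∀ a, D a → (f a = true ↔ Q a)

end STG

end

/-!
# Undecidability of quantitative reachability in `1½`-player stochastic timed games

A program with two real registers, given by affine updates, is turned into a game with four clocks.
Player `◇` guesses the values of the registers after each instruction, and the stochastic player
checks a guess with probability `1 / 2`. A check consists of two trials with the same bias `x`, and
leads to the target with probability `2 x (1 - x)`; this is `1 / 2` if the guess is right and less
otherwise. So Player `◇` attains the value `1 / 2` if and only if the program runs forever. Such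
programs simulate Turing machines: the registers encode the two sides of the tape.
-/

noncomputable section

namespace STG

/-! ## Constraints and delays -/

/-! The value of a register is what its clock shows at the moment when `per` equals 4. At this
moment Player ◇ branches, which resets `per`. In the period that follows, each register clock is
reset once, at a moment of Player ◇'s choice; a reset at the time 4 - a' after the branch writes the
value a'.

Just before such a reset a fair coin decides between going on and checking the guess a'. In a check,
time runs without resets. The moments when three clocks reach three constants are affine functions
of the old value a and of a'. A delay drawn uniformly from the window between two of these moments
ends before the third with probability 1/2 exactly if the third is the midpoint, which is a linear
equation between a and a'. Suitable constants give halving, doubling and translation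
(`Check.balanced_half`, `Check.balanced_double`, `Check.balanced_shift`).

A single trial could exceed the probability x = 1/2, and errors could compensate each other. So the
trial is repeated, and different outcomes win: 2x(1 - x) is at most 1/2, with equality only at x =
1/2 (`two_trials`, `Realizes.At.hit_check`). The window is cut off at length 8 and the second trial
starts 8 time units after the first, with all constants raised by 8; hence it is an exact copy of
the first trial, whatever delay was drawn there.

Every coin toss averages the value of a check and the value of going on. So no strategy exceeds 1/2
(`Realizes.hit_le_half_of_isSim`), and a strategy with value 1/2 has only correct guesses and never
gives up (`Realizes.half_of_average`, `Realizes.At.exists_move`). Conversely, an infinite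
computation yields 1/4 + 1/8 + ... = 1/2 (`Realizes.exists_strategy`).

For a Turing machine the left half of the tape is a binary fraction scaled to [0, 2), and the right
half with the head is one scaled to [2, 4). Moves of the head halve or double the registers up to
constants, and the two bits next to the border are found by comparison with 1 and 3
(`move_machineProg_iff`). So the value 1/2 is attained if and only if the machine does not halt
(`isPositive_iff_not_dom`). The machine is fixed and its inputs are `pre` followed by powers of `u`
(`exists_machine_halting`), so that only the rational initial clock values vary. -/

theorem Cmp.Holds.between {c : Cmp} {a b x y : ℝ} (hx : c.Holds a y) (hz : c.Holds b y)
    (h₁ : a ≤ x) (h₂ : x ≤ b) : c.Holds x y := by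
  cases c <;> simp only [Cmp.Holds] at * <;> linarith

theorem Constraint.Sat.between {X : Type} {g : Constraint X} {u v w : X → ℝ} (hu : g.Sat u)
    (hw : g.Sat w) (h₁ : ∀ x, u x ≤ v x) (h₂ : ∀ x, v x ≤ w x) : g.Sat v :=
  fun a ha => (hu a ha).between (hw a ha) (h₁ _) (h₂ _)

namespace TimedAutomaton

variable {L X E : Type} (A : TimedAutomaton L X E)

/-- Constraints are conjunctions of bounds on single clocks, and clocks grow with the delay; so what
holds at two delays holds between them. -/
theorem ordConnected_edgeDelays (s : Config L X) (e : E) : (A.edgeDelays s e).OrdConnected := by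
  refine ⟨fun a ha b hb t ht => ?_⟩
  obtain ⟨h1, h2, h3, h4, h5, h6⟩ := ha
  obtain ⟨-, -, k3, k4, k5, k6⟩ := hb
  refine ⟨h1, h2.trans ht.1, ?_, fun t' h h' => k4 t' h (h'.trans ht.2), fun x => ?_, ?_⟩
  · exact h3.between k3 (fun x => add_le_add_right ht.1 _) (fun x => add_le_add_right ht.2 _)
  · have := h5 x
    simp only [next] at this ⊢
    split_ifs at this ⊢
    · exact this
    · linarith [ht.1]
  · refine h6.between k6 (fun x => ?_) (fun x => ?_) <;> simp only [next] <;> split_ifs <;>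
      linarith [ht.1, ht.2]

theorem measurableSet_edgeDelays (s : Config L X) (e : E) : MeasurableSet (A.edgeDelays s e) :=
  (A.ordConnected_edgeDelays s e).measurableSet

theorem measurableSet_delays [Finite E] (s : Config L X) : MeasurableSet (A.delays s) := by
  have := Fintype.ofFinite E
  exact MeasurableSet.iUnion fun e => A.measurableSet_edgeDelays s e

theorem edgeDelays_subset_delays (s : Config L X) (e : E) : A.edgeDelays s e ⊆ A.delays s :=
  Set.subset_iUnion (fun e => A.edgeDelays s e) e

theorem edgeDelays_eq_empty {s : Config L X} {e : E} (h : A.src e ≠ s.loc) :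
    A.edgeDelays s e = ∅ :=
  Set.eq_empty_of_forall_notMem fun _ ht => h ht.1

/-- Every edge contributes an interval, and an interval of length 0 has at most one point. This
makes the normalised counting measure a probability measure in the degenerate case of `uniformDist`.
-/
theorem finite_delays_of_volume_eq_zero [Finite E] {s : Config L X}
    (h : volume (A.delays s) = 0) : (A.delays s).Finite := by
  refine Set.finite_iUnion fun e => Set.Subsingleton.finite fun a ha b hb => ?_
  have h0 : volume (A.edgeDelays s e) = 0 := measure_mono_null (A.edgeDelays_subset_delays s e) h
  by_contra hab
  wlog hlt : a < b generalizing a b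
  · exact this b hb a ha (Ne.symm hab) (lt_of_le_of_ne (not_lt.1 hlt) (Ne.symm hab))
  have := measure_mono_null ((A.ordConnected_edgeDelays s e).out ha hb) h0
  rw [Real.volume_Icc, ENNReal.ofReal_eq_zero] at this
  linarith

theorem last_snoc (ρ : Path L X E) (p : ℝ × E) :
    A.last (ρ.snoc p) = A.next (A.last ρ) p.1 p.2 := by
  simp [last, Path.snoc]

theorem IsRunFrom.isState_foldl {s : Config L X} {r : List (ℝ × E)} (h : A.IsRunFrom s r) :
    A.IsState (r.foldl (fun s p => A.next s p.1 p.2) s) := by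
  induction r generalizing s with
  | nil => exact h
  | cons p r ih => exact ih h.2.2

theorem IsRun.isState_last {ρ : Path L X E} (h : A.IsRun ρ) : A.IsState (A.last ρ) :=
  IsRunFrom.isState_foldl A h

theorem IsRunFrom.append {s : Config L X} {r : List (ℝ × E)} {p : ℝ × E} (h : A.IsRunFrom s r)
    (hp : A.CanStep (r.foldl (fun s p => A.next s p.1 p.2) s) p.1 p.2) :
    A.IsRunFrom s (r ++ [p]) := by
  induction r generalizing s with
  | nil => exact ⟨h, hp, hp.2.2.2.2⟩
  | cons q r ih => exact ⟨h.1, h.2.1, ih h.2.2 hp⟩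

theorem IsRun.snoc {ρ : Path L X E} {p : ℝ × E} (h : A.IsRun ρ)
    (hp : A.CanStep (A.last ρ) p.1 p.2) : A.IsRun (ρ.snoc p) :=
  IsRunFrom.append A h hp

end TimedAutomaton

namespace Game

variable {L X E : Type} (G : Game L X E)

/-! ## Uniform distributions -/

theorem uniformDist_self {I : Set ℝ} (hI : MeasurableSet I) (hb : Bornology.IsBounded I)
    (hne : I.Nonempty) (hfin : volume I = 0 → I.Finite) : uniformDist I I = 1 := by
  unfold uniformDist
  split_ifs with h
  · rw [ProbabilityTheory.cond_apply hI, Set.inter_self, ENNReal.inv_mul_cancel]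
    · exact (Measure.count_ne_zero_iff.2 hne)
    · exact (Measure.count_apply_lt_top.2 (hfin h)).ne
  · rw [ProbabilityTheory.cond_apply hI, Set.inter_self, ENNReal.inv_mul_cancel h]
    exact hb.measure_lt_top.ne

theorem uniformDist_compl {I : Set ℝ} (hI : MeasurableSet I) : uniformDist I Iᶜ = 0 := by
  unfold uniformDist
  split_ifs <;> rw [ProbabilityTheory.cond_apply hI, Set.inter_compl_self, measure_empty, mul_zero]

/-- A nonblocking timed automaton with bounded delays, positive weights and uniform distributions
is a stochastic timed game. -/
theorem isSTG_of_uniform [Finite L] [Finite X] [Finite E] (hdist : G.EdgesDistinct)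
    (hw : ∀ e, 0 < G.weight e) (hu : ∀ s, G.delayDist s = uniformDist (G.delays s))
    (hb : ∀ s, G.IsState s → Bornology.IsBounded (G.delays s)) (hn : G.NonBlocking) :
    G.IsSTG where
  finite_loc := inferInstance
  finite_clock := inferInstance
  finite_edge := inferInstance
  edges_distinct := hdist
  weight_pos e _ := hw e
  dist_delays s hs _ := by
    rw [hu]
    exact ⟨uniformDist_self (G.measurableSet_delays s) (hb s hs) (hn s hs)
      G.finite_delays_of_volume_eq_zero, uniformDist_compl (G.measurableSet_delays s)⟩
  dist_equiv s hs _ hpos B _ hB := by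
    rw [hu, uniformDist, if_neg hpos.ne', ProbabilityTheory.cond_apply (G.measurableSet_delays s),
      Set.inter_eq_self_of_subset_right hB, mul_eq_zero, ENNReal.inv_eq_zero]
    simp [(hb s hs).measure_lt_top.ne]

/-- All conditions are vacuous, since no run ends in a location of `o`. In a game without Player `□`
any function can thus serve as the strategy of that player. -/
theorem IsStrategy.of_forall_ne {o : Owner} (h : ∀ l, G.owner l ≠ o) (τ : Path L X E → ℝ × E) :
    G.IsStrategy o τ where
  legal ρ _ ho := absurd ho (h _)
  measurable_delay s n e := by
    have : IsEmpty {τ : Fin n → ℝ // G.IsRun ⟨s, List.ofFn fun i => (τ i, e i)⟩ ∧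
        G.owner (G.last ⟨s, List.ofFn fun i => (τ i, e i)⟩).loc = o} := ⟨fun x => h _ x.2.2⟩
    exact measurable_of_empty _
  measurable_edge s n e e' := by
    have : IsEmpty {τ : Fin n → ℝ // G.IsRun ⟨s, List.ofFn fun i => (τ i, e i)⟩ ∧
        G.owner (G.last ⟨s, List.ofFn fun i => (τ i, e i)⟩).loc = o} := ⟨fun x => h _ x.2.2⟩
    exact (Set.toFinite _).measurableSet

/-! ## Reaching the target within a number of steps -/

theorem firstHit_nil {T : Set L} {l : L} : G.FirstHit T l [] ↔ l ∈ T := by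
  simp [FirstHit, locAfter]

theorem firstHit_cons {T : Set L} {l : L} {e : E} {w : List E} :
    G.FirstHit T l (e :: w) ↔ l ∉ T ∧ G.FirstHit T (G.tgt e) w := by
  constructor
  · rintro ⟨h1, h2⟩
    exact ⟨h2 0 (by simp), h1, fun k hk => h2 (k + 1) (by simpa using hk)⟩
  · rintro ⟨h0, h1, h2⟩
    refine ⟨h1, fun k hk => ?_⟩
    cases k with
    | zero => exact h0
    | succ k => exact h2 k (by simpa using hk)

variable [Fintype E] (σ τ : Path L X E → ℝ × E) (T : Set L)

open Classical in
/-- The probability to visit `T` within `N` more steps after the finite run `ρ`. -/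
def hit (N : ℕ∞) (ρ : Path L X E) : ℝ≥0∞ :=
  ∑' w : List E, if G.FirstHit T (G.last ρ).loc w ∧ (w.length : ℕ∞) ≤ N then
    G.cylProb σ τ ρ w else 0

open Classical in
/-- The contribution to `hit` of the runs that take the edge `e` next. -/
def hitVia (N : ℕ∞) (ρ : Path L X E) (e : E) : ℝ≥0∞ :=
  ∑' w : List E, if G.FirstHit T (G.tgt e) w ∧ (w.length : ℕ∞) ≤ N then
    G.cylProb σ τ ρ (e :: w) else 0

theorem reachProb_eq_hit (s : Config L X) : G.reachProb σ τ T s = G.hit σ τ T ⊤ ⟨s, []⟩ := by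
  classical
  unfold reachProb hit
  refine (tsum_subtype {w | G.FirstHit T s.loc w} fun w => G.cylProb σ τ ⟨s, []⟩ w).trans ?_
  refine tsum_congr fun w => ?_
  simp only [le_top, and_true, Set.indicator, Set.mem_ofPred_eq]
  rfl

theorem hit_mono {M N : ℕ∞} (h : M ≤ N) (ρ : Path L X E) :
    G.hit σ τ T M ρ ≤ G.hit σ τ T N ρ := by
  refine ENNReal.tsum_le_tsum fun w => ?_
  split_ifs with h1 h2
  · exact le_rfl
  · exact absurd ⟨h1.1, h1.2.trans h⟩ h2
  · exact zero_le
  · exact le_rfl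

/-- A finite set of edge sequences has bounded length. So a bound that is proved by induction on the
number of steps carries over to unbounded reachability. -/
theorem hit_top_le {ρ : Path L X E} {a : ℝ≥0∞} (h : ∀ N : ℕ, G.hit σ τ T N ρ ≤ a) :
    G.hit σ τ T ⊤ ρ ≤ a := by
  classical
  rw [hit, ENNReal.tsum_eq_iSup_sum]
  refine iSup_le fun S => le_trans ?_ (h (S.sup List.length))
  refine le_trans (Finset.sum_le_sum fun w hw => le_of_eq ?_) (ENNReal.sum_le_tsum S)
  have : (w.length : ℕ∞) ≤ (S.sup List.length : ℕ) := by
    exact_mod_cast Finset.le_sup (f := List.length) hw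
  simp [this]

theorem hit_of_mem {N : ℕ∞} {ρ : Path L X E} (h : (G.last ρ).loc ∈ T) :
    G.hit σ τ T N ρ = 1 := by
  unfold hit
  rw [tsum_eq_single []]
  · rw [if_pos ⟨(G.firstHit_nil).2 h, by simp⟩, cylProb]
  · intro w hw
    cases w with
    | nil => exact absurd rfl hw
    | cons e w => rw [if_neg fun h' => ((G.firstHit_cons).1 h'.1).1 h]

theorem hit_zero {ρ : Path L X E} (h : (G.last ρ).loc ∉ T) : G.hit σ τ T 0 ρ = 0 := by
  refine ENNReal.tsum_eq_zero.2 fun w => if_neg fun hw => ?_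
  have : w = [] := List.length_eq_zero_iff.1 (by exact_mod_cast le_antisymm hw.2 bot_le)
  exact h ((G.firstHit_nil).1 (this ▸ hw.1))

/-- Outside `T` the empty sequence is not a first hit, so the sum splits by the first edge. Since ⊤
+ 1 = ⊤, the case `N = ⊤` is the fixed point equation for the reachability probability. -/
theorem hit_succ {N : ℕ∞} {ρ : Path L X E} (h : (G.last ρ).loc ∉ T) :
    G.hit σ τ T (N + 1) ρ = ∑ e, G.hitVia σ τ T N ρ e := by
  have hinj : Function.Injective fun p : E × List E => p.1 :: p.2 := by
    rintro ⟨a, v⟩ ⟨b, w⟩ h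
    simpa using h
  unfold hit hitVia
  rw [← hinj.tsum_eq, ENNReal.tsum_prod', tsum_fintype]
  · refine Finset.sum_congr rfl fun e _ => tsum_congr fun w => ?_
    have hiff : G.FirstHit T (G.last ρ).loc (e :: w) ∧ ((e :: w).length : ℕ∞) ≤ N + 1 ↔
        G.FirstHit T (G.tgt e) w ∧ (w.length : ℕ∞) ≤ N := by
      rw [G.firstHit_cons]
      simp [h]
    by_cases hw : G.FirstHit T (G.tgt e) w ∧ (w.length : ℕ∞) ≤ N
    · rw [if_pos hw, if_pos (hiff.2 hw)]
    · rw [if_neg hw, if_neg (hiff.not.2 hw)]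
  · intro w hw
    cases w with
    | nil => exact absurd (if_neg fun h' => h ((G.firstHit_nil).1 h'.1)) hw
    | cons e w => exact ⟨(e, w), rfl⟩

theorem hit_diamond {N : ℕ∞} {ρ : Path L X E} (h : (G.last ρ).loc ∉ T)
    (ho : G.owner (G.last ρ).loc = Owner.diamond) :
    G.hit σ τ T (N + 1) ρ = G.hit σ τ T N (ρ.snoc (σ ρ)) := by
  rw [G.hit_succ σ τ T h, Fintype.sum_eq_single (σ ρ).2]
  · refine tsum_congr fun w => ?_
    rw [G.last_snoc, cylProb, ho]
    simp only [if_true]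
    rfl
  · intro e he
    refine ENNReal.tsum_eq_zero.2 fun w => ?_
    rw [cylProb, ho]
    simp [he.symm]

variable {σ τ T}

theorem hitVia_of_edgeDelays_eq_empty {N : ℕ∞} {ρ : Path L X E} {e : E}
    (ho : G.owner (G.last ρ).loc = Owner.stoch) (he : G.edgeDelays (G.last ρ) e = ∅) :
    G.hitVia σ τ T N ρ e = 0 := by
  refine ENNReal.tsum_eq_zero.2 fun w => ?_
  rw [cylProb, ho]
  simp [he]

/-- If the edge `e` has a constant probability, and if what happens later does not depend on the
delay, then the random delay contributes only the measure of the delays that allow for `e`. -/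
theorem hitVia_stoch {N : ℕ∞} {ρ ρ' : Path L X E} {e : E} {κ : ℝ≥0∞}
    (ho : G.owner (G.last ρ).loc = Owner.stoch)
    (hκ : ∀ t ∈ G.edgeDelays (G.last ρ) e, G.edgeProb ((G.last ρ).delay t) e = κ)
    (hloc : (G.last ρ').loc = G.tgt e)
    (hc : ∀ t ∈ G.edgeDelays (G.last ρ) e, ∀ w, G.FirstHit T (G.tgt e) w →
      G.cylProb σ τ (ρ.snoc (t, e)) w = G.cylProb σ τ ρ' w) :
    G.hitVia σ τ T N ρ e =
      G.delayDist (G.last ρ) (G.edgeDelays (G.last ρ) e) * κ * G.hit σ τ T N ρ' := by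
  unfold hitVia hit
  rw [← ENNReal.tsum_mul_left]
  refine tsum_congr fun w => ?_
  rw [hloc]
  split_ifs with hw
  · rw [cylProb, ho]
    simp only
    rw [setLIntegral_congr_fun (G.measurableSet_edgeDelays _ _)
      (g := fun _ => κ * G.cylProb σ τ ρ' w)
      (fun t ht => by simp only [hκ t ht, hc t ht w hw.1]), setLIntegral_const]
    ring
  · rw [mul_zero]

/-- In a region without proper players the future depends only on the last configuration. -/
theorem cylProb_eq_of_last_eq {R : Set L} (hR : ∀ e, G.src e ∈ R → G.tgt e ∈ R)
    (ho : ∀ l ∈ R, G.owner l = Owner.stoch) (w : List E) {ρ ρ' : Path L X E}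
    (h : G.last ρ = G.last ρ') (hl : (G.last ρ).loc ∈ R) :
    G.cylProb σ τ ρ w = G.cylProb σ τ ρ' w := by
  induction w generalizing ρ ρ' with
  | nil => rw [cylProb, cylProb]
  | cons e w ih =>
    rw [cylProb, cylProb, ← h, ho _ hl]
    by_cases he : G.src e = (G.last ρ).loc
    · simp only
      congr 1 with t
      rw [ih (ρ := ρ.snoc (t, e)) (ρ' := ρ'.snoc (t, e)) (by rw [G.last_snoc, G.last_snoc, h])
        (by rw [G.last_snoc]; exact hR e (he ▸ hl))]
    · simp [G.edgeDelays_eq_empty he]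

open Classical in
theorem edgeProb_of_unique {s : Config L X} {e : E} (he : G.Enabled s e)
    (hu : ∀ e', G.Enabled s e' → e' = e) (hw : G.weight e ≠ 0) : G.edgeProb s e = 1 := by
  rw [edgeProb, if_pos he, Fintype.sum_eq_single e fun e' h => if_neg fun h' => h (hu e' h'),
    if_pos he, ENNReal.div_self (by exact_mod_cast hw) (ENNReal.natCast_ne_top _)]

open Classical in
theorem edgeProb_of_pair {s : Config L X} {e f : E} (hne : e ≠ f) (he : G.Enabled s e)
    (hf : G.Enabled s f) (hu : ∀ e', G.Enabled s e' → e' = e ∨ e' = f) (hwe : G.weight e = 1)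
    (hwf : G.weight f = 1) : G.edgeProb s e = 1 / 2 := by
  rw [edgeProb, if_pos he, Fintype.sum_eq_add e f hne, if_pos he, if_pos hf, hwe, hwf]
  · norm_num
  · rintro e' ⟨h1, h2⟩
    exact if_neg fun h => (hu e' h).elim h1 h2

theorem cylProb_eq_zero_of_trap {l : L} (hl : l ∉ T) (htrap : ∀ e, G.src e = l → G.tgt e = l)
    (ho : G.owner l = Owner.stoch) {w : List E} {ρ : Path L X E} (hρ : (G.last ρ).loc = l)
    (hw : G.FirstHit T l w) : G.cylProb σ τ ρ w = 0 := by
  induction w generalizing ρ with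
  | nil => exact absurd ((G.firstHit_nil).1 hw) hl
  | cons e w ih =>
    rw [cylProb, hρ, ho]
    by_cases he : G.src e = l
    · have : ∀ t, G.cylProb σ τ (ρ.snoc (t, e)) w = 0 := fun t =>
        ih (by rw [G.last_snoc]; exact htrap e he)
          (by have := ((G.firstHit_cons).1 hw).2; rwa [htrap e he] at this)
      simp [this]
    · simp [G.edgeDelays_eq_empty (s := G.last ρ) (e := e) (by rwa [hρ])]

/-- A location that the game never leaves is useless unless it is a target. -/
theorem hit_eq_zero_of_trap {l : L} (hl : l ∉ T) (htrap : ∀ e, G.src e = l → G.tgt e = l)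
    (ho : G.owner l = Owner.stoch) {N : ℕ∞} {ρ : Path L X E} (h : (G.last ρ).loc = l) :
    G.hit σ τ T N ρ = 0 := by
  refine ENNReal.tsum_eq_zero.2 fun w => ?_
  split_ifs with hw
  · exact G.cylProb_eq_zero_of_trap hl htrap ho h (h ▸ hw.1)
  · rfl

end Game
-- Splitting of delays, and stochastic locations with a forced delay
namespace TimedAutomaton

variable {L X E : Type} (A : TimedAutomaton L X E)

theorem next_delay (s : Config L X) (t d : ℝ) (e : E) :
    A.next (s.delay t) d e = A.next s (t + d) e := by
  simp only [next, Config.delay, add_assoc]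

theorem CanStep.isState_delay {s : Config L X} {t : ℝ} {e : E} (hs : ∀ x, 0 ≤ s.val x)
    (h : A.CanStep s t e) : A.IsState (s.delay t) :=
  ⟨fun x => add_nonneg (hs x) h.2.1, h.2.2.2.1 t h.2.1 le_rfl⟩

theorem canStep_delay_iff {s : Config L X} {t d : ℝ} {e : E} (hs : A.IsState s)
    (hst : A.IsState (s.delay t)) (ht : 0 ≤ t) (hd : 0 ≤ d) :
    A.CanStep (s.delay t) d e ↔ A.CanStep s (t + d) e := by
  have hdel : ∀ u, (s.delay t).delay u = s.delay (t + u) := fun u => by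
    simp only [Config.delay, add_assoc]
  have hinv : ∀ u, 0 ≤ u → u ≤ t → (A.inv s.loc).Sat (s.delay u).val := fun u h0 h1 =>
    hs.2.between hst.2 (fun x => by simp [Config.delay, h0])
      (fun x => by simpa [Config.delay] using h1)
  unfold CanStep
  rw [A.next_delay, hdel]
  refine and_congr_right fun _ => ⟨fun h => ⟨add_nonneg ht hd, h.2.1, fun u h0 h1 => ?_, h.2.2.2⟩,
    fun h => ⟨hd, h.2.1, fun u h0 h1 => ?_, h.2.2.2⟩⟩
  · rcases le_total u t with h2 | h2
    · exact hinv u h0 h2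
    · have := h.2.2.1 (u - t) (by linarith) (by linarith)
      rwa [hdel, add_sub_cancel] at this
  · rw [hdel]
    exact h.2.2.1 (t + u) (by linarith) (by linarith)

/-- Edges are drawn in the state after the delay; this translates enabledness there into a condition
on transitions from the original state. -/
theorem enabled_delay_iff {s : Config L X} {t : ℝ} {e f : E} (hs : A.IsState s)
    (h : A.CanStep s t e) : A.Enabled (s.delay t) f ↔ A.CanStep s t f := by
  rw [Enabled, A.canStep_delay_iff hs (h.isState_delay A hs.1) h.2.1 le_rfl, add_zero]

theorem delays_eq_singleton {s : Config L X} {d : ℝ} {e : E} (h : A.CanStep s d e)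
    (hu : ∀ t e', A.CanStep s t e' → t = d) : A.delays s = {d} := by
  refine Set.Subset.antisymm (Set.iUnion_subset fun e' t ht => hu t e' ht)
    (Set.singleton_subset_iff.2 (Set.mem_iUnion.2 ⟨e, h⟩))

theorem edgeDelays_eq_singleton {s : Config L X} {d : ℝ} {e : E} (h : A.CanStep s d e)
    (hu : ∀ t e', A.CanStep s t e' → t = d) : A.edgeDelays s e = {d} :=
  Set.Subset.antisymm (fun t ht => hu t e ht) (Set.singleton_subset_iff.2 h)

end TimedAutomaton

namespace Game

variable {L X E : Type} {G : Game L X E} [Fintype E] {σ τ : Path L X E → ℝ × E} {T : Set L}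

theorem uniformDist_singleton (d : ℝ) : uniformDist {d} {d} = 1 :=
  uniformDist_self (measurableSet_singleton d) Bornology.isBounded_singleton
    (Set.singleton_nonempty d) fun _ => Set.finite_singleton d

theorem hitVia_of_forced {N : ℕ∞} {ρ : Path L X E} {d : ℝ} {e : E} {κ : ℝ≥0∞}
    (ho : G.owner (G.last ρ).loc = Owner.stoch)
    (hμ : G.delayDist (G.last ρ) = uniformDist (G.delays (G.last ρ)))
    (h : G.CanStep (G.last ρ) d e) (hu : ∀ t e', G.CanStep (G.last ρ) t e' → t = d)
    (hκ : G.edgeProb ((G.last ρ).delay d) e = κ) :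
    G.hitVia σ τ T N ρ e = κ * G.hit σ τ T N (ρ.snoc (d, e)) := by
  have hD := G.edgeDelays_eq_singleton h hu
  rw [G.hitVia_stoch (ρ' := ρ.snoc (d, e)) (κ := κ) ho, hμ, hD, G.delays_eq_singleton h hu,
    uniformDist_singleton, one_mul]
  · rw [hD]
    rintro t rfl
    exact hκ
  · rw [G.last_snoc]
    rfl
  · rw [hD]
    rintro t rfl w _
    rfl

/-- A stochastic location with only one possible transition. -/
theorem hit_of_forced {N : ℕ∞} {ρ : Path L X E} {d : ℝ} {e : E} (hT : (G.last ρ).loc ∉ T)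
    (ho : G.owner (G.last ρ).loc = Owner.stoch) (hs : G.IsState (G.last ρ))
    (hμ : G.delayDist (G.last ρ) = uniformDist (G.delays (G.last ρ)))
    (h : G.CanStep (G.last ρ) d e)
    (hu : ∀ t e', G.CanStep (G.last ρ) t e' → t = d ∧ e' = e) (hw : G.weight e = 1) :
    G.hit σ τ T (N + 1) ρ = G.hit σ τ T N (ρ.snoc (d, e)) := by
  rw [G.hit_succ σ τ T hT, Fintype.sum_eq_single e,
    hitVia_of_forced (κ := 1) ho hμ h (fun t e' h' => (hu t e' h').1), one_mul]
  · refine G.edgeProb_of_unique ((G.enabled_delay_iff hs h).2 h) (fun e' h' => ?_)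
      (by rw [hw]; simp)
    exact (hu _ _ ((G.enabled_delay_iff hs h).1 h')).2
  · intro e' he'
    refine G.hitVia_of_edgeDelays_eq_empty ho (Set.eq_empty_of_forall_notMem fun t ht => ?_)
    exact he' (hu t e' ht).2

/-- A stochastic location with one possible delay and two equally likely edges. -/
theorem hit_of_fair {N : ℕ∞} {ρ : Path L X E} {d : ℝ} {e f : E} (hT : (G.last ρ).loc ∉ T)
    (ho : G.owner (G.last ρ).loc = Owner.stoch) (hs : G.IsState (G.last ρ))
    (hμ : G.delayDist (G.last ρ) = uniformDist (G.delays (G.last ρ))) (hne : e ≠ f)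
    (he : G.CanStep (G.last ρ) d e) (hf : G.CanStep (G.last ρ) d f)
    (hu : ∀ t e', G.CanStep (G.last ρ) t e' → t = d ∧ (e' = e ∨ e' = f))
    (hwe : G.weight e = 1) (hwf : G.weight f = 1) :
    G.hit σ τ T (N + 1) ρ =
      1 / 2 * G.hit σ τ T N (ρ.snoc (d, e)) + 1 / 2 * G.hit σ τ T N (ρ.snoc (d, f)) := by
  have hu' := fun e' h' => (hu _ e' ((G.enabled_delay_iff hs he).1 h')).2
  have he' := (G.enabled_delay_iff hs he).2 he
  have hf' := (G.enabled_delay_iff hs he).2 hf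
  rw [G.hit_succ σ τ T hT, Fintype.sum_eq_add e f hne,
    hitVia_of_forced (κ := 1 / 2) ho hμ he (fun t e' h' => (hu t e' h').1),
    hitVia_of_forced (κ := 1 / 2) ho hμ hf (fun t e' h' => (hu t e' h').1)]
  · exact G.edgeProb_of_pair hne.symm hf' he' (fun e' h' => (hu' e' h').symm) hwf hwe
  · exact G.edgeProb_of_pair hne he' hf' hu' hwe hwf
  · rintro e' ⟨h1, h2⟩
    refine G.hitVia_of_edgeDelays_eq_empty ho (Set.eq_empty_of_forall_notMem fun t ht => ?_)
    exact (hu t e' ht).2.elim h1 h2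

/-- Waiting for a fixed moment hides how much of the waiting time has already passed. -/
theorem cylProb_eq_of_delay {R : Set L} (hR : ∀ e, G.src e ∈ R → G.tgt e ∈ R)
    (hRo : ∀ l ∈ R, G.owner l = Owner.stoch) {ρ ρ' : Path L X E} {t d : ℝ} (ht : 0 ≤ t)
    (hd : 0 ≤ d) (hlast : G.last ρ' = (G.last ρ).delay t) (hl : (G.last ρ).loc ∈ R)
    (hs : G.IsState (G.last ρ)) (hs' : G.IsState (G.last ρ'))
    (hμ : G.delayDist (G.last ρ) = uniformDist (G.delays (G.last ρ)))
    (hμ' : G.delayDist (G.last ρ') = uniformDist (G.delays (G.last ρ')))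
    (hu : ∀ u e, G.CanStep (G.last ρ) u e → u = t + d)
    (hu' : ∀ u e, G.CanStep (G.last ρ') u e → u = d) (w : List E) :
    G.cylProb σ τ ρ w = G.cylProb σ τ ρ' w := by
  have hl' : (G.last ρ').loc = (G.last ρ).loc := by rw [hlast]; rfl
  cases w with
  | nil => rw [cylProb, cylProb]
  | cons e w =>
    rw [cylProb, cylProb, hl', hRo _ hl]
    simp only
    have hiff : G.CanStep (G.last ρ') d e ↔ G.CanStep (G.last ρ) (t + d) e := by
      rw [hlast, G.canStep_delay_iff hs (hlast ▸ hs') ht hd]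
    by_cases h : G.CanStep (G.last ρ') d e
    · rw [G.edgeDelays_eq_singleton h hu', G.edgeDelays_eq_singleton (hiff.1 h) hu,
        lintegral_singleton, lintegral_singleton, hμ, hμ', G.delays_eq_singleton h hu',
        G.delays_eq_singleton (hiff.1 h) hu, uniformDist_singleton, uniformDist_singleton, hlast,
        G.cylProb_eq_of_last_eq hR hRo w (ρ := ρ.snoc (t + d, e)) (ρ' := ρ'.snoc (d, e))]
      · simp only [Config.delay, add_assoc]
      -- Waiting t + d, or t and then d, leads to the same configuration, and the further course
      -- depends on nothing else.
      · rw [G.last_snoc, G.last_snoc, hlast, G.next_delay]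
      · rw [G.last_snoc]
        exact hR e (h.1.trans hl' ▸ hl)
    · have e1 : G.edgeDelays (G.last ρ') e = ∅ :=
        Set.eq_empty_of_forall_notMem fun u hmem => h ((hu' u e hmem) ▸ hmem)
      have e2 : G.edgeDelays (G.last ρ) e = ∅ :=
        Set.eq_empty_of_forall_notMem fun u hmem => h (hiff.2 ((hu u e hmem) ▸ hmem))
      rw [e1, e2]
      simp

end Game

/-! ## Uniform trials -/

/-- The probability that a delay drawn from `[0, ℓ]` is less than `m`. -/
def early (ℓ m : ℝ) : ℝ≥0∞ := Game.uniformDist (Set.Icc 0 ℓ) {t | t ∈ Set.Icc 0 ℓ ∧ t < m}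

/-- The probability that a delay drawn from `[0, ℓ]` is at least `m`. -/
def late (ℓ m : ℝ) : ℝ≥0∞ := Game.uniformDist (Set.Icc 0 ℓ) {t | t ∈ Set.Icc 0 ℓ ∧ m ≤ t}

theorem early_add_late {ℓ : ℝ} (m : ℝ) (hℓ : 0 ≤ ℓ) : early ℓ m + late ℓ m = 1 := by
  have hm : MeasurableSet {t : ℝ | t ∈ Set.Icc 0 ℓ ∧ m ≤ t} :=
    measurableSet_Icc.inter measurableSet_Ici
  rw [early, late, ← measure_union _ hm]
  · rw [show {t : ℝ | t ∈ Set.Icc 0 ℓ ∧ t < m} ∪ {t : ℝ | t ∈ Set.Icc 0 ℓ ∧ m ≤ t} = Set.Icc 0 ℓ by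
      ext t
      simp only [Set.mem_union, Set.mem_ofPred_eq]
      have := lt_or_ge t m
      tauto]
    refine Game.uniformDist_self measurableSet_Icc (Metric.isBounded_Icc _ _)
      (Set.nonempty_Icc.2 hℓ) fun h => ?_
    rw [Real.volume_Icc, ENNReal.ofReal_eq_zero] at h
    rw [show ℓ = 0 by linarith, Set.Icc_self]
    exact Set.finite_singleton _
  · rw [Set.disjoint_left]
    rintro t ⟨-, h1⟩ ⟨-, h2⟩
    exact absurd h1 (not_lt.2 h2)

theorem early_of_pos {ℓ m : ℝ} (hℓ : 0 < ℓ) :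
    early ℓ m = ENNReal.ofReal (max 0 (min m ℓ) / ℓ) := by
  have hv : volume (Set.Icc 0 ℓ) = ENNReal.ofReal ℓ := by rw [Real.volume_Icc, sub_zero]
  have hv0 : volume (Set.Icc 0 ℓ) ≠ 0 := by rw [hv]; simpa using hℓ
  rw [early, Game.uniformDist, if_neg hv0, ProbabilityTheory.cond_apply measurableSet_Icc, hv,
    ENNReal.ofReal_div_of_pos hℓ, mul_comm, div_eq_mul_inv]
  congr 1
  rcases le_or_gt m ℓ with h | h
  · have : Set.Icc 0 ℓ ∩ {t | t ∈ Set.Icc 0 ℓ ∧ t < m} = Set.Ico 0 m := by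
      ext t
      simp only [Set.mem_inter_iff, Set.mem_Icc, Set.mem_ofPred_eq, Set.mem_Ico]
      constructor
      · exact fun h => ⟨h.1.1, h.2.2⟩
      · exact fun h' => ⟨⟨h'.1, h'.2.le.trans h⟩, ⟨h'.1, h'.2.le.trans h⟩, h'.2⟩
    rw [this, Real.volume_Ico, min_eq_left h, sub_zero, ENNReal.ofReal_max]
    simp
  · have : Set.Icc 0 ℓ ∩ {t | t ∈ Set.Icc 0 ℓ ∧ t < m} = Set.Icc 0 ℓ := by
      ext t
      simp only [Set.mem_inter_iff, Set.mem_Icc, Set.mem_ofPred_eq]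
      constructor
      · exact fun h => h.1
      · exact fun h' => ⟨h', h', h'.2.trans_lt h⟩
    rw [this, hv, min_eq_right h.le, max_eq_right hℓ.le]

/-- On a window of length 0 the delay is deterministic. So a degenerate window never gives the
probability 1/2, and no wrong guess can profit from it. -/
theorem early_zero (m : ℝ) : early 0 m = 0 ∨ early 0 m = 1 := by
  rw [early, Set.Icc_self]
  by_cases hm : 0 < m
  · right
    rw [show {t : ℝ | t ∈ ({0} : Set ℝ) ∧ t < m} = {0} by
      ext t
      simp only [Set.mem_singleton_iff, Set.mem_ofPred_eq, and_iff_left_iff_imp]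
      rintro rfl
      exact hm]
    exact Game.uniformDist_singleton 0
  · left
    rw [show {t : ℝ | t ∈ ({0} : Set ℝ) ∧ t < m} = ∅ by
      ext t
      simp only [Set.mem_singleton_iff, Set.mem_ofPred_eq, Set.mem_empty_iff_false, iff_false]
      rintro ⟨rfl, h⟩
      exact hm h]
    exact measure_empty

theorem early_eq_half_iff {ℓ m : ℝ} (hℓ : 0 ≤ ℓ) :
    early ℓ m = 1 / 2 ↔ 0 < ℓ ∧ 2 * m = ℓ := by
  rcases hℓ.eq_or_lt with rfl | h
  · simp only [lt_irrefl, false_and, iff_false]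
    intro h'
    replace h' := congrArg ENNReal.toReal h'
    rcases early_zero m with h | h <;> norm_num [h] at h'
  · have h2 : (1 / 2 : ℝ≥0∞) = ENNReal.ofReal (1 / 2) := by
      rw [ENNReal.ofReal_div_of_pos two_pos]
      norm_num
    rw [early_of_pos h, h2, ENNReal.ofReal_eq_ofReal_iff (by positivity) (by norm_num),
      div_eq_iff h.ne']
    simp only [h, true_and]
    constructor
    · intro h'
      rcases max_cases 0 (min m ℓ) with h1 | h1 <;> rcases min_cases m ℓ with h2 | h2 <;> linarith
    · intro h'
      rw [min_eq_left (by linarith), max_eq_right (by linarith)]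
      linarith

/-- Two independent trials with success probability `a` differ with probability at most `1 / 2`. -/
theorem two_trials {a b : ℝ≥0∞} (h : a + b = 1) :
    a * b + b * a ≤ 1 / 2 ∧ (a * b + b * a = 1 / 2 ↔ a = 1 / 2) := by
  have ha : a ≠ ∞ := fun h' => by simp [h'] at h
  have hb : b ≠ ∞ := fun h' => by simp [h'] at h
  lift a to NNReal using ha
  lift b to NNReal using hb
  have h' : (a : ℝ) + b = 1 := by exact_mod_cast h
  have h2 : (1 / 2 : ℝ≥0∞) = ((1 / 2 : NNReal) : ℝ≥0∞) := by simp
  rw [h2, ← ENNReal.coe_mul, ← ENNReal.coe_mul, ← ENNReal.coe_add, ENNReal.coe_le_coe,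
    ENNReal.coe_inj, ENNReal.coe_inj, ← NNReal.coe_le_coe, ← NNReal.coe_inj, ← NNReal.coe_inj]
  push_cast
  have hb' : (b : ℝ) = 1 - a := by linarith
  rw [hb']
  -- 2a(1 - a) = 1/2 - 2(a - 1/2)².
  refine ⟨by nlinarith [sq_nonneg ((a : ℝ) - 1 / 2)], fun h => ?_, fun h => by rw [h]; norm_num⟩
  have : ((a : ℝ) - 1 / 2) ^ 2 = 0 := by nlinarith
  have := pow_eq_zero_iff (two_ne_zero) |>.1 this
  linarith

/-! ## Programs that update two registers, and their games -/

/-- The clocks of the game of a program: two registers, a clock for the period and an auxiliary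
clock. -/
inductive Clk
  | reg (b : Bool) | per | aux
  deriving DecidableEq

/-- The clocks that the check of a register update can refer to. -/
inductive Role
  | reg | per | aux

/-- The clock with a given role in the update of the register `b`. -/
def Role.clk (b : Bool) : Role → Clk
  | .reg => .reg b
  | .per => .per
  | .aux => .aux

/-- The data of a check: it tests whether the moment when `o = c₃` is the midpoint between the
moments when `p = c₁` and when `q = c₂`. -/
structure Check where
  p : Role
  q : Role
  o : Role
  c₁ : ℕ
  c₂ : ℕ
  c₃ : ℕ

/-- A program with states `Q` and instructions `I`. -/
structure Prog (Q I : Type) where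
  src : I → Q
  tgt : I → Q
  test : I → Constraint Bool
  op : I → Bool → Check

/-- The locations of the game of a program. -/
inductive PLoc (Q I : Type)
  | main (q : Q)
  | slot (i : I) (b : Bool)
  | choice (i : I) (b : Bool)
  | wait (i : I) (b : Bool) (s : Option Bool)
  | trial (i : I) (b : Bool) (s : Option Bool)
  | win
  | lose
  deriving Fintype

/-- The edges of the game of a program. -/
inductive PEdge (Q I : Type)
  | branch (i : I)
  | quit (q : Q)
  | guess (i : I) (b : Bool)
  | skip (i : I) (b : Bool)
  | cont (i : I) (b : Bool)
  | chk (i : I) (b : Bool)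
  | go (i : I) (b : Bool) (s : Option Bool)
  | fail (i : I) (b : Bool) (s : Option Bool)
  | out (i : I) (b : Bool) (s : Option Bool) (r : Bool)
  | loop (w : Bool)
  deriving Fintype

/-- The second of the two trials of a check takes place 8 time units after the first one. -/
def lag : Option Bool → ℕ
  | none => 0
  | some _ => 8

namespace Prog

variable {Q I : Type} (P : Prog Q I)

/-- The invariant of a location, given by upper bounds for some clocks. -/
def bounds : PLoc Q I → List (Clk × ℕ)
  | .main _ => [(.per, 4)]
  | .slot _ _ => [(.per, 4)]
  | .choice _ _ => [(.per, 4), (.aux, 0)]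
  | .wait i b s => [((P.op i b).p.clk b, (P.op i b).c₁ + lag s)]
  | .trial i b s => [((P.op i b).q.clk b, (P.op i b).c₂ + lag s),
      ((P.op i b).p.clk b, (P.op i b).c₁ + lag s + 8)]
  | .win => [(.aux, 0)]
  | .lose => [(.aux, 0)]

def owner : PLoc Q I → Owner
  | .main _ => .diamond
  | .slot _ _ => .diamond
  | _ => .stoch

def source : PEdge Q I → PLoc Q I
  | .branch i => .main (P.src i)
  | .quit q => .main q
  | .guess i b => .slot i b
  | .skip i b => .slot i b
  | .cont i b => .choice i b
  | .chk i b => .choice i b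
  | .go i b s => .wait i b s
  | .fail i b s => .wait i b s
  | .out i b s _ => .trial i b s
  | .loop true => .win
  | .loop false => .lose

/-- Equal outcomes lose and different ones win, which gives the probability 2x(1 - x). The edges
`quit` and `skip` guarantee that Player `◇` always has a transition, at the price of losing. -/
def target : PEdge Q I → PLoc Q I
  | .branch i => .slot i true
  | .quit _ => .lose
  | .guess i b => .choice i b
  | .skip _ _ => .lose
  | .cont i true => .slot i false
  | .cont i false => .main (P.tgt i)
  | .chk i b => .wait i b none
  | .go i b s => .trial i b s
  | .fail _ _ _ => .lose
  | .out i b none r => .wait i b (some r)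
  | .out _ _ (some r) r' => if r = r' then .lose else .win
  | .loop true => .win
  | .loop false => .lose

def guard : PEdge Q I → Constraint Clk
  | .branch i => (.per, .eq, 4) :: (P.test i).map fun a => (.reg a.1, a.2)
  | .go i b s => [((P.op i b).p.clk b, .eq, (P.op i b).c₁ + lag s),
      ((P.op i b).q.clk b, .le, (P.op i b).c₂ + lag s)]
  | .fail i b s => [((P.op i b).p.clk b, .eq, (P.op i b).c₁ + lag s),
      ((P.op i b).q.clk b, .gt, (P.op i b).c₂ + lag s)]
  | .out i b s r => [((P.op i b).o.clk b, if r then .lt else .ge, (P.op i b).c₃ + lag s)]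
  | _ => []

def reset : PEdge Q I → List Clk
  | .branch _ => [.per]
  | .cont _ b => [.reg b]
  | .chk _ _ => []
  | .go _ _ _ => []
  | .out _ _ none _ => []
  | _ => [.aux]

/-- The clock values `v` satisfy the invariant of the location `l`. -/
def Within (l : PLoc Q I) (v : Clk → ℝ) : Prop := ∀ a ∈ P.bounds l, v a.1 ≤ (a.2 : ℝ)

/-- The clock values after a delay and an edge. -/
def after (v : Clk → ℝ) (t : ℝ) (e : PEdge Q I) (c : Clk) : ℝ :=
  if c ∈ reset e then 0 else v c + t

/-- The edge `e` can be taken from the location `l` after the delay `t`. -/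
def Step (l : PLoc Q I) (v : Clk → ℝ) (t : ℝ) (e : PEdge Q I) : Prop :=
  P.source e = l ∧ 0 ≤ t ∧ (P.guard e).Sat (fun c => v c + t) ∧ P.Within l (fun c => v c + t) ∧
    P.Within (P.target e) (after v t e)

end Prog

variable {Q I L X E : Type}

/-- The game `G` is the game of the program `P`, up to the names of locations, edges and clocks. -/
structure Realizes (P : Prog Q I) (G : Game L X E) where
  φ : PLoc Q I ≃ L
  ψ : PEdge Q I ≃ E
  κ : Clk → X
  κ_inj : Function.Injective κ
  src_eq : ∀ e, G.src (ψ e) = φ (P.source e)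
  tgt_eq : ∀ e, G.tgt (ψ e) = φ (P.target e)
  guard_eq : ∀ e, G.guard (ψ e) = (P.guard e).map fun a => (κ a.1, a.2)
  reset_eq : ∀ e, G.reset (ψ e) = {x | ∃ c ∈ Prog.reset e, κ c = x}
  inv_eq : ∀ l, G.inv (φ l) = (P.bounds l).map fun a => (κ a.1, Cmp.le, a.2)
  owner_eq : ∀ l, G.owner (φ l) = Prog.owner l
  weight_eq : ∀ e, G.weight e = 1
  dist_eq : ∀ s, G.delayDist s = Game.uniformDist (G.delays s)

namespace Realizes

variable {P : Prog Q I} {G : Game L X E} (R : Realizes P G)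

theorem sat_guard_iff (e : PEdge Q I) (ν : X → ℝ) :
    (G.guard (R.ψ e)).Sat ν ↔ (P.guard e).Sat fun c => ν (R.κ c) := by
  rw [R.guard_eq]
  simp only [Constraint.Sat, List.forall_mem_map]

theorem sat_inv_iff (l : PLoc Q I) (ν : X → ℝ) :
    (G.inv (R.φ l)).Sat ν ↔ P.Within l fun c => ν (R.κ c) := by
  rw [R.inv_eq]
  simp only [Constraint.Sat, List.forall_mem_map, Cmp.Holds, Prog.Within]

theorem next_val (s : Config L X) (t : ℝ) (e : PEdge Q I) (c : Clk) :
    (G.next s t (R.ψ e)).val (R.κ c) = Prog.after (fun c => s.val (R.κ c)) t e c := by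
  have : R.κ c ∈ G.reset (R.ψ e) ↔ c ∈ Prog.reset e := by
    rw [R.reset_eq]
    exact ⟨fun ⟨c', h, h'⟩ => R.κ_inj h' ▸ h, fun h => ⟨c, h, rfl⟩⟩
  simp only [TimedAutomaton.next, Prog.after, this]

theorem next_eq_delay (s : Config L X) (t : ℝ) {e : PEdge Q I} (he : Prog.reset e = []) :
    G.next s t (R.ψ e) = ⟨R.φ (P.target e), fun x => s.val x + t⟩ := by
  have hx : ∀ x, x ∉ G.reset (R.ψ e) := by simp [R.reset_eq, he]
  simp only [TimedAutomaton.next, R.tgt_eq, hx, if_false]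

/-- The run `ρ` ends in the location `l`, with clock values `v`. -/
def At (ρ : Path L X E) (l : PLoc Q I) (v : Clk → ℝ) : Prop :=
  G.IsState (G.last ρ) ∧ (G.last ρ).loc = R.φ l ∧ ∀ c, (G.last ρ).val (R.κ c) = v c

variable {R} in
theorem At.eq {ρ : Path L X E} {l : PLoc Q I} {v : Clk → ℝ} (h : R.At ρ l v) :
    (fun c => (G.last ρ).val (R.κ c)) = v := funext h.2.2

variable {R} in
theorem At.nonneg {ρ : Path L X E} {l : PLoc Q I} {v : Clk → ℝ} (h : R.At ρ l v) (c : Clk) :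
    0 ≤ v c := by
  rw [← h.2.2]
  exact h.1.1 _

variable {R} in
theorem At.within {ρ : Path L X E} {l : PLoc Q I} {v : Clk → ℝ} (h : R.At ρ l v) :
    P.Within l v := by
  rw [← h.eq, ← R.sat_inv_iff, ← h.2.1]
  exact h.1.2

variable {R} in
theorem At.snoc {ρ : Path L X E} {l : PLoc Q I} {v : Clk → ℝ} (h : R.At ρ l v) {t : ℝ}
    {e : PEdge Q I} (ht : 0 ≤ t) (hw : P.Within (P.target e) (Prog.after v t e)) :
    R.At (ρ.snoc (t, R.ψ e)) (P.target e) (Prog.after v t e) := by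
  have hv := fun c => R.next_val (G.last ρ) t e c
  simp only [h.eq] at hv
  refine ⟨⟨fun x => ?_, ?_⟩, ?_, fun c => ?_⟩
  · rw [G.last_snoc]
    simp only [TimedAutomaton.next]
    split_ifs
    · exact le_rfl
    · exact add_nonneg (h.1.1 x) ht
  · rw [G.last_snoc]
    change (G.inv (G.tgt (R.ψ e))).Sat _
    rw [R.tgt_eq, R.sat_inv_iff]
    simpa only [hv] using hw
  · rw [G.last_snoc]
    exact R.tgt_eq e
  · rw [G.last_snoc]
    exact hv c

variable {R} in
theorem At.canStep_iff {ρ : Path L X E} {l : PLoc Q I} {v : Clk → ℝ} (h : R.At ρ l v) {t : ℝ}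
    {e : PEdge Q I} : G.CanStep (G.last ρ) t (R.ψ e) ↔ P.Step l v t e := by
  have hg : (G.guard (R.ψ e)).Sat ((G.last ρ).delay t).val ↔
      (P.guard e).Sat (fun c => v c + t) := by
    rw [R.sat_guard_iff]
    simp only [Config.delay, h.2.2]
  have hi : ∀ t', (G.inv (R.φ l)).Sat ((G.last ρ).delay t').val ↔
      P.Within l (fun c => v c + t') := fun t' => by
    rw [R.sat_inv_iff]
    simp only [Config.delay, h.2.2]
  unfold TimedAutomaton.CanStep Prog.Step
  rw [R.src_eq, h.2.1, R.φ.apply_eq_iff_eq, hg]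
  simp only [hi]
  refine and_congr_right fun _ => and_congr_right fun ht => and_congr_right fun _ => ?_
  constructor
  · rintro ⟨h1, -, h2⟩
    refine ⟨h1 t ht le_rfl, ?_⟩
    change (G.inv (G.tgt (R.ψ e))).Sat _ at h2
    rw [R.tgt_eq, R.sat_inv_iff] at h2
    simpa only [R.next_val, h.eq] using h2
  · rintro ⟨h1, h2⟩
    refine ⟨fun t' _ h' a ha => (add_le_add_right h' _).trans (h1 a ha), ?_⟩
    have := (h.snoc ht h2).1
    rwa [G.last_snoc] at this

/-- The target of the game. -/
def goal : Set L := {R.φ .win}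

theorem mem_goal_iff {l : PLoc Q I} : R.φ l ∈ R.goal ↔ l = .win := by
  simp [goal]

variable {R} in
theorem At.owner {ρ : Path L X E} {l : PLoc Q I} {v : Clk → ℝ} (h : R.At ρ l v) :
    G.owner (G.last ρ).loc = Prog.owner l := by
  rw [h.2.1, R.owner_eq]

variable {R} in
theorem At.not_mem {ρ : Path L X E} {l : PLoc Q I} {v : Clk → ℝ} (h : R.At ρ l v)
    (hl : l ≠ .win) : (G.last ρ).loc ∉ R.goal := by
  rw [h.2.1, R.mem_goal_iff]
  exact hl

/-- The locations of the checks and the two final locations. -/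
def region : Set L := R.φ '' {l | match l with
  | .wait _ _ _ | .trial _ _ _ | .win | .lose => True
  | _ => False}

theorem region_closed (e : E) (he : G.src e ∈ R.region) : G.tgt e ∈ R.region := by
  obtain ⟨e, rfl⟩ := R.ψ.surjective e
  rw [R.src_eq, region, R.φ.injective.mem_set_image] at he
  rw [R.tgt_eq, region, R.φ.injective.mem_set_image]
  rcases e with _ | _ | _ | _ | _ | _ | _ | _ | ⟨i, b, _ | s, r⟩ | w <;>
    simp only [Prog.source, Prog.target, Set.mem_ofPred_eq] at he ⊢
  · split_ifs <;> trivial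
  · cases w <;> trivial

theorem region_stoch (l : L) (hl : l ∈ R.region) : G.owner l = Owner.stoch := by
  obtain ⟨l, h, rfl⟩ := hl
  rw [R.owner_eq]
  cases l <;> first | rfl | exact h.elim

end Realizes

/-! ### The transitions of a check -/

namespace Prog

variable {Q I : Type} {P : Prog Q I}

theorem after_of_reset_eq_nil {e : PEdge Q I} (he : reset e = []) (v : Clk → ℝ) (t : ℝ) :
    after v t e = fun c => v c + t := by
  funext c
  simp only [after, he, List.not_mem_nil, if_false]

theorem after_of_reset_eq_singleton {e : PEdge Q I} {c₀ : Clk} (he : reset e = [c₀]) (v : Clk → ℝ)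
    (t : ℝ) : after v t e = fun c => if c = c₀ then 0 else v c + t := by
  funext c
  simp only [after, he, List.mem_singleton]

/-- Both edges require `p` to equal its bound, which fixes the delay; the guards on `q` exclude each
other, which fixes the edge. The hypothesis `hp` makes the delay nonnegative. -/
theorem step_wait_iff {i : I} {b : Bool} {s : Option Bool} {v : Clk → ℝ} {t : ℝ}
    {e : PEdge Q I} (hp : v ((P.op i b).p.clk b) ≤ ((P.op i b).c₁ + lag s : ℕ)) :
    P.Step (.wait i b s) v t e ↔ t = ((P.op i b).c₁ + lag s : ℕ) - v ((P.op i b).p.clk b) ∧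
      ((e = .go i b s ∧ v ((P.op i b).q.clk b) + t ≤ ((P.op i b).c₂ + lag s : ℕ)) ∨
        (e = .fail i b s ∧ ((P.op i b).c₂ + lag s : ℕ) < v ((P.op i b).q.clk b) + t)) := by
  cases e <;> simp only [Step, source, guard, Within, bounds, target, after, reset, Constraint.Sat,
    Cmp.Holds, List.forall_mem_cons, List.not_mem_nil, false_imp_iff, implies_true, and_true,
    reduceCtorEq, false_and, or_false, false_or, and_false, PLoc.wait.injEq, PEdge.go.injEq,
    PEdge.fail.injEq, if_false, iff_false]
  case go i' b' s' =>
    constructor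
    · rintro ⟨⟨rfl, rfl, rfl⟩, h0, ⟨h1, h2⟩, h3, h4, h5⟩
      exact ⟨by linarith, ⟨rfl, rfl, rfl⟩, h2⟩
    · rintro ⟨h1, ⟨rfl, rfl, rfl⟩, h2⟩
      refine ⟨⟨rfl, rfl, rfl⟩, by linarith, ⟨by linarith, h2⟩, by linarith, h2, ?_⟩
      push_cast at *
      linarith
  case fail i' b' s' =>
    constructor
    · rintro ⟨⟨rfl, rfl, rfl⟩, h0, ⟨h1, h2⟩, h3, h4⟩
      exact ⟨by linarith, ⟨rfl, rfl, rfl⟩, h2⟩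
    · rintro ⟨h1, ⟨rfl, rfl, rfl⟩, h2⟩
      refine ⟨⟨rfl, rfl, rfl⟩, by linarith, ⟨by linarith, h2⟩, by linarith, ?_⟩
      simp
  case loop w => cases w <;> simp

theorem step_trial_iff {i : I} {b : Bool} {s : Option Bool} {v : Clk → ℝ} {t : ℝ}
    {e : PEdge Q I} :
    P.Step (.trial i b s) v t e ↔
      t ∈ Set.Icc 0 (min (((P.op i b).c₂ + lag s : ℕ) - v ((P.op i b).q.clk b))
        (((P.op i b).c₁ + lag s + 8 : ℕ) - v ((P.op i b).p.clk b))) ∧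
      ((e = .out i b s true ∧ t < ((P.op i b).c₃ + lag s : ℕ) - v ((P.op i b).o.clk b)) ∨
        (e = .out i b s false ∧ ((P.op i b).c₃ + lag s : ℕ) - v ((P.op i b).o.clk b) ≤ t)) := by
  rw [Set.mem_Icc, le_min_iff, le_sub_iff_add_le, le_sub_iff_add_le, lt_sub_iff_add_lt,
    sub_le_iff_le_add, add_comm t, add_comm t, add_comm t]
  cases e
  case out i' b' s' r =>
    have ht : (Within P (P.target (.out i b s r)) (after v t (.out i b s r : PEdge Q I)) ↔
      (s = none → v ((P.op i b).p.clk b) + t ≤ ((P.op i b).c₁ + 8 : ℕ))) := by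
      rcases s with _ | s
      · simp [Within, target, bounds, after, reset, lag]
      · simp only [target]
        split_ifs <;> simp [Within, bounds, after, reset]
    by_cases h : i' = i ∧ b' = b ∧ s' = s
    · obtain ⟨rfl, rfl, rfl⟩ := h
      simp only [Step, ht]
      cases r <;> simp only [source, guard, Within, bounds, Constraint.Sat,
        Cmp.Holds, List.forall_mem_cons, List.not_mem_nil, false_imp_iff, implies_true, and_true,
        true_and, PEdge.out.injEq, if_true, if_false, Bool.false_eq_true, reduceCtorEq, false_and,
        and_false, or_false, false_or]
      · constructor
        · tauto
        · rintro ⟨h1, h2⟩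
          refine ⟨h1.1, h2, h1.2, ?_⟩
          rintro rfl
          exact h1.2.2
      · constructor
        · tauto
        · rintro ⟨h1, h2⟩
          refine ⟨h1.1, h2, h1.2, ?_⟩
          rintro rfl
          exact h1.2.2
    · have h' : ¬ (PLoc.trial (Q := Q) i' b' s' = .trial i b s) := by
        simpa only [PLoc.trial.injEq] using h
      simp only [Step, source, h', false_and, false_iff, PEdge.out.injEq]
      tauto
  case loop w => cases w <;> simp [Step, source]
  all_goals simp [Step, source]

end Prog

/-! ### The winning probability of a check -/

namespace Realizes

variable {Q I L X E : Type} {P : Prog Q I} {G : Game L X E} {R : Realizes P G}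

theorem hit_win [Fintype E] {σ τ : Path L X E → ℝ × E} {N : ℕ∞} {ρ : Path L X E}
    (h : (G.last ρ).loc = R.φ .win) : G.hit σ τ R.goal N ρ = 1 :=
  G.hit_of_mem σ τ _ (by rw [h, R.mem_goal_iff])

theorem lose_trap (e : E) (h : G.src e = R.φ .lose) : G.tgt e = R.φ .lose := by
  obtain ⟨e, rfl⟩ := R.ψ.surjective e
  rw [R.src_eq, R.φ.apply_eq_iff_eq] at h
  rw [R.tgt_eq, R.φ.apply_eq_iff_eq]
  rcases e with _ | _ | _ | _ | _ | _ | _ | _ | _ | (_ | _) <;> simp_all [Prog.source, Prog.target]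

theorem hit_lose [Fintype E] {σ τ : Path L X E → ℝ × E} {N : ℕ∞} {ρ : Path L X E}
    (h : (G.last ρ).loc = R.φ .lose) : G.hit σ τ R.goal N ρ = 0 :=
  G.hit_eq_zero_of_trap (by rw [R.mem_goal_iff]; simp) R.lose_trap (R.owner_eq _) h

theorem At.snoc' {ρ : Path L X E} {l : PLoc Q I} {v : Clk → ℝ} (h : R.At ρ l v) {t : ℝ}
    {e : PEdge Q I} (hs : P.Step l v t e) :
    R.At (ρ.snoc (t, R.ψ e)) (P.target e) (Prog.after v t e) :=
  h.snoc hs.2.1 hs.2.2.2.2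

theorem At.hit_forced [Fintype E] {σ τ : Path L X E → ℝ × E} {N : ℕ∞} {ρ : Path L X E}
    {l : PLoc Q I} {v : Clk → ℝ} (h : R.At ρ l v) (hl : l ≠ .win) (ho : Prog.owner l = .stoch)
    {d : ℝ} {e : PEdge Q I} (hs : P.Step l v d e)
    (hu : ∀ t e', P.Step l v t e' → t = d ∧ e' = e) :
    G.hit σ τ R.goal (N + 1) ρ = G.hit σ τ R.goal N (ρ.snoc (d, R.ψ e)) := by
  refine Game.hit_of_forced (h.not_mem hl) (h.owner.trans ho) h.1 (R.dist_eq _)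
    (h.canStep_iff.2 hs) (fun t e' h' => ?_) (R.weight_eq _)
  obtain ⟨e', rfl⟩ := R.ψ.surjective e'
  rw [R.ψ.apply_eq_iff_eq]
  exact hu t e' (h.canStep_iff.1 h')

section Check

variable [Fintype E] {σ τ : Path L X E → ℝ × E} {ρ : Path L X E} {i : I} {b : Bool}
  {s : Option Bool} {v : Clk → ℝ}

theorem At.hit_wait_of_le (h : R.At ρ (.wait i b s) v) {d : ℝ}
    (hd : d = ((P.op i b).c₁ + lag s : ℕ) - v ((P.op i b).p.clk b))
    (hq : v ((P.op i b).q.clk b) + d ≤ ((P.op i b).c₂ + lag s : ℕ)) :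
    G.hit σ τ R.goal ⊤ ρ = G.hit σ τ R.goal ⊤ (ρ.snoc (d, R.ψ (.go i b s))) ∧
      R.At (ρ.snoc (d, R.ψ (.go i b s))) (.trial i b s) (fun c => v c + d) := by
  have hp : v ((P.op i b).p.clk b) ≤ ((P.op i b).c₁ + lag s : ℕ) := 
    h.within (_, (P.op i b).c₁ + lag s) (List.mem_singleton.2 rfl)
  have hs : P.Step (.wait i b s) v d (.go i b s) := (Prog.step_wait_iff hp).2 ⟨hd, .inl ⟨rfl, hq⟩⟩
  constructor
  · rw [← h.hit_forced (by simp) rfl hs, top_add]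
    intro t e' h'
    obtain ⟨h1, ⟨h2, -⟩ | ⟨-, h3⟩⟩ := (Prog.step_wait_iff hp).1 h'
    · exact ⟨h1.trans hd.symm, h2⟩
    · rw [h1, ← hd] at h3
      exact absurd hq (not_le.2 h3)
  · rw [← Prog.after_of_reset_eq_nil (e := .go i b s) rfl]
    exact h.snoc' hs

theorem At.hit_wait_of_lt (h : R.At ρ (.wait i b s) v) {d : ℝ}
    (hd : d = ((P.op i b).c₁ + lag s : ℕ) - v ((P.op i b).p.clk b))
    (hq : ((P.op i b).c₂ + lag s : ℕ) < v ((P.op i b).q.clk b) + d) :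
    G.hit σ τ R.goal ⊤ ρ = 0 := by
  have hp : v ((P.op i b).p.clk b) ≤ ((P.op i b).c₁ + lag s : ℕ) := 
    h.within (_, (P.op i b).c₁ + lag s) (List.mem_singleton.2 rfl)
  have hs : P.Step (.wait i b s) v d (.fail i b s) :=
    (Prog.step_wait_iff hp).2 ⟨hd, .inr ⟨rfl, hq⟩⟩
  have := h.hit_forced (σ := σ) (τ := τ) (N := ⊤) (by simp) rfl hs
  rw [top_add] at this
  rw [this]
  · exact hit_lose (h.snoc' hs).2.1
  · intro t e' h'
    obtain ⟨h1, ⟨-, h3⟩ | ⟨h2, -⟩⟩ := (Prog.step_wait_iff hp).1 h'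
    · rw [h1, ← hd] at h3
      exact absurd h3 (not_le.2 hq)
    · exact ⟨h1.trans hd.symm, h2⟩

/-- At each delay of the window exactly one of the two outcomes is enabled, so it has probability 1
there. By `hc` the drawn delay has no influence on the future, hence the delay 0 may represent all
others. -/
theorem At.hit_trial (h : R.At ρ (.trial i b s) v) {ℓ m : ℝ}
    (hℓ : ℓ = min (((P.op i b).c₂ + lag s : ℕ) - v ((P.op i b).q.clk b))
        (((P.op i b).c₁ + lag s + 8 : ℕ) - v ((P.op i b).p.clk b)))
    (hm : m = ((P.op i b).c₃ + lag s : ℕ) - v ((P.op i b).o.clk b))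
    (hc : ∀ r t, G.CanStep (G.last ρ) t (R.ψ (.out i b s r)) → ∀ w,
      G.FirstHit R.goal (G.tgt (R.ψ (.out i b s r))) w →
      G.cylProb σ τ (ρ.snoc (t, R.ψ (.out i b s r))) w =
        G.cylProb σ τ (ρ.snoc (0, R.ψ (.out i b s r))) w) :
    G.hit σ τ R.goal ⊤ ρ =
      early ℓ m * G.hit σ τ R.goal ⊤ (ρ.snoc (0, R.ψ (.out i b s true))) +
        late ℓ m * G.hit σ τ R.goal ⊤ (ρ.snoc (0, R.ψ (.out i b s false))) := by
  have hstep : ∀ t e, G.CanStep (G.last ρ) t (R.ψ e) ↔ t ∈ Set.Icc 0 ℓ ∧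
      ((e = .out i b s true ∧ t < m) ∨ (e = .out i b s false ∧ m ≤ t)) := by
    intro t e
    rw [h.canStep_iff, Prog.step_trial_iff, hℓ, hm]
  have hdt : G.edgeDelays (G.last ρ) (R.ψ (.out i b s true)) = {t | t ∈ Set.Icc 0 ℓ ∧ t < m} := by
    ext t
    exact (hstep t _).trans (by simp)
  have hdf : G.edgeDelays (G.last ρ) (R.ψ (.out i b s false)) = {t | t ∈ Set.Icc 0 ℓ ∧ m ≤ t} := by
    ext t
    exact (hstep t _).trans (by simp)
  have hdel : G.delays (G.last ρ) = Set.Icc 0 ℓ := by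
    ext t
    rw [TimedAutomaton.delays, Set.mem_iUnion]
    constructor
    · rintro ⟨e, he⟩
      obtain ⟨e, rfl⟩ := R.ψ.surjective e
      exact ((hstep t e).1 he).1
    · intro ht
      rcases lt_or_ge t m with h' | h'
      · exact ⟨_, (hstep t (.out i b s true)).2 ⟨ht, .inl ⟨rfl, h'⟩⟩⟩
      · exact ⟨_, (hstep t (.out i b s false)).2 ⟨ht, .inr ⟨rfl, h'⟩⟩⟩
  have hprob : ∀ r, ∀ t ∈ G.edgeDelays (G.last ρ) (R.ψ (.out i b s r)),
      G.edgeProb ((G.last ρ).delay t) (R.ψ (.out i b s r)) = 1 := by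
    intro r t ht
    refine G.edgeProb_of_unique ((G.enabled_delay_iff h.1 ht).2 ht) (fun e he => ?_)
      (by rw [R.weight_eq]; simp)
    obtain ⟨e, rfl⟩ := R.ψ.surjective e
    have he' := ((hstep t e).1 ((G.enabled_delay_iff h.1 ht).1 he)).2
    have ht' := ((hstep t _).1 ht).2
    rcases he' with ⟨rfl, h1⟩ | ⟨rfl, h1⟩ <;> rcases ht' with ⟨h2, h3⟩ | ⟨h2, h3⟩ <;>
      first | exact absurd h1 (by linarith) | rw [h2]
  have hvia : ∀ r, G.hitVia σ τ R.goal ⊤ ρ (R.ψ (.out i b s r)) =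
      Game.uniformDist (Set.Icc 0 ℓ) (G.edgeDelays (G.last ρ) (R.ψ (.out i b s r))) *
        G.hit σ τ R.goal ⊤ (ρ.snoc (0, R.ψ (.out i b s r))) := by
    intro r
    rw [G.hitVia_stoch (ρ' := ρ.snoc (0, R.ψ (.out i b s r))) (κ := 1) (h.owner.trans rfl)
      (hprob r) (by rw [G.last_snoc]; rfl) (hc r), mul_one, R.dist_eq, hdel]
  have key := G.hit_succ σ τ R.goal (N := ⊤) (h.not_mem (by simp))
  rw [top_add] at key
  rw [key, Fintype.sum_eq_add (R.ψ (.out i b s true)) (R.ψ (.out i b s false)) (by simp), hvia,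
    hvia, hdt, hdf, early, late]
  rintro e ⟨h1, h2⟩
  obtain ⟨e, rfl⟩ := R.ψ.surjective e
  refine G.hitVia_of_edgeDelays_eq_empty (h.owner.trans rfl)
    (Set.eq_empty_of_forall_notMem fun t ht => ?_)
  rw [ne_eq, R.ψ.apply_eq_iff_eq] at h1 h2
  exact ((hstep t e).1 ht).2.elim (fun h' => h1 h'.1) (fun h' => h2 h'.1)

end Check

end Realizes
/-- The check succeeds with the maximal probability `1 / 2` if the clocks have the values `u`. -/
def Check.Balanced (k : Check) (u : Role → ℝ) : Prop :=
  0 < min (k.c₂ - (u k.q + (k.c₁ - u k.p))) 8 ∧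
    2 * (k.c₃ - (u k.o + (k.c₁ - u k.p))) = min (k.c₂ - (u k.q + (k.c₁ - u k.p))) 8

namespace Realizes

variable {Q I L X E : Type} {P : Prog Q I} {G : Game L X E} {R : Realizes P G} [Fintype E]
  {σ τ : Path L X E → ℝ × E} {ρ : Path L X E} {i : I} {b : Bool} {v : Clk → ℝ}

/-- The remembered outcome `r` wins against the opposite outcome only: after an early first trial
the second one has to be late, and vice versa. -/
theorem At.hit_second_trial {r : Bool} (h : R.At ρ (.trial i b (some r)) v) {ℓ m : ℝ}
    (hℓ : ℓ = min (((P.op i b).c₂ + 8 : ℕ) - v ((P.op i b).q.clk b))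
        (((P.op i b).c₁ + 8 + 8 : ℕ) - v ((P.op i b).p.clk b)))
    (hm : m = ((P.op i b).c₃ + 8 : ℕ) - v ((P.op i b).o.clk b)) :
    G.hit σ τ R.goal ⊤ ρ = if r then late ℓ m else early ℓ m := by
  have htgt : ∀ r' t, (G.last (ρ.snoc (t, R.ψ (.out i b (some r) r')))).loc =
      R.φ (if r = r' then .lose else .win) := by
    intro r' t
    rw [G.last_snoc]
    exact R.tgt_eq _
  rw [h.hit_trial hℓ hm]
  · cases r
    · rw [hit_win (R := R) (htgt true 0), hit_lose (R := R) (htgt false 0)]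
      simp
    · rw [hit_lose (R := R) (htgt true 0), hit_win (R := R) (htgt false 0)]
      simp
  · intro r' t _ w hw
    rw [R.tgt_eq] at hw
    by_cases hr : r = r'
    · simp only [Prog.target, if_pos hr] at hw
      have hl : R.φ .lose ∉ R.goal := by simp [R.mem_goal_iff]
      rw [G.cylProb_eq_zero_of_trap hl R.lose_trap (R.owner_eq _) (by rw [htgt, if_pos hr]) hw,
        G.cylProb_eq_zero_of_trap hl R.lose_trap (R.owner_eq _) (by rw [htgt, if_pos hr]) hw]
    · simp only [Prog.target, if_neg hr] at hw
      cases w with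
      | nil => rw [Game.cylProb, Game.cylProb]
      | cons e w => exact absurd (R.mem_goal_iff.2 rfl) (G.firstHit_cons.1 hw).1

/-- The second trial starts when `p` equals c₁ + 8, and no clock is reset in between. So it has the
same parameters ℓ and m as the first trial and is independent of it. -/
theorem At.hit_first_trial (h : R.At ρ (.trial i b none) v) {ℓ m : ℝ}
    (hp : v ((P.op i b).p.clk b) = (P.op i b).c₁) (hq : v ((P.op i b).q.clk b) ≤ (P.op i b).c₂)
    (hℓ : ℓ = min ((P.op i b).c₂ - v ((P.op i b).q.clk b)) 8)
    (hm : m = (P.op i b).c₃ - v ((P.op i b).o.clk b)) :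
    G.hit σ τ R.goal ⊤ ρ = early ℓ m * late ℓ m + late ℓ m * early ℓ m := by
  have hlast : ∀ r t, G.last (ρ.snoc (t, R.ψ (.out i b none r))) =
      ⟨R.φ (.wait i b (some r)), fun x => (G.last ρ).val x + t⟩ := by
    intro r t
    rw [G.last_snoc, R.next_eq_delay _ _ rfl]
    rfl
  have hat : ∀ r t, 0 ≤ t → t ≤ 8 →
      R.At (ρ.snoc (t, R.ψ (.out i b none r))) (.wait i b (some r)) (fun c => v c + t) := by
    intro r t h0 h8
    have := h.snoc (e := .out i b none r) h0
    rw [Prog.after_of_reset_eq_nil rfl] at this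
    refine this fun a ha => ?_
    obtain rfl := List.mem_singleton.1 ha
    simp only [lag, hp]
    push_cast
    linarith
  rw [h.hit_trial (ℓ := ℓ) (m := m)]
  · have hval : ∀ r, G.hit σ τ R.goal ⊤ (ρ.snoc (0, R.ψ (.out i b none r))) =
        if r then late ℓ m else early ℓ m := by
      intro r
      -- After the representative delay 0 the clock `p` still shows c₁, so 8 time units remain.
      obtain ⟨h1, h2⟩ := (hat r 0 le_rfl (by norm_num)).hit_wait_of_le (σ := σ) (τ := τ) (d := 8)
        (by simp only [lag, hp]; push_cast; ring) (by simp only [lag]; push_cast; linarith)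
      rw [h1, h2.hit_second_trial]
      · rw [hℓ, hp]
        push_cast
        congr 1 <;> ring
      · rw [hm]
        push_cast
        ring
    rw [hval, hval]
    rfl
  · rw [hℓ, hp]
    simp only [lag]
    push_cast
    congr 1 <;> ring
  · rw [hm]
    simp [lag]
  · intro r t ht w _
    have ht' := (Prog.step_trial_iff.1 (h.canStep_iff.1 ht)).1
    have h8 : t ≤ 8 := by
      have := ht'.2.trans (min_le_right _ _)
      simp only [lag, hp] at this
      push_cast at this
      linarith
    have hat0 := hat r 0 le_rfl (by norm_num)
    have hatt := hat r t ht'.1 h8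
    have hbound : ∀ t, t ≤ 8 → v ((P.op i b).p.clk b) + t ≤ ((P.op i b).c₁ + lag (some r) : ℕ) := by
      intro t h
      simp only [lag, hp]
      push_cast
      linarith
    -- A delay t ≤ 8 in the first trial is compensated by waiting only 8 - t for the second one.
    refine (G.cylProb_eq_of_delay R.region_closed R.region_stoch ht'.1 (sub_nonneg.2 h8) ?_ ?_
      hat0.1 hatt.1 (R.dist_eq _) (R.dist_eq _) ?_ ?_ w).symm
    · rw [hlast, hlast]
      simp [Config.delay]
    · rw [hlast]
      exact ⟨.wait i b (some r), by simp only [Set.mem_ofPred_eq], rfl⟩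
    · intro u e he
      obtain ⟨e, rfl⟩ := R.ψ.surjective e
      have := ((Prog.step_wait_iff (hbound 0 (by norm_num))).1 (hat0.canStep_iff.1 he)).1
      rw [this, hp]
      simp only [lag]
      push_cast
      ring
    · intro u e he
      obtain ⟨e, rfl⟩ := R.ψ.surjective e
      have := ((Prog.step_wait_iff (hbound t h8)).1 (hatt.canStep_iff.1 he)).1
      rw [this, hp]
      simp only [lag]
      push_cast
      ring

/-- If the window is over before it begins, then the check is lost and both sides of the equivalence
are false. Otherwise `two_trials` bounds the probability, and its equality case says that m is the
midpoint of a window of positive length. -/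
theorem At.hit_check (h : R.At ρ (.wait i b none) v) :
    G.hit σ τ R.goal ⊤ ρ ≤ 1 / 2 ∧
      (G.hit σ τ R.goal ⊤ ρ = 1 / 2 ↔ (P.op i b).Balanced fun r => v (r.clk b)) := by
  set d := (P.op i b).c₁ - v ((P.op i b).p.clk b) with hd
  have hd' : d = ((P.op i b).c₁ + lag none : ℕ) - v ((P.op i b).p.clk b) := by simp [lag, hd]
  rcases le_or_gt (v ((P.op i b).q.clk b) + d) (P.op i b).c₂ with hq | hq
  · obtain ⟨h1, h2⟩ := h.hit_wait_of_le (σ := σ) (τ := τ) hd' (by simpa [lag] using hq)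
    have hℓ : 0 ≤ min ((P.op i b).c₂ - (v ((P.op i b).q.clk b) + d)) 8 :=
      le_min (by linarith) (by norm_num)
    rw [h1, h2.hit_first_trial (by rw [hd]; ring) hq rfl rfl]
    refine ⟨(two_trials (early_add_late _ hℓ)).1, ?_⟩
    rw [(two_trials (early_add_late _ hℓ)).2, early_eq_half_iff hℓ]
    rfl
  · rw [h.hit_wait_of_lt hd' (by simpa [lag] using hq)]
    refine ⟨zero_le, iff_of_false (fun h0 => ?_) fun hb => ?_⟩
    · simpa using congrArg ENNReal.toReal h0
    · have := lt_of_lt_of_le hb.1 (min_le_left _ _)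
      linarith

end Realizes
-- Moves of a program, and the upper bound 1/2
namespace Prog

variable {Q I : Type} {P : Prog Q I}

/-- The first moment of a check is never over when the check starts. -/
def WellFormed (P : Prog Q I) : Prop :=
  ∀ i b, (P.op i b).p = .per ∧ 4 ≤ (P.op i b).c₁ ∨ (P.op i b).p = .aux

theorem step_main {q : Q} {v : Clk → ℝ} {t : ℝ} {e : PEdge Q I} (h : P.Step (.main q) v t e) :
    e = .quit q ∨ ∃ i, e = .branch i ∧ P.src i = q ∧ v .per + t = 4 ∧
      (P.test i).Sat fun b => v (.reg b) + t := by
  cases e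
  case branch i =>
    obtain ⟨h1, -, h2, -⟩ := h
    refine .inr ⟨i, rfl, by simpa [source] using h1, ?_, fun a ha => ?_⟩
    · simpa [Cmp.Holds] using h2 (.per, .eq, 4) (by simp [guard])
    · exact h2 (.reg a.1, a.2) (List.mem_cons_of_mem _ (List.mem_map.2 ⟨a, ha, rfl⟩))
  case quit q' => exact .inl (by simpa [source] using h.1)
  case loop w => cases w <;> simp [Step, source] at h
  all_goals simp [Step, source] at h

theorem step_slot {i : I} {b : Bool} {v : Clk → ℝ} {t : ℝ} {e : PEdge Q I}
    (h : P.Step (.slot i b) v t e) : e = .skip i b ∨ e = .guess i b := by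
  cases e
  case loop w => cases w <;> simp [Step, source] at h
  all_goals simp [Step, source] at h ⊢
  all_goals exact h.1

theorem within_four_iff {l : PLoc Q I} (hl : P.bounds l = [(.per, 4)]) {v : Clk → ℝ} :
    P.Within l v ↔ v .per ≤ 4 := by
  simp [Within, hl]

theorem step_guess {i : I} {b : Bool} {v : Clk → ℝ} {t : ℝ} (ht : 0 ≤ t) (h4 : v .per + t ≤ 4) :
    P.Step (.slot i b) v t (.guess i b) := by
  refine ⟨rfl, ht, by simp [guard, Constraint.Sat], (within_four_iff rfl).2 h4, ?_⟩
  simpa [Within, target, bounds, after, reset] using h4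

theorem bounds_target_cont (i : I) (b : Bool) : P.bounds (P.target (.cont i b)) = [(.per, 4)] := by
  cases b <;> rfl

/-- The invariant `aux` ≤ 0 stops time. Well-formedness is what keeps `chk` possible: the clock `p`
of the check has not yet passed c₁. -/
theorem step_choice_iff (hP : P.WellFormed) {i : I} {b : Bool} {v : Clk → ℝ} {t : ℝ}
    {e : PEdge Q I} (hper : v .per ≤ 4) (haux : v .aux = 0) :
    P.Step (.choice i b) v t e ↔ t = 0 ∧ (e = .chk i b ∨ e = .cont i b) := by
  have ht : ∀ {e}, P.Step (.choice i b) v t e → t = 0 := fun h => by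
    have := h.2.2.2.1 (.aux, 0) (by simp [bounds])
    simp only [haux] at this
    push_cast at this
    linarith [h.2.1]
  constructor
  · intro h
    refine ⟨ht h, ?_⟩
    cases e
    case loop w => cases w <;> simp [Step, source] at h
    all_goals simp [Step, source] at h ⊢
    all_goals exact h.1
  · rintro ⟨rfl, rfl | rfl⟩
    · refine ⟨rfl, le_rfl, by simp [guard, Constraint.Sat], ?_, ?_⟩
      · simp [Within, bounds, hper, haux]
      · rw [after_of_reset_eq_nil rfl]
        intro a ha
        obtain rfl := List.mem_singleton.1 ha
        rcases hP i b with ⟨h1, h2⟩ | h1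
        · simp only [h1, Role.clk, lag]
          have : (4 : ℝ) ≤ (P.op i b).c₁ := by exact_mod_cast h2
          push_cast
          linarith
        · simp only [h1, Role.clk, haux]
          simpa using by positivity
    · refine ⟨rfl, le_rfl, by simp [guard, Constraint.Sat], ?_, ?_⟩
      · simp [Within, bounds, hper, haux]
      · rw [within_four_iff (bounds_target_cont i b)]
        simpa [after, reset] using hper

/-- The instruction `i` leads from the state `q` with register values `a` to the register values
`a'`. -/
def Move (P : Prog Q I) (q : Q) (a : Bool → ℝ) (i : I) (a' : Bool → ℝ) : Prop :=
  P.src i = q ∧ (P.test i).Sat a ∧ ∀ b, 0 ≤ a' b ∧ a' b ≤ 4 ∧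
    (P.op i b).Balanced fun
      | .reg => a b + (4 - a' b)
      | .per => 4 - a' b
      | .aux => 0

end Prog

/-- The locations where the runs of the program take place. -/
def PLoc.IsSim {Q I : Type} : PLoc Q I → Prop
  | .main _ | .slot _ _ | .choice _ _ => True
  | _ => False

namespace Realizes

variable {Q I L X E : Type} {P : Prog Q I} {G : Game L X E} {R : Realizes P G}
  {ρ : Path L X E} {i : I} {b : Bool} {v : Clk → ℝ}

theorem At.aux_eq_zero (h : R.At ρ (.choice i b) v) : v .aux = 0 := by
  have := h.within (.aux, 0) (by simp [Prog.bounds])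
  exact le_antisymm (by simpa using this) (h.nonneg _)

theorem At.per_le (h : R.At ρ (.choice i b) v) : v .per ≤ 4 := by
  simpa using h.within (.per, 4) (by simp [Prog.bounds])

theorem At.canStep_cont (hP : P.WellFormed) (h : R.At ρ (.choice i b) v) :
    G.CanStep (G.last ρ) 0 (R.ψ (.cont i b)) :=
  h.canStep_iff.2 ((Prog.step_choice_iff hP h.per_le h.aux_eq_zero).2 ⟨rfl, .inr rfl⟩)

theorem At.cont (hP : P.WellFormed) (h : R.At ρ (.choice i b) v) :
    R.At (ρ.snoc (0, R.ψ (.cont i b))) (P.target (.cont i b))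
      (fun c => if c = .reg b then 0 else v c) := by
  have := h.snoc' (h.canStep_iff.1 (h.canStep_cont hP))
  rw [Prog.after_of_reset_eq_singleton rfl] at this
  simpa only [add_zero] using this

theorem At.chk (hP : P.WellFormed) (h : R.At ρ (.choice i b) v) :
    R.At (ρ.snoc (0, R.ψ (.chk i b))) (.wait i b none) v := by
  have := h.snoc' ((Prog.step_choice_iff hP h.per_le h.aux_eq_zero (e := .chk i b)).2
    ⟨rfl, .inl rfl⟩)
  rw [Prog.after_of_reset_eq_nil rfl] at this
  simp only [add_zero] at this
  exact this

theorem At.guess (h : R.At ρ (.slot i b) v) {t : ℝ} (ht : 0 ≤ t) (h4 : v .per + t ≤ 4) :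
    R.At (ρ.snoc (t, R.ψ (.guess i b))) (.choice i b)
      (fun c => if c = .aux then 0 else v c + t) := by
  rw [← Prog.after_of_reset_eq_singleton (e := .guess i b) rfl]
  exact h.snoc' (Prog.step_guess ht h4)

theorem At.branch {q : Q} (h : R.At ρ (.main q) v) {t : ℝ} {i : I}
    (hs : P.Step (.main q) v t (.branch i)) :
    R.At (ρ.snoc (t, R.ψ (.branch i))) (.slot i true)
      (fun c => if c = .per then 0 else v c + t) := by
  rw [← Prog.after_of_reset_eq_singleton (e := .branch i) rfl]
  exact h.snoc' hs

variable [Fintype E] {σ τ : Path L X E → ℝ × E}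

theorem At.hit_choice (hP : P.WellFormed) (h : R.At ρ (.choice i b) v) {N : ℕ∞} :
    G.hit σ τ R.goal (N + 1) ρ = 1 / 2 * G.hit σ τ R.goal N (ρ.snoc (0, R.ψ (.chk i b))) +
      1 / 2 * G.hit σ τ R.goal N (ρ.snoc (0, R.ψ (.cont i b))) := by
  have hstep : ∀ t e, G.CanStep (G.last ρ) t (R.ψ e) ↔ t = 0 ∧ (e = .chk i b ∨ e = .cont i b) :=
    fun t e => h.canStep_iff.trans (Prog.step_choice_iff hP h.per_le h.aux_eq_zero)
  refine Game.hit_of_fair (h.not_mem (by simp)) (h.owner.trans rfl) h.1 (R.dist_eq _) (by simp)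
    ((hstep _ _).2 ⟨rfl, .inl rfl⟩) ((hstep _ _).2 ⟨rfl, .inr rfl⟩) (fun t e he => ?_)
    (R.weight_eq _) (R.weight_eq _)
  obtain ⟨e, rfl⟩ := R.ψ.surjective e
  simpa using (hstep t e).1 he

section UpperBound

variable (hP : P.WellFormed) (hσ : G.IsStrategy Owner.diamond σ)

include hP hσ

/-- Induction on the number of steps: giving up yields 0, other moves of Player `◇` lead to a
location of the same kind, and a choice averages a check, bounded by `At.hit_check`, and a
continuation, bounded by induction. -/
theorem hit_le_half_of_isSim (N : ℕ) {ρ : Path L X E} {l : PLoc Q I} {v : Clk → ℝ}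
    (h : R.At ρ l v) (hrun : G.IsRun ρ) (hl : l.IsSim) : G.hit σ τ R.goal N ρ ≤ 1 / 2 := by
  induction N generalizing ρ l v with
  | zero =>
    have := G.hit_zero σ τ R.goal (h.not_mem (by rintro rfl; exact hl))
    rw [Nat.cast_zero, this]
    exact zero_le
  | succ N ih =>
    rw [Nat.cast_succ]
    have hdia : Prog.owner l = .diamond → l ≠ .win → ∃ t e, P.Step l v t e ∧
        G.hit σ τ R.goal (N + 1) ρ = G.hit σ τ R.goal N (ρ.snoc (t, R.ψ e)) ∧
        R.At (ρ.snoc (t, R.ψ e)) (P.target e) (Prog.after v t e) ∧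
        G.IsRun (ρ.snoc (t, R.ψ e)) := by
      intro ho hw
      obtain ⟨e, he⟩ := R.ψ.surjective (σ ρ).2
      have hc := hσ.legal ρ hrun (h.owner.trans ho)
      have hpair : σ ρ = ((σ ρ).1, R.ψ e) := by rw [he]
      rw [← he, h.canStep_iff] at hc
      refine ⟨_, e, hc, ?_, h.snoc' hc, hrun.snoc _ (h.canStep_iff.2 hc)⟩
      rw [← hpair]
      exact G.hit_diamond σ τ R.goal (h.not_mem hw) (h.owner.trans ho)
    cases l with
    | main q =>
      obtain ⟨t, e, hs, heq, hat, hr⟩ := hdia rfl (by simp)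
      rw [heq]
      rcases Prog.step_main hs with rfl | ⟨i, rfl, -⟩
      · rw [hit_lose hat.2.1]
        exact zero_le
      · exact ih hat hr trivial
    | slot i b =>
      obtain ⟨t, e, hs, heq, hat, hr⟩ := hdia rfl (by simp)
      rw [heq]
      rcases Prog.step_slot hs with rfl | rfl
      · rw [hit_lose hat.2.1]
        exact zero_le
      · exact ih hat hr trivial
    | choice i b =>
      rw [h.hit_choice hP]
      have h1 : G.hit σ τ R.goal N (ρ.snoc (0, R.ψ (.chk i b))) ≤ 1 / 2 :=
        (G.hit_mono σ τ R.goal le_top _).trans (h.chk hP).hit_check.1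
      have h2 : G.hit σ τ R.goal N (ρ.snoc (0, R.ψ (.cont i b))) ≤ 1 / 2 :=
        ih (h.cont hP) (hrun.snoc _ (h.canStep_cont hP)) (by cases b <;> trivial)
      calc _ ≤ 1 / 2 * (1 / 2) + 1 / 2 * (1 / 2 : ℝ≥0∞) := by gcongr
        _ = 1 / 2 := by rw [← add_mul, ENNReal.add_halves, one_mul]
    | _ => exact hl.elim

theorem hit_top_le_half {ρ : Path L X E} {l : PLoc Q I} {v : Clk → ℝ}
    (h : R.At ρ l v) (hrun : G.IsRun ρ) (hl : l.IsSim) : G.hit σ τ R.goal ⊤ ρ ≤ 1 / 2 :=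
  G.hit_top_le σ τ R.goal fun N => hit_le_half_of_isSim hP hσ N h hrun hl

end UpperBound

/-- Both terms are at their maximum if their average is. Thus the value 1/2 of a choice passes to
its check and to its continuation. -/
theorem half_of_average {a b : ℝ≥0∞} (ha : a ≤ 1 / 2) (hb : b ≤ 1 / 2)
    (h : 1 / 2 * a + 1 / 2 * b = 1 / 2) : a = 1 / 2 ∧ b = 1 / 2 := by
  have ha' : a ≠ ∞ := fun h' => by simp [h'] at ha
  have hb' : b ≠ ∞ := fun h' => by simp [h'] at hb
  have h2 : (1 / 2 : ℝ≥0∞) = ((1 / 2 : NNReal) : ℝ≥0∞) := by simp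
  lift a to NNReal using ha'
  lift b to NNReal using hb'
  rw [h2] at *
  rw [← ENNReal.coe_mul, ← ENNReal.coe_mul, ← ENNReal.coe_add, ENNReal.coe_inj] at h
  rw [ENNReal.coe_le_coe] at ha hb
  rw [ENNReal.coe_inj, ENNReal.coe_inj]
  rw [← NNReal.coe_le_coe] at ha hb
  rw [← NNReal.coe_inj] at h ⊢
  rw [← NNReal.coe_inj]
  push_cast at *
  constructor <;> linarith

end Realizes
-- The value 1/2 forces correct moves
namespace Realizes

variable {Q I L X E : Type} {P : Prog Q I} {G : Game L X E} {R : Realizes P G} [Fintype E]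
  {σ τ : Path L X E → ℝ × E} {ρ : Path L X E} {i : I} {b : Bool} {v : Clk → ℝ}

theorem At.exists_step {l : PLoc Q I} (hσ : G.IsStrategy Owner.diamond σ) (hrun : G.IsRun ρ)
    (h : R.At ρ l v) (ho : Prog.owner l = .diamond) :
    ∃ t e, σ ρ = (t, R.ψ e) ∧ P.Step l v t e ∧
      G.hit σ τ R.goal ⊤ ρ = G.hit σ τ R.goal ⊤ (ρ.snoc (t, R.ψ e)) ∧
      G.IsRun (ρ.snoc (t, R.ψ e)) := by
  have hw : l ≠ .win := by rintro rfl; simp [Prog.owner] at ho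
  obtain ⟨e, he⟩ := R.ψ.surjective (σ ρ).2
  have hc := hσ.legal ρ hrun (h.owner.trans ho)
  have hpair : σ ρ = ((σ ρ).1, R.ψ e) := by rw [he]
  rw [← he] at hc
  refine ⟨_, e, hpair, h.canStep_iff.1 hc, ?_, hrun.snoc _ hc⟩
  rw [← hpair]
  have := G.hit_diamond σ τ R.goal (N := ⊤) (h.not_mem hw) (h.owner.trans ho)
  rwa [top_add] at this

/-- Skipping has value 0, so Player `◇` guesses. By `half_of_average` the check is balanced, and the
continuation keeps the value 1/2. -/
theorem At.exists_slot (hP : P.WellFormed) (hσ : G.IsStrategy Owner.diamond σ)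
    (hrun : G.IsRun ρ) (h : R.At ρ (.slot i b) v) (hh : G.hit σ τ R.goal ⊤ ρ = 1 / 2) :
    ∃ t, 0 ≤ t ∧ v .per + t ≤ 4 ∧
      ((P.op i b).Balanced fun r => if r.clk b = .aux then 0 else v (r.clk b) + t) ∧
      ∃ ρ', R.At ρ' (P.target (.cont i b))
          (fun c => if c = .reg b then 0 else if c = .aux then 0 else v c + t) ∧
        G.IsRun ρ' ∧ G.hit σ τ R.goal ⊤ ρ' = 1 / 2 := by
  obtain ⟨t, e, -, hs, heq, hr⟩ := h.exists_step hσ hrun rfl (τ := τ)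
  rw [heq] at hh
  rcases Prog.step_slot hs with rfl | rfl
  · rw [hit_lose (h.snoc' hs).2.1] at hh
    simpa using congrArg ENNReal.toReal hh
  · have h4 := (Prog.within_four_iff rfl).1 hs.2.2.2.1
    have hg := h.guess hs.2.1 h4
    have hc := hg.hit_choice hP (σ := σ) (τ := τ) (N := ⊤)
    rw [top_add, hh] at hc
    have hr' := hr.snoc _ (p := (0, R.ψ (.cont i b))) (hg.canStep_cont hP)
    have hcont := hg.cont hP
    obtain ⟨h1, h2⟩ := half_of_average (hg.chk hP).hit_check.1
      (hit_top_le_half hP hσ hcont hr' (by cases b <;> trivial)) hc.symm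
    exact ⟨t, hs.2.1, h4, (hg.chk hP).hit_check.2.1 h1, _, hcont, hr', h2⟩

/-- If Player `◇` attains the value `1 / 2`, then the program can make a move after which the value
is still `1 / 2`. -/
theorem At.exists_move (hP : P.WellFormed) (hσ : G.IsStrategy Owner.diamond σ)
    (hrun : G.IsRun ρ) {q : Q} (h : R.At ρ (.main q) v) (hh : G.hit σ τ R.goal ⊤ ρ = 1 / 2) :
    ∃ i a', P.Move q (fun b => v (.reg b) + (4 - v .per)) i a' ∧
      ∃ ρ' v', R.At ρ' (.main (P.tgt i)) v' ∧ G.IsRun ρ' ∧ G.hit σ τ R.goal ⊤ ρ' = 1 / 2 ∧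
        a' = fun b => v' (.reg b) + (4 - v' .per) := by
  obtain ⟨t, e, -, hs, heq, hr⟩ := h.exists_step hσ hrun rfl (τ := τ)
  rw [heq] at hh
  rcases Prog.step_main hs with rfl | ⟨i, rfl, hsrc, hper, htest⟩
  · rw [hit_lose (h.snoc' hs).2.1] at hh
    simpa using congrArg ENNReal.toReal hh
  · have ht : t = 4 - v .per := by linarith
    have hb := h.branch hs
    obtain ⟨t₁, h0, h4, hbal, ρ₁, hat₁, hr₁, hh₁⟩ := hb.exists_slot hP hσ hr hh
    obtain ⟨t₂, h0', h4', hbal', ρ₂, hat₂, hr₂, hh₂⟩ := At.exists_slot hP hσ hr₁ hat₁ hh₁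
    simp only [reduceCtorEq, if_false, if_true, zero_add] at *
    -- The register `true` is reset t₁ after the branch, the register `false` another t₂ later; 4
    -- minus this time is what the clock will show when `per` equals 4.
    refine ⟨i, fun b => 4 - if b then t₁ else t₁ + t₂, ⟨hsrc, ht ▸ htest, ?_⟩, ρ₂, _, hat₂, hr₂,
      hh₂, ?_⟩
    · rintro (_ | _)
      · refine ⟨by simpa using h4', by simp; linarith, ?_⟩
        convert hbal' using 1
        funext r
        cases r <;> simp [Role.clk, ht]
        ring
      · refine ⟨by simpa using h4, by simp; linarith, ?_⟩
        convert hbal using 1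
        funext r
        cases r <;> simp [Role.clk, ht]
    · funext b
      cases b <;> simp
      ring

end Realizes
-- An infinite computation yields a strategy with value 1/2
theorem Game.countable_preimage_path {L X E : Type} {S : Set (Path L X E)} (hS : S.Countable)
    (s : Config L X) {n : ℕ} (e : Fin n → E) (p : (Fin n → ℝ) → Prop) :
    {τ : {τ : Fin n → ℝ // p τ} |
      (⟨s, List.ofFn fun i => (τ.1 i, e i)⟩ : Path L X E) ∈ S}.Countable := by
  refine hS.preimage (f := fun τ : {τ : Fin n → ℝ // p τ} =>
    (⟨s, List.ofFn fun i => (τ.1 i, e i)⟩ : Path L X E)) fun τ₁ τ₂ h => ?_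
  have h' := List.ofFn_injective (Path.mk.inj h).2
  exact Subtype.ext (funext fun i => congrArg Prod.fst (congrFun h' i))

open Classical in
/-- A strategy that deviates from a trivial one on countably many runs only. -/
theorem Game.isStrategy_of_countable {L X E : Type} (G : Game L X E) {o : Owner}
    {S : Set (Path L X E)} (hS : S.Countable) (f : Path L X E → ℝ × E) (d : L → E)
    (hf : ∀ ρ ∈ S, G.IsRun ρ → G.owner (G.last ρ).loc = o →
      G.CanStep (G.last ρ) (f ρ).1 (f ρ).2)
    (hd : ∀ ρ, G.IsRun ρ → G.owner (G.last ρ).loc = o →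
      G.CanStep (G.last ρ) 0 (d (G.last ρ).loc)) :
    G.IsStrategy o fun ρ => if ρ ∈ S then f ρ else (0, d (G.last ρ).loc) where
  legal ρ h1 h2 := by
    by_cases h : ρ ∈ S
    · simpa only [if_pos h] using hf ρ h h1 h2
    · simpa only [if_neg h] using hd ρ h1 h2
  measurable_delay s n e := by
    refine (measurable_const (a := (0 : ℝ))).measurable_of_countable_ne
      ((countable_preimage_path hS s e _).mono fun τ hτ => ?_)
    by_contra h
    exact hτ (by simp only [if_neg (show _ ∉ S from h)])
  measurable_edge s n e e' := by
    set C := {τ : {τ : Fin n → ℝ // G.IsRun ⟨s, List.ofFn fun i => (τ i, e i)⟩ ∧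
      G.owner (G.last ⟨s, List.ofFn fun i => (τ i, e i)⟩).loc = o} |
      (⟨s, List.ofFn fun i => (τ.1 i, e i)⟩ : Path L X E) ∈ S} with hC
    have hcount : C.Countable := countable_preimage_path hS s e _
    -- The last location depends only on the edges. So outside the countable set `C` the proposed
    -- edge is constant, and the set in question is, up to countably many points, everything or
    -- empty.
    have hloc : ∀ τ : Fin n → ℝ, (G.last ⟨s, List.ofFn fun i => (τ i, e i)⟩).loc =
        G.locAfter s.loc (List.ofFn e) := by
      intro τ
      rw [G.last_loc, List.map_ofFn]
      rfl
    rw [← Set.inter_union_sdiff {τ | _} C]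
    refine (hcount.mono Set.inter_subset_right).measurableSet.union ?_
    by_cases hde : d (G.locAfter s.loc (List.ofFn e)) = e'
    · convert hcount.measurableSet.compl using 1
      ext τ
      simp only [Set.mem_sdiff, Set.mem_ofPred_eq, Set.mem_compl_iff, and_iff_right_iff_imp]
      intro h
      rw [if_neg (show _ ∉ S from h)]
      simp only [hloc, hde]
    · convert MeasurableSet.empty using 1
      ext τ
      simp only [Set.mem_sdiff, Set.mem_ofPred_eq, Set.mem_empty_iff_false, iff_false, not_and,
        not_not]
      intro h
      by_contra h'
      rw [if_neg (show _ ∉ S from h')] at h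
      simp only [hloc] at h
      exact hde h

namespace Realizes

variable {Q I L X E : Type} {P : Prog Q I} {G : Game L X E} {R : Realizes P G}
  {σ τ : Path L X E → ℝ × E} {ρ : Path L X E} {i : I} {b : Bool} {v : Clk → ℝ}

/-- The edge by which Player `◇` gives up. -/
def giveUp : PLoc Q I → PEdge Q I
  | .main q => .quit q
  | .slot i b => .skip i b
  | _ => .loop true

theorem at_of_isRun (R : Realizes P G) (h : G.IsRun ρ) :
    R.At ρ (R.φ.symm (G.last ρ).loc) (fun c => (G.last ρ).val (R.κ c)) :=
  ⟨h.isState_last, by simp, fun _ => rfl⟩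

theorem At.canStep_giveUp {l : PLoc Q I} (h : R.At ρ l v) (ho : Prog.owner l = .diamond) :
    G.CanStep (G.last ρ) 0 (R.ψ (giveUp l)) := by
  rw [h.canStep_iff]
  have hw := h.within
  cases l with
  | main q =>
    refine ⟨rfl, le_rfl, by simp [Prog.guard, giveUp, Constraint.Sat], by simpa using hw, ?_⟩
    simp [Prog.Within, Prog.after, Prog.bounds, Prog.reset, giveUp, Prog.target]
  | slot i b =>
    refine ⟨rfl, le_rfl, by simp [Prog.guard, giveUp, Constraint.Sat], by simpa using hw, ?_⟩
    simp [Prog.Within, Prog.after, Prog.bounds, Prog.reset, giveUp, Prog.target]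
  | _ => simp [Prog.owner] at ho

theorem At.hit_slot [Fintype E] (hP : P.WellFormed) (h : R.At ρ (.slot i b) v) {t : ℝ}
    (ht : 0 ≤ t) (h4 : v .per + t ≤ 4) (hσ : σ ρ = (t, R.ψ (.guess i b)))
    (hb : (P.op i b).Balanced fun r => if r.clk b = .aux then 0 else v (r.clk b) + t) :
    G.hit σ τ R.goal ⊤ ρ = 1 / 2 * (1 / 2) + 1 / 2 * G.hit σ τ R.goal ⊤
      ((ρ.snoc (t, R.ψ (.guess i b))).snoc (0, R.ψ (.cont i b))) := by
  have h1 := G.hit_diamond σ τ R.goal (N := ⊤) (h.not_mem (by simp)) (h.owner.trans rfl)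
  rw [top_add, hσ] at h1
  have hg := h.guess ht h4
  have h2 := hg.hit_choice hP (σ := σ) (τ := τ) (N := ⊤)
  rw [top_add, (hg.chk hP).hit_check.2.2 hb] at h2
  rw [h1, h2]

section Canonical

variable (R) (ρ₀ : Path L X E) (a : ℕ → Bool → ℝ) (ins : ℕ → I)

/-- The path after the branch of the period `k`, which starts at the path `m`. -/
def afterBranch (k : ℕ) (m : Path L X E) : Path L X E :=
  m.snoc (4 - (G.last m).val (R.κ .per), R.ψ (.branch (ins k)))

/-- The path after the first update of the period `k`, which starts at the path `m`. -/
def afterFirst (k : ℕ) (m : Path L X E) : Path L X E :=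
  ((R.afterBranch ins k m).snoc (4 - a (k + 1) true, R.ψ (.guess (ins k) true))).snoc
    (0, R.ψ (.cont (ins k) true))

/-- The path after the second update of the period `k`, which starts at the path `m`. -/
def afterSecond (k : ℕ) (m : Path L X E) : Path L X E :=
  ((R.afterFirst a ins k m).snoc
    (a (k + 1) true - a (k + 1) false, R.ψ (.guess (ins k) false))).snoc
      (0, R.ψ (.cont (ins k) false))

/-- The path that follows the instructions `ins` for `k` periods. -/
def canon : ℕ → Path L X E
  | 0 => ρ₀
  | k + 1 => R.afterSecond a ins k (canon k)

/-- The paths along `canon` after which Player `◇` has to move. -/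
def canonSet : Set (Path L X E) :=
  Set.range (R.canon ρ₀ a ins) ∪
    Set.range (fun k => R.afterBranch ins k (R.canon ρ₀ a ins k)) ∪
    Set.range (fun k => R.afterFirst a ins k (R.canon ρ₀ a ins k))

/-- The moves of Player `◇` along `canon`; the current step is known from the length of the path. -/
def canonMove (ρ : Path L X E) : ℝ × E :=
  if ρ.steps.length % 5 = 0 then
    (4 - (G.last ρ).val (R.κ .per), R.ψ (.branch (ins (ρ.steps.length / 5))))
  else if ρ.steps.length % 5 = 1 then
    (4 - a (ρ.steps.length / 5 + 1) true, R.ψ (.guess (ins (ρ.steps.length / 5)) true))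
  else
    (a (ρ.steps.length / 5 + 1) true - a (ρ.steps.length / 5 + 1) false,
      R.ψ (.guess (ins (ρ.steps.length / 5)) false))

open Classical in
/-- The strategy that follows `canon`. -/
def canonStrategy (ρ : Path L X E) : ℝ × E :=
  if ρ ∈ R.canonSet ρ₀ a ins then R.canonMove a ins ρ
  else (0, R.ψ (giveUp (R.φ.symm (G.last ρ).loc)))

variable {R ρ₀ a ins}

/-- A period has five steps: the branch, then `guess` and `cont` for each of the two registers. So
Player `◇` moves at the lengths 0, 1 and 3 modulo 5. -/
theorem length_canon (h₀ : ρ₀.steps = []) (k : ℕ) : (R.canon ρ₀ a ins k).steps.length = 5 * k := by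
  induction k with
  | zero => simp [canon, h₀]
  | succ k ih =>
    simp only [canon, afterSecond, afterFirst, afterBranch, Path.snoc, List.length_append, ih,
      List.length_singleton]
    ring

theorem canonStrategy_canon (h₀ : ρ₀.steps = []) (k : ℕ) :
    R.canonStrategy ρ₀ a ins (R.canon ρ₀ a ins k) =
      (4 - (G.last (R.canon ρ₀ a ins k)).val (R.κ .per), R.ψ (.branch (ins k))) := by
  rw [canonStrategy, if_pos (.inl (.inl ⟨k, rfl⟩)), canonMove, length_canon h₀,
    if_pos (by omega), show 5 * k / 5 = k by omega]

theorem canonStrategy_afterBranch (h₀ : ρ₀.steps = []) (k : ℕ) :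
    R.canonStrategy ρ₀ a ins (R.afterBranch ins k (R.canon ρ₀ a ins k)) =
      (4 - a (k + 1) true, R.ψ (.guess (ins k) true)) := by
  have hlen : (R.afterBranch ins k (R.canon ρ₀ a ins k)).steps.length = 5 * k + 1 := by
    simp [afterBranch, Path.snoc, length_canon h₀]
  rw [canonStrategy, if_pos (.inl (.inr ⟨k, rfl⟩)), canonMove, hlen, if_neg (by omega),
    if_pos (by omega), show (5 * k + 1) / 5 = k by omega]

theorem canonStrategy_afterFirst (h₀ : ρ₀.steps = []) (k : ℕ) :
    R.canonStrategy ρ₀ a ins (R.afterFirst a ins k (R.canon ρ₀ a ins k)) =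
      (a (k + 1) true - a (k + 1) false, R.ψ (.guess (ins k) false)) := by
  have hlen : (R.afterFirst a ins k (R.canon ρ₀ a ins k)).steps.length = 5 * k + 3 := by
    simp [afterFirst, afterBranch, Path.snoc, length_canon h₀]
  rw [canonStrategy, if_pos (.inr ⟨k, rfl⟩), canonMove, hlen, if_neg (by omega),
    if_neg (by omega), show (5 * k + 3) / 5 = k by omega]

variable {q : ℕ → Q} (hP : P.WellFormed)
  (hmove : ∀ k, P.Move (q k) (a k) (ins k) (a (k + 1)))
  (hq : ∀ k, q (k + 1) = P.tgt (ins k)) (hord : ∀ k, a (k + 1) false ≤ a (k + 1) true)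

/-- The values of the clocks after the branch of a period that starts with register values `a`. -/
def branchVal (a : Bool → ℝ) (x : ℝ) : Clk → ℝ
  | .reg b => a b
  | .per => 0
  | .aux => x

/-- The values of the clocks after the first update of a period. -/
def firstVal (a a' : Bool → ℝ) : Clk → ℝ
  | .reg true => 0
  | .reg false => a false + (4 - a' true)
  | .per => 4 - a' true
  | .aux => 0

/-- The values of the clocks after the second update of a period. -/
def secondVal (a' : Bool → ℝ) : Clk → ℝ
  | .reg true => a' true - a' false
  | .reg false => 0
  | .per => 4 - a' false
  | .aux => 0

include hmove in
theorem at_afterBranch {k : ℕ} {m : Path L X E} (hm : R.At m (.main (q k)) v)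
    (ha : ∀ b, v (.reg b) + (4 - v .per) = a k b) :
    G.CanStep (G.last m) (4 - (G.last m).val (R.κ .per)) (R.ψ (.branch (ins k))) ∧
      ∃ x, R.At (R.afterBranch ins k m) (.slot (ins k) true) (branchVal (a k) x) := by
  obtain ⟨hsrc, htest, -⟩ := hmove k
  have hper : v .per ≤ 4 := (Prog.within_four_iff rfl).1 hm.within
  have hs : P.Step (.main (q k)) v (4 - v .per) (.branch (ins k)) := by
    refine ⟨by rw [Prog.source, hsrc], by linarith, ?_, (Prog.within_four_iff rfl).2 (by simp), ?_⟩
    · refine List.forall_mem_cons.2 ⟨by simp [Cmp.Holds], ?_⟩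
      rw [List.forall_mem_map]
      intro c hc
      simp only [ha]
      exact htest c hc
    · exact (Prog.within_four_iff rfl).2 (by simp [Prog.after, Prog.reset])
  rw [hm.2.2]
  refine ⟨hm.canStep_iff.2 hs, v .aux + (4 - v .per), ?_⟩
  have := hm.branch hs
  rw [afterBranch, hm.2.2]
  convert this using 1
  funext c
  cases c <;> simp [branchVal, ha]

include hmove in
theorem at_afterFirst {k : ℕ} {m : Path L X E} {x : ℝ} (hP : P.WellFormed)
    (hm : R.At (R.afterBranch ins k m) (.slot (ins k) true) (branchVal (a k) x)) :
    R.At (R.afterFirst a ins k m) (.slot (ins k) false) (firstVal (a k) (a (k + 1))) := by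
  obtain ⟨-, -, h⟩ := hmove k
  have hg := hm.guess (t := 4 - a (k + 1) true) (by linarith [(h true).2.1])
    (by simp only [branchVal]; linarith [(h true).1])
  have := hg.cont hP
  rw [afterFirst]
  convert this using 1
  · rfl
  funext c
  rcases c with (_ | _) | _ | _ <;> simp [firstVal, branchVal]

include hmove hord in
theorem at_afterSecond {k : ℕ} {m : Path L X E} (hP : P.WellFormed)
    (hm : R.At (R.afterFirst a ins k m) (.slot (ins k) false) (firstVal (a k) (a (k + 1)))) :
    R.At (R.afterSecond a ins k m) (.main (P.tgt (ins k))) (secondVal (a (k + 1))) := by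
  obtain ⟨-, -, h⟩ := hmove k
  have hg := hm.guess (t := a (k + 1) true - a (k + 1) false) (by linarith [hord k])
    (by simp only [firstVal]; linarith [(h false).1])
  have := hg.cont hP
  rw [afterSecond]
  convert this using 1
  · rfl
  funext c
  rcases c with (_ | _) | _ | _ <;> simp [secondVal, firstVal]

include hP hmove hq hord in
theorem exists_at_canon {v₀ : Clk → ℝ} (h₀ : R.At ρ₀ (.main (q 0)) v₀)
    (ha : ∀ b, v₀ (.reg b) + (4 - v₀ .per) = a 0 b) (k : ℕ) :
    ∃ v, R.At (R.canon ρ₀ a ins k) (.main (q k)) v ∧ ∀ b, v (.reg b) + (4 - v .per) = a k b := by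
  induction k with
  | zero => exact ⟨v₀, h₀, ha⟩
  | succ k ih =>
    obtain ⟨v, hv, hav⟩ := ih
    obtain ⟨x, hx⟩ := (at_afterBranch hmove hv hav).2
    refine ⟨secondVal (a (k + 1)), ?_, fun b => ?_⟩
    · rw [hq]
      exact at_afterSecond hmove hord hP (at_afterFirst hmove hP hx)
    · cases b <;> simp [secondVal]

/-- If the program has an infinite computation, then Player `◇` attains the value `1 / 2`. -/
theorem exists_strategy [Fintype E] {v₀ : Clk → ℝ} (hP : P.WellFormed)
    (hmove : ∀ k, P.Move (q k) (a k) (ins k) (a (k + 1)))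
    (hq : ∀ k, q (k + 1) = P.tgt (ins k)) (hord : ∀ k, a (k + 1) false ≤ a (k + 1) true)
    (hs₀ : ρ₀.steps = []) (hr₀ : G.IsRun ρ₀) (h₀ : R.At ρ₀ (.main (q 0)) v₀)
    (ha : ∀ b, v₀ (.reg b) + (4 - v₀ .per) = a 0 b) :
    ∃ σ, G.IsStrategy Owner.diamond σ ∧ ∀ τ, G.hit σ τ R.goal ⊤ ρ₀ = 1 / 2 := by
  have hcan := exists_at_canon hP hmove hq hord h₀ ha
  have hbranch : ∀ k, ∃ x, R.At (R.afterBranch ins k (R.canon ρ₀ a ins k)) (.slot (ins k) true)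
      (branchVal (a k) x) := fun k => by
    obtain ⟨v, hv, hav⟩ := hcan k
    exact (at_afterBranch hmove hv hav).2
  have hfirst : ∀ k, R.At (R.afterFirst a ins k (R.canon ρ₀ a ins k)) (.slot (ins k) false)
      (firstVal (a k) (a (k + 1))) := fun k => by
    obtain ⟨x, hx⟩ := hbranch k
    exact at_afterFirst hmove hP hx
  have hnn := fun k b => (hmove k).2.2 b
  have hσ : G.IsStrategy Owner.diamond (R.canonStrategy ρ₀ a ins) := by
    refine G.isStrategy_of_countable (S := R.canonSet ρ₀ a ins) ?_ (R.canonMove a ins)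
      (fun l => R.ψ (giveUp (R.φ.symm l))) (fun ρ hρ _ _ => ?_) (fun ρ hr ho => ?_)
    · exact ((Set.countable_range _).union (Set.countable_range _)).union (Set.countable_range _)
    · have hval : R.canonMove a ins ρ = R.canonStrategy ρ₀ a ins ρ := by
        rw [canonStrategy, if_pos hρ]
      rw [hval]
      rcases hρ with (⟨k, rfl⟩ | ⟨k, rfl⟩) | ⟨k, rfl⟩
      · obtain ⟨v, hv, hav⟩ := hcan k
        rw [canonStrategy_canon hs₀]
        exact (at_afterBranch hmove hv hav).1
      · obtain ⟨x, hx⟩ := hbranch k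
        simp only [canonStrategy_afterBranch hs₀]
        refine hx.canStep_iff.2 (Prog.step_guess (by linarith [(hnn k true).2.1]) ?_)
        simp only [branchVal]
        linarith [(hnn k true).1]
      · simp only [canonStrategy_afterFirst hs₀]
        refine (hfirst k).canStep_iff.2 (Prog.step_guess (by linarith [hord k]) ?_)
        simp only [firstVal]
        linarith [(hnn k false).1]
    · have := R.at_of_isRun hr
      exact this.canStep_giveUp (this.owner.symm.trans ho)
  refine ⟨_, hσ, fun τ => le_antisymm (hit_top_le_half hP hσ h₀ hr₀ trivial) ?_⟩
  -- Both checks of a period have value 1/2; they are reached with the probabilities 1/2 and 1/4,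
  -- and the next period with probability 1/4.
  have hrec : ∀ k, G.hit (R.canonStrategy ρ₀ a ins) τ R.goal ⊤ (R.canon ρ₀ a ins k) =
      1 / 2 * (1 / 2) + 1 / 2 * (1 / 2 * (1 / 2) + 1 / 2 *
        G.hit (R.canonStrategy ρ₀ a ins) τ R.goal ⊤ (R.canon ρ₀ a ins (k + 1))) := by
    intro k
    obtain ⟨v, hv, hav⟩ := hcan k
    obtain ⟨x, hx⟩ := hbranch k
    have h1 := G.hit_diamond (R.canonStrategy ρ₀ a ins) τ R.goal (N := ⊤) (hv.not_mem (by simp))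
      (hv.owner.trans rfl)
    rw [top_add, canonStrategy_canon hs₀] at h1
    rw [h1]
    refine (hx.hit_slot hP (by linarith [(hnn k true).2.1]) ?_ (canonStrategy_afterBranch hs₀ k)
      ?_).trans ?_
    · simp only [branchVal]
      linarith [(hnn k true).1]
    · convert (hnn k true).2.2 using 1
      funext r
      cases r <;> simp [Role.clk, branchVal]
    · congr 2
      refine (hfirst k).hit_slot hP (by linarith [hord k]) ?_ (canonStrategy_afterFirst hs₀ k) ?_
      · simp only [firstVal]
        linarith [(hnn k false).1]
      · convert (hnn k false).2.2 using 1
        funext r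
        cases r <;> simp [Role.clk, firstVal]
        ring
  -- The recursion has the fixed point 1/2, and each unfolding divides the possible deficit by 4.
  -- The deficit is an additive term because subtraction in `ℝ≥0∞` is truncated.
  have hle : ∀ j k, (1 / 2 : ℝ≥0∞) ≤
      G.hit (R.canonStrategy ρ₀ a ins) τ R.goal ⊤ (R.canon ρ₀ a ins k) + (1 / 2 * (1 / 2)) ^ j := by
    intro j
    induction j with
    | zero => exact fun k => le_add_left (by rw [pow_zero]; exact ENNReal.half_le_self)
    | succ j ih =>
      intro k
      rw [hrec]
      calc (1 / 2 : ℝ≥0∞) = 1 / 2 * (1 / 2) + 1 / 2 * (1 / 2 * (1 / 2) + 1 / 2 * (1 / 2)) := by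
            rw [← add_mul, ENNReal.add_halves, one_mul, ← add_mul, ENNReal.add_halves, one_mul]
        _ ≤ 1 / 2 * (1 / 2) + 1 / 2 * (1 / 2 * (1 / 2) + 1 / 2 *
            (G.hit (R.canonStrategy ρ₀ a ins) τ R.goal ⊤ (R.canon ρ₀ a ins (k + 1)) +
              (1 / 2 * (1 / 2)) ^ j)) := by
            gcongr
            exact ih (k + 1)
        _ = _ := by ring
  have hlim : Filter.Tendsto (fun j : ℕ => G.hit (R.canonStrategy ρ₀ a ins) τ R.goal ⊤ ρ₀ +
      (1 / 2 * (1 / 2) : ℝ≥0∞) ^ j) Filter.atTop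
      (nhds (G.hit (R.canonStrategy ρ₀ a ins) τ R.goal ⊤ ρ₀ + 0)) := by
    refine Filter.Tendsto.const_add _ (ENNReal.tendsto_pow_atTop_nhds_zero_of_lt_one ?_)
    rw [one_div, ← ENNReal.mul_inv (by simp) (by simp), ENNReal.inv_lt_one]
    norm_num
  rw [add_zero] at hlim
  exact ge_of_tendsto' hlim fun j => hle j 0

end Canonical

end Realizes
-- The game of a program is a nonblocking stochastic timed game
namespace Prog

variable {Q I : Type} {P : Prog Q I}

/-- The only delicate case is a second trial: its source contains the first outcome, so `win` or
`lose` determines the second one. Guards need not be compared for the distinctness of edges. -/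
theorem source_target_injective :
    Function.Injective fun e : PEdge Q I => (P.source e, P.target e) := by
  intro e e' h
  rw [Prod.mk.injEq] at h
  obtain ⟨hs, ht⟩ := h
  rcases e with _ | _ | _ | _ | ⟨i, _ | _⟩ | _ | _ | _ | ⟨i, b, _ | s, r⟩ | (_ | _) <;>
    rcases e' with _ | _ | _ | _ | ⟨i', _ | _⟩ | _ | _ | _ | ⟨i', b', _ | s', r'⟩ | (_ | _) <;>
    simp_all [source, target]
  obtain ⟨rfl, rfl, rfl⟩ := hs
  cases s <;> cases r <;> cases r' <;> simp_all

theorem exists_mem_bounds (l : PLoc Q I) : ∃ a, a ∈ P.bounds l := by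
  cases l <;> exact ⟨_, List.mem_cons_self⟩

theorem Step.le_bound {l : PLoc Q I} {v : Clk → ℝ} {t : ℝ} {e : PEdge Q I}
    (h : P.Step l v t e) (hv : ∀ c, 0 ≤ v c) {a : Clk × ℕ} (ha : a ∈ P.bounds l) : t ≤ a.2 := by
  have := h.2.2.2.1 a ha
  linarith [hv a.1]

/-- Player `◇` can give up at once, `cont` needs no delay, and in a check the alternatives
`go`/`fail` and early/late are exhaustive. -/
theorem exists_step {l : PLoc Q I} {v : Clk → ℝ} (hw : P.Within l v) : ∃ t e, P.Step l v t e := by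
  have hw0 : P.Within l fun c => v c + 0 := by simpa using hw
  cases l with
  | main q =>
    refine ⟨0, .quit q, rfl, le_rfl, by simp [guard, Constraint.Sat], hw0, ?_⟩
    simp [Within, after, bounds, reset, target]
  | slot i b =>
    refine ⟨0, .skip i b, rfl, le_rfl, by simp [guard, Constraint.Sat], hw0, ?_⟩
    simp [Within, after, bounds, reset, target]
  | choice i b =>
    have h4 := hw (.per, 4) (by simp [bounds])
    refine ⟨0, .cont i b, rfl, le_rfl, by simp [guard, Constraint.Sat], hw0, ?_⟩
    cases b <;> simpa [Within, after, bounds, reset, target] using h4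
  | wait i b s =>
    have hp := hw _ List.mem_cons_self
    rcases le_or_gt (v ((P.op i b).q.clk b) + (((P.op i b).c₁ + lag s : ℕ) -
        v ((P.op i b).p.clk b))) ((P.op i b).c₂ + lag s : ℕ) with h | h
    · exact ⟨_, _, (step_wait_iff hp).2 ⟨rfl, Or.inl ⟨rfl, h⟩⟩⟩
    · exact ⟨_, _, (step_wait_iff hp).2 ⟨rfl, Or.inr ⟨rfl, h⟩⟩⟩
  | trial i b s =>
    have h0 : (0 : ℝ) ∈ Set.Icc 0 (min (((P.op i b).c₂ + lag s : ℕ) - v ((P.op i b).q.clk b))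
        (((P.op i b).c₁ + lag s + 8 : ℕ) - v ((P.op i b).p.clk b))) :=
      ⟨le_rfl, le_min (sub_nonneg.2 (hw _ List.mem_cons_self))
        (sub_nonneg.2 (hw _ (List.mem_cons_of_mem _ List.mem_cons_self)))⟩
    rcases lt_or_ge 0 (((P.op i b).c₃ + lag s : ℕ) - v ((P.op i b).o.clk b)) with h | h
    · exact ⟨0, _, step_trial_iff.2 ⟨h0, Or.inl ⟨rfl, h⟩⟩⟩
    · exact ⟨0, _, step_trial_iff.2 ⟨h0, Or.inr ⟨rfl, h⟩⟩⟩
  | win =>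
    refine ⟨0, .loop true, rfl, le_rfl, by simp [guard, Constraint.Sat], hw0, ?_⟩
    simp [Within, after, bounds, reset, target]
  | lose =>
    refine ⟨0, .loop false, rfl, le_rfl, by simp [guard, Constraint.Sat], hw0, ?_⟩
    simp [Within, after, bounds, reset, target]

end Prog

namespace Realizes

variable {Q I L X E : Type} {P : Prog Q I} {G : Game L X E}

theorem at_of_isState (R : Realizes P G) {s : Config L X} (h : G.IsState s) :
    R.At ⟨s, []⟩ (R.φ.symm s.loc) (fun c => s.val (R.κ c)) :=
  R.at_of_isRun (ρ := ⟨s, []⟩) h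

theorem nonBlocking (R : Realizes P G) : G.NonBlocking := by
  intro s hs
  have h := R.at_of_isState hs
  obtain ⟨t, e, ht⟩ := Prog.exists_step h.within
  exact ⟨t, Set.mem_iUnion.2 ⟨R.ψ e, h.canStep_iff.2 ht⟩⟩

theorem isBounded_delays (R : Realizes P G) {s : Config L X} (hs : G.IsState s) :
    Bornology.IsBounded (G.delays s) := by
  have h := R.at_of_isState hs
  obtain ⟨a, ha⟩ := P.exists_mem_bounds (R.φ.symm s.loc)
  refine (Metric.isBounded_Icc (0 : ℝ) a.2).subset fun t ht => ?_
  obtain ⟨e, he⟩ := Set.mem_iUnion.1 ht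
  obtain ⟨e, rfl⟩ := R.ψ.surjective e
  have := h.canStep_iff.1 he
  exact ⟨this.2.1, this.le_bound h.nonneg ha⟩

theorem edgesDistinct (R : Realizes P G) : G.EdgesDistinct := by
  intro e e' h
  obtain ⟨e, rfl⟩ := R.ψ.surjective e
  obtain ⟨e', rfl⟩ := R.ψ.surjective e'
  simp only [Prod.mk.injEq, R.src_eq, R.tgt_eq, R.φ.apply_eq_iff_eq] at h
  rw [P.source_target_injective (Prod.ext h.1 h.2.2.2)]

theorem isSTG [Finite L] [Finite X] [Finite E] (R : Realizes P G) : G.IsSTG :=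
  G.isSTG_of_uniform R.edgesDistinct (fun e => by rw [R.weight_eq]; exact one_pos) R.dist_eq
    (fun _ => R.isBounded_delays) R.nonBlocking

theorem isOneAndHalfPlayer (R : Realizes P G) : G.IsOneAndHalfPlayer := by
  intro l
  obtain ⟨l, rfl⟩ := R.φ.surjective l
  rw [R.owner_eq]
  cases l <;> simp [Prog.owner]

theorem hasUniformDelays (R : Realizes P G) : G.HasUniformDelays :=
  fun s hs => ⟨R.isBounded_delays hs, fun _ => R.dist_eq s⟩

end Realizes

/-! ## Programs as instances -/

namespace Prog

variable {Q I : Type} (P : Prog Q I) {n N M : ℕ}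

/-- The description of a location of the game of `P`. -/
def locCode (κ : Clk → Fin n) (l : PLoc Q I) : LocCode n where
  owner := owner l
  inv := (P.bounds l).map fun a => (κ a.1, Cmp.le, a.2)
  isTarget := match l with
    | .win => true
    | _ => false

/-- The description of an edge of the game of `P`. -/
def edgeCode (φ : PLoc Q I ≃ Fin (N + 1)) (κ : Clk → Fin n) (e : PEdge Q I) : EdgeCode n where
  src := φ (P.source e)
  tgt := φ (P.target e)
  guard := (P.guard e).map fun a => (κ a.1, a.2)
  reset := (reset e).map κ
  weight := 1

/-- The game of `P` as an instance of the reachability problem with threshold `= 1 / 2`. -/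
def toInstance (φ : PLoc Q I ≃ Fin (N + 1)) (ψ : PEdge Q I ≃ Fin M) (κ : Clk → Fin n)
    (x : Fin n → ℕ) (d : ℕ) : Instance n where
  initLoc := P.locCode κ (φ.symm 0)
  otherLocs := List.ofFn fun i : Fin N => P.locCode κ (φ.symm i.succ)
  edges := List.ofFn fun i => P.edgeCode φ κ (ψ.symm i)
  initVal := x
  initDen := d
  cmp := .eq
  num := 1
  den := 2

variable (φ : PLoc Q I ≃ Fin (N + 1)) (ψ : PEdge Q I ≃ Fin M) (κ : Clk → Fin n)
    (x : Fin n → ℕ) (d : ℕ)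

/-- The initial location is stored apart from the others; put in front of them, it completes the
list of all codes in the order of `φ`. -/
theorem locCode_toInstance (l : PLoc Q I)
    (h : N + 1 = (P.toInstance φ ψ κ x d).otherLocs.length + 1) :
    (P.toInstance φ ψ κ x d).locCode (finCongr h (φ l)) = P.locCode κ l := by
  have key : ∀ (i : Fin (N + 1)) (l : List (LocCode n)) (h : N + 1 = l.length),
      l = (List.ofFn fun i => P.locCode κ (φ.symm i)) →
      l.get (finCongr h i) = P.locCode κ (φ.symm i) := by
    rintro i _ h rfl
    rw [List.get_ofFn]
    rfl
  exact (key (φ l) (_ :: _) h (List.ofFn_succ (f := fun i => P.locCode κ (φ.symm i))).symm).trans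
    (congrArg _ (φ.symm_apply_apply l))

theorem get_edges_toInstance (e : PEdge Q I) (h : M = (P.toInstance φ ψ κ x d).edges.length) :
    (P.toInstance φ ψ κ x d).edges.get (finCongr h (ψ e)) = P.edgeCode φ κ e := by
  refine (List.get_ofFn _ _).trans ?_
  exact congrArg _ (ψ.symm_apply_apply e)

theorem ofNat_eq_finCongr {N K : ℕ} (i : Fin (N + 1)) (h : N + 1 = K + 1) :
    Fin.ofNat (K + 1) i = finCongr h i :=
  Fin.ext (Nat.mod_eq_of_lt (h ▸ i.2))

/-- The instance describes the game of `P`. -/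
def realizes (hκ : Function.Injective κ) : Realizes P (P.toInstance φ ψ κ x d).game where
  φ := φ.trans (finCongr (by simp [toInstance]))
  ψ := ψ.trans (finCongr (by simp [toInstance]))
  κ := κ
  κ_inj := hκ
  src_eq e := by
    simp only [Instance.game, Instance.automaton, Equiv.trans_apply, get_edges_toInstance]
    exact ofNat_eq_finCongr _ _
  tgt_eq e := by
    simp only [Instance.game, Instance.automaton, Equiv.trans_apply, get_edges_toInstance]
    exact ofNat_eq_finCongr _ _
  guard_eq e := by
    simp only [Instance.game, Instance.automaton, Equiv.trans_apply, get_edges_toInstance]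
    rfl
  reset_eq e := by
    simp only [Instance.game, Instance.automaton, Equiv.trans_apply, get_edges_toInstance]
    simp only [edgeCode, List.mem_map]
  inv_eq l := by
    simp only [Instance.game, Instance.automaton, Equiv.trans_apply, locCode_toInstance]
    rfl
  owner_eq l := by
    simp only [Instance.game, Equiv.trans_apply, locCode_toInstance]
    rfl
  weight_eq e := by
    obtain ⟨e, rfl⟩ := (ψ.trans (finCongr (by simp [toInstance] :
      M = (P.toInstance φ ψ κ x d).edges.length))).surjective e
    simp only [Instance.game, Equiv.trans_apply, get_edges_toInstance]
    rfl
  dist_eq s := rfl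

variable {φ ψ κ x d}

theorem targets_toInstance (hκ : Function.Injective κ) :
    (P.toInstance φ ψ κ x d).targets = (P.realizes φ ψ κ x d hκ).goal := by
  ext l
  obtain ⟨l, rfl⟩ := (P.realizes φ ψ κ x d hκ).φ.surjective l
  rw [Realizes.mem_goal_iff]
  simp only [Instance.targets, realizes, Equiv.trans_apply, Set.mem_ofPred_eq, locCode_toInstance]
  cases l <;> simp [locCode]

variable {q₀ : Q} (hφ : φ (.main q₀) = 0)

include hφ in
theorem at_init (hκ : Function.Injective κ) (hper : x (κ .per) ≤ 4 * d) (hd : 0 < d) :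
    (P.realizes φ ψ κ x d hκ).At ⟨(P.toInstance φ ψ κ x d).init, []⟩ (.main q₀)
      (fun c => x (κ c) / d) := by
  have hl : (P.toInstance φ ψ κ x d).init.loc = (P.realizes φ ψ κ x d hκ).φ (.main q₀) := by
    ext
    simp [realizes, hφ, Instance.init]
  refine ⟨⟨fun c => div_nonneg (Nat.cast_nonneg _) (Nat.cast_nonneg _), ?_⟩, hl, fun _ => rfl⟩
  change ((P.toInstance φ ψ κ x d).game.inv (P.toInstance φ ψ κ x d).init.loc).Sat _
  rw [hl, Realizes.sat_inv_iff]
  have hd' : (0 : ℝ) < d := by exact_mod_cast hd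
  have : (x (κ .per) : ℝ) / d ≤ 4 := by
    rw [div_le_iff₀ hd']
    exact_mod_cast hper
  exact List.forall_mem_singleton.2 (by exact_mod_cast this)

include hφ in
theorem isQuantitative_toInstance (hκ : Function.Injective κ) (hper : x (κ .per) ≤ 4 * d)
    (hd : 0 < d) : (P.toInstance φ ψ κ x d).IsQuantitative where
  isSTG := (P.realizes φ ψ κ x d hκ).isSTG
  isOneAndHalfPlayer := (P.realizes φ ψ κ x d hκ).isOneAndHalfPlayer
  hasUniformDelays := (P.realizes φ ψ κ x d hκ).hasUniformDelays
  nonBlocking := (P.realizes φ ψ κ x d hκ).nonBlocking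
  initDen_pos := hd
  isState_init := (P.at_init hφ hκ hper hd).1
  threshold_pos := one_pos
  threshold_lt_one := one_lt_two

/-- An infinite computation of the program `P`. -/
structure IsComputation (q : ℕ → Q) (ins : ℕ → I) (a : ℕ → Bool → ℝ) : Prop where
  move : ∀ k, P.Move (q k) (a k) (ins k) (a (k + 1))
  tgt : ∀ k, q (k + 1) = P.tgt (ins k)

end Prog

/-- Dependent choice along `At.exists_move`, over the pairs of a state and register values that
belong to some run with value 1/2. -/
theorem Realizes.exists_isComputation {Q I L X E : Type} [Fintype E] {P : Prog Q I}
    {G : Game L X E} {R : Realizes P G} {σ τ : Path L X E → ℝ × E} (hP : P.WellFormed)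
    (hσ : G.IsStrategy .diamond σ) {ρ : Path L X E} {q₀ : Q} {v : Clk → ℝ} (hr : G.IsRun ρ)
    (h : R.At ρ (.main q₀) v) (hh : G.hit σ τ R.goal ⊤ ρ = 1 / 2) :
    ∃ q ins a, P.IsComputation q ins a ∧ q 0 = q₀ ∧
      ∀ b, a 0 b = v (.reg b) + (4 - v .per) := by
  let S : Q × (Bool → ℝ) → Prop := fun p => ∃ ρ v, R.At ρ (.main p.1) v ∧ G.IsRun ρ ∧
    G.hit σ τ R.goal ⊤ ρ = 1 / 2 ∧ p.2 = fun b => v (.reg b) + (4 - v .per)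
  have hS : ∀ p : Subtype S, ∃ i, ∃ p' : Subtype S, P.Move p.1.1 p.1.2 i p'.1.2 ∧
      p'.1.1 = P.tgt i := by
    rintro ⟨⟨q, a⟩, ρ, v, h, hr, hh, ha⟩
    obtain ⟨i, a', hm, ρ', v', h', hr', hh', ha'⟩ := h.exists_move hP hσ hr hh
    exact ⟨i, ⟨(P.tgt i, a'), ρ', v', h', hr', hh', ha'⟩, by rw [← ha] at hm; exact hm, rfl⟩
  choose i nxt hm ht using hS
  let s : ℕ → Subtype S := fun k => nxt^[k] ⟨(q₀, fun b => v (.reg b) + (4 - v .per)),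
    ρ, v, h, hr, hh, rfl⟩
  have hs : ∀ k, s (k + 1) = nxt (s k) := fun k => Function.iterate_succ_apply' ..
  refine ⟨fun k => (s k).1.1, fun k => i (s k), fun k => (s k).1.2,
    ⟨fun k => ?_, fun k => ?_⟩, rfl, fun _ => rfl⟩
  · simp only [hs]
    exact hm _
  · simp only [hs]
    exact ht _

namespace Prog

variable {Q I : Type} {P : Prog Q I} {n N M : ℕ} {φ : PLoc Q I ≃ Fin (N + 1)}
  {ψ : PEdge Q I ≃ Fin M} {κ : Clk → Fin n} {x : Fin n → ℕ} {d : ℕ} {q₀ : Q}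

theorem threshold_toInstance : (P.toInstance φ ψ κ x d).threshold = 1 / 2 := by
  simp [Instance.threshold, toInstance]

theorem exists_isComputation_of_isPositive (hφ : φ (.main q₀) = 0) (hκ : Function.Injective κ)
    (hper : x (κ .per) ≤ 4 * d) (hd : 0 < d) (hP : P.WellFormed)
    (h : (P.toInstance φ ψ κ x d).IsPositive) :
    ∃ q ins a, P.IsComputation q ins a ∧ q 0 = q₀ ∧
      ∀ b, a 0 b = (x (κ (.reg b)) : ℝ) / d + (4 - (x (κ .per) : ℝ) / d) := by
  obtain ⟨σ, hσ, h⟩ := h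
  have hinit := P.at_init (ψ := ψ) hφ hκ hper hd
  have hr : (P.toInstance φ ψ κ x d).game.IsRun ⟨(P.toInstance φ ψ κ x d).init, []⟩ := hinit.1
  -- Some strategy of Player `□` is needed in order to use the hypothesis; any function will do, for
  -- instance `σ`.
  have h := h σ (Game.IsStrategy.of_forall_ne _ (P.realizes φ ψ κ x d hκ).isOneAndHalfPlayer σ)
  rw [Game.reachProb_eq_hit, P.targets_toInstance hκ, threshold_toInstance] at h
  exact Realizes.exists_isComputation hP hσ hr hinit h

theorem isPositive_of_isComputation (hφ : φ (.main q₀) = 0) (hκ : Function.Injective κ)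
    (hper : x (κ .per) ≤ 4 * d) (hd : 0 < d) (hP : P.WellFormed) {q : ℕ → Q} {ins : ℕ → I}
    {a : ℕ → Bool → ℝ} (hc : P.IsComputation q ins a) (hq : q 0 = q₀)
    (ha : ∀ b, a 0 b = (x (κ (.reg b)) : ℝ) / d + (4 - (x (κ .per) : ℝ) / d))
    (hord : ∀ k, a (k + 1) false ≤ a (k + 1) true) :
    (P.toInstance φ ψ κ x d).IsPositive := by
  have hinit := P.at_init (ψ := ψ) (q₀ := q 0) (by rw [hq, hφ]) hκ hper hd
  have hr : (P.toInstance φ ψ κ x d).game.IsRun ⟨(P.toInstance φ ψ κ x d).init, []⟩ := hinit.1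
  obtain ⟨σ, hσ, h⟩ := Realizes.exists_strategy hP hc.move hc.tgt hord rfl hr hinit
    fun b => (ha b).symm
  refine ⟨σ, hσ, fun τ _ => ?_⟩
  rw [Game.reachProb_eq_hit, P.targets_toInstance hκ, threshold_toInstance]
  exact h τ

end Prog
end STG

/-! ### Computations that do not halt -/

open Turing StateTransition

/-- A computation does not halt if and only if it gives rise to an infinite sequence of steps. -/
theorem StateTransition.not_dom_eval_iff {σ : Type*} {f : σ → Option σ} {a : σ} :
    ¬ (StateTransition.eval f a).Dom ↔
      ∃ s : ℕ → σ, s 0 = a ∧ ∀ k, f (s k) = some (s (k + 1)) := by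
  constructor
  · intro h
    have hS : ∀ c : {c // StateTransition.Reaches f a c},
        ∃ c' : {c // StateTransition.Reaches f a c}, f c.1 = some c'.1 := by
      rintro ⟨c, hc⟩
      rcases hf : f c with _ | c'
      · exact absurd (Part.dom_iff_mem.2 ⟨c, StateTransition.mem_eval.2 ⟨hc, hf⟩⟩) h
      · exact ⟨⟨c', hc.tail hf⟩, rfl⟩
    choose g hg using hS
    have ha : StateTransition.Reaches f a a := Relation.ReflTransGen.refl
    refine ⟨fun k => (g^[k] ⟨a, ha⟩).1, rfl, fun k => ?_⟩
    simp only [Function.iterate_succ_apply']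
    exact hg _
  · rintro ⟨s, hs, hf⟩ h
    obtain ⟨b, hb⟩ := Part.dom_iff_mem.1 h
    revert s
    -- Induction along the terminating computation: the shifted sequence is infinite as well and
    -- starts one step later.
    refine StateTransition.evalInduction (C := fun a => ∀ s : ℕ → σ, s 0 = a →
      (∀ k, f (s k) = some (s (k + 1))) → False) hb ?_
    rintro a - ih s rfl hs
    exact ih _ (hs 0) (fun k => s (k + 1)) rfl fun k => hs (k + 1)

namespace STG

/-! ## The value of a one-sided binary tape -/

/-- The number with a given binary expansion after the point. -/
def binaryValue : List Bool → ℝ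
  | [] => 0
  | b :: l => (b.toNat + binaryValue l) / 2

/-- Blanks are zeros after the point, so the value is well defined on half-tapes up to trailing
blanks. -/
theorem binaryValue_append_replicate (l : List Bool) (n : ℕ) :
    binaryValue (l ++ List.replicate n false) = binaryValue l := by
  induction l with
  | nil => induction n with
    | zero => rfl
    | succ n ih => simpa [binaryValue, List.replicate_succ] using ih
  | cons b l ih => simp [binaryValue, ih]

theorem binaryValue_mem (l : List Bool) : binaryValue l ∈ Set.Ico 0 1 := by
  induction l with
  | nil => simp [binaryValue]
  | cons b l ih =>
    obtain ⟨h0, h1⟩ := ih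
    cases b <;> simp only [binaryValue, Bool.toNat_true, Bool.toNat_false, Nat.cast_one,
      Nat.cast_zero] <;> exact ⟨by linarith, by linarith⟩

/-- The value of one side of the tape. -/
def tapeValue (L : ListBlank Bool) : ℝ :=
  L.liftOn binaryValue fun l l' ⟨n, h⟩ => by
    rw [h]
    exact (binaryValue_append_replicate l n).symm

theorem tapeValue_mk (l : List Bool) : tapeValue (ListBlank.mk l) = binaryValue l := rfl

theorem tapeValue_cons (b : Bool) (L : ListBlank Bool) :
    tapeValue (L.cons b) = (b.toNat + tapeValue L) / 2 :=
  L.induction_on fun _ => rfl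

/-- Doubling shifts the binary expansion by one place, and the first cell becomes the integer part.
-/
theorem two_mul_tapeValue (L : ListBlank Bool) :
    2 * tapeValue L = L.head.toNat + tapeValue L.tail := by
  rw [← L.cons_head_tail, tapeValue_cons, L.cons_head_tail]
  ring

theorem tapeValue_nonneg (L : ListBlank Bool) : 0 ≤ tapeValue L :=
  L.induction_on fun l => (binaryValue_mem l).1

theorem tapeValue_lt_one (L : ListBlank Bool) : tapeValue L < 1 :=
  L.induction_on fun l => (binaryValue_mem l).2

/-- The register values that encode a tape. -/
def tapeRegs (T : Tape Bool) : Bool → ℝ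
  | false => 2 * tapeValue T.left
  | true => 2 + 2 * tapeValue T.right₀

/-- The offset 2 separates the ranges [0, 2) and [2, 4). The game needs this order, because it
resets the register `true` first, and an earlier reset means a larger value. -/
theorem tapeRegs_le (T : Tape Bool) : tapeRegs T false ≤ tapeRegs T true := by
  simp only [tapeRegs]
  linarith [tapeValue_lt_one T.left, tapeValue_nonneg T.right₀]

theorem tapeRegs_nonneg (T : Tape Bool) (b : Bool) : 0 ≤ tapeRegs T b := by
  cases b <;> simp only [tapeRegs] <;>
    linarith [tapeValue_nonneg T.left, tapeValue_nonneg T.right₀]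

theorem tapeRegs_lt (T : Tape Bool) (b : Bool) : tapeRegs T b < 4 := by
  cases b <;> simp only [tapeRegs] <;>
    linarith [tapeValue_lt_one T.left, tapeValue_lt_one T.right₀]

/-! ## The program of a Turing machine -/

namespace Check

/-- The check of an update of the form `a' = a / 2 + const`. -/
def half (c : ℕ) : Check := ⟨.per, .reg, .aux, 4, 8, c⟩

/-- The check of an update of the form `a' = 2 a + const`. -/
def double (c : ℕ) : Check := ⟨.aux, .per, .reg, 0, 6, c⟩

/-- The check of an update of the form `a' = a + const`. -/
def shift (c : ℕ) : Check := ⟨.aux, .aux, .reg, 0, 2, c⟩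

variable {c : ℕ} {a a' : ℝ}

/-- The window opens when `per` = 4, which is a' after the start; then `reg` shows a + 4 and reaches
8 after 4 - a more time units, while `aux` shows a' and should reach c halfway. The strict bound a <
4 keeps the window nondegenerate. -/
theorem balanced_half (h0 : 0 ≤ a) (h4 : a < 4) :
    (half c).Balanced (fun | .reg => a + (4 - a') | .per => 4 - a' | .aux => 0) ↔
      2 * a' = a + 2 * c - 4 := by
  simp only [Balanced, half, Nat.cast_ofNat]
  rw [min_eq_left (by linarith)]
  exact ⟨fun h => by linarith [h.2], fun h => ⟨by linarith, by linarith⟩⟩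

/-- The window opens at once and lasts until `per` = 6, for the time 2 + a'. The register clock
should reach c halfway. -/
theorem balanced_double (h0 : 0 ≤ a') (h4 : a' ≤ 4) :
    (double c).Balanced (fun | .reg => a + (4 - a') | .per => 4 - a' | .aux => 0) ↔
      a' = 2 * a + 10 - 2 * c := by
  simp only [Balanced, double, Nat.cast_ofNat, Nat.cast_zero]
  rw [min_eq_left (by linarith)]
  exact ⟨fun h => by linarith [h.2], fun h => ⟨by linarith, by linarith⟩⟩

/-- The window has the fixed length 2, so the register clock should reach c after 1 time unit. -/
theorem balanced_shift :
    (shift c).Balanced (fun | .reg => a + (4 - a') | .per => 4 - a' | .aux => 0) ↔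
      a' = a + 5 - c := by
  simp only [Balanced, shift, Nat.cast_ofNat, Nat.cast_zero]
  rw [min_eq_left (by norm_num)]
  exact ⟨fun h => by linarith [h.2], fun h => ⟨by norm_num, by linarith⟩⟩

end Check

variable {Q : Type} [Inhabited Q] (N : TM0.Machine Bool Q)

/-- The atom that determines a bit of the tape by the comparison of a register with a constant. -/
def bitTest (b : Bool) (c : ℕ) (d : Bool) : Bool × Cmp × ℕ := (b, if d then .ge else .lt, c)

/-- The update of the register `b` for an operation of a Turing machine, when the head reads `h` and
the cell to its left contains `l`. -/
def tapeOp (h l : Bool) : TM0.Stmt Bool → Bool → Check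
  | .move .right, false => .half (2 + h.toNat)
  | .move .right, true => .double (6 + h.toNat)
  | .move .left, false => .double (5 + l.toNat)
  | .move .left, true => .half (3 + l.toNat)
  | .write _, false => .shift 5
  | .write d, true => .shift (4 + (!d).toNat + h.toNat)

/-- The program of a Turing machine with two tape symbols. An instruction consists of a state and of
the contents of the cell under the head and of the cell to its left. -/
def machineProg : Prog Q (Q × Bool × Bool) where
  src i := i.1
  tgt i := match N i.1 i.2.1 with
    | none => i.1
    | some p => p.1
  test i := match N i.1 i.2.1 with
    | none => [(true, .lt, 0)]
    | some _ => [bitTest true 3 i.2.1, bitTest false 1 i.2.2]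
  op i := match N i.1 i.2.1 with
    | none => fun _ => .shift 5
    | some p => tapeOp i.2.1 i.2.2 p.2

theorem wellFormed_machineProg : (machineProg N).WellFormed := by
  rintro ⟨q, h, l⟩ b
  simp only [machineProg]
  rcases N q h with _ | ⟨q', (_ | _) | d⟩ <;> cases b <;>
    simp [tapeOp, Check.half, Check.double, Check.shift]

variable {N}

theorem holds_bitTest_right {T : Tape Bool} {h : Bool} :
    (bitTest true 3 h).2.1.Holds (tapeRegs T true) (3 : ℕ) ↔ T.head = h := by
  have h2 := two_mul_tapeValue T.right₀
  have : T.right₀.head = T.head := ListBlank.head_cons _ _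
  rw [this] at h2
  have h0 := tapeValue_nonneg T.right₀.tail
  have h1 := tapeValue_lt_one T.right₀.tail
  cases hT : T.head <;> cases h <;> simp [hT, bitTest, Cmp.Holds, tapeRegs] at h2 ⊢ <;> linarith

theorem holds_bitTest_left {T : Tape Bool} {l : Bool} :
    (bitTest false 1 l).2.1.Holds (tapeRegs T false) (1 : ℕ) ↔ T.left.head = l := by
  have h2 := two_mul_tapeValue T.left
  have h0 := tapeValue_nonneg T.left.tail
  have h1 := tapeValue_lt_one T.left.tail
  cases hT : T.left.head <;> cases l <;> simp [hT, bitTest, Cmp.Holds, tapeRegs] at h2 ⊢ <;>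
    linarith

theorem sat_test_iff {T : Tape Bool} {q : Q} {h l : Bool} :
    ((machineProg N).test (q, h, l)).Sat (tapeRegs T) ↔
      (N q h).isSome ∧ T.head = h ∧ T.left.head = l := by
  simp only [machineProg]
  rcases N q h with _ | p
  · simpa [Constraint.Sat, Cmp.Holds] using tapeRegs_nonneg T true
  · simp only [Constraint.Sat, List.forall_mem_cons, List.not_mem_nil, false_imp_iff, implies_true,
      and_true, Option.isSome_some, true_and]
    exact and_congr holds_bitTest_right holds_bitTest_left

/-- The tape after an operation of a Turing machine. -/
def applyStmt (T : Tape Bool) : TM0.Stmt Bool → Tape Bool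
  | .move d => T.move d
  | .write b => T.write b

/-- A move of the head pushes a bit into one half of the tape, which halves its register, and pops
this bit from the other half, which doubles its register. The constants of `tapeOp` account for the
bit and for the offset 2 of the right half. -/
theorem balanced_tapeOp_iff {T : Tape Bool} {s : TM0.Stmt Bool} {b : Bool} {a' : ℝ} (h0 : 0 ≤ a')
    (h4 : a' ≤ 4) :
    (tapeOp T.head T.left.head s b).Balanced
      (fun | .reg => tapeRegs T b + (4 - a') | .per => 4 - a' | .aux => 0) ↔
      a' = tapeRegs (applyStmt T s) b := by
  obtain ⟨h, L, R⟩ := T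
  have hL := two_mul_tapeValue L
  have hR := two_mul_tapeValue R
  have hl := tapeValue_lt_one L
  have hr := tapeValue_lt_one R
  have hl0 := tapeValue_nonneg L
  have hr0 := tapeValue_nonneg R
  have hh : (h.toNat : ℝ) ≤ 1 := by cases h <;> simp
  have hh0 : (0 : ℝ) ≤ (h.toNat : ℝ) := Nat.cast_nonneg _
  rcases s with (_ | _) | d <;> cases b <;>
    simp only [tapeOp, applyStmt, tapeRegs, Tape.right₀, Tape.move, Tape.write, tapeValue_cons,
      ListBlank.cons_head_tail]
  · rw [Check.balanced_double h0 h4]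
    push_cast
    constructor <;> intro <;> linarith
  · rw [Check.balanced_half (by linarith) (by linarith)]
    push_cast
    constructor <;> intro <;> linarith
  · rw [Check.balanced_half (by linarith) (by linarith)]
    push_cast
    constructor <;> intro <;> linarith
  · rw [Check.balanced_double h0 h4]
    push_cast
    constructor <;> intro <;> linarith
  · rw [Check.balanced_shift]
    push_cast
    constructor <;> intro <;> linarith
  · rw [Check.balanced_shift]
    -- The constant should be 5 + h - d; the negated bit writes it without subtraction.
    have hd : (((!d).toNat : ℕ) : ℝ) = 1 - d.toNat := by cases d <;> simp
    push_cast
    rw [hd]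
    constructor <;> intro <;> linarith

theorem step_eq_of_eq_some {q q' : Q} {T : Tape Bool} {s : TM0.Stmt Bool}
    (h : N q T.head = some (q', s)) : TM0.step N ⟨q, T⟩ = some ⟨q', applyStmt T s⟩ := by
  simp only [TM0.step, h, Option.map_some]
  cases s <;> rfl

/-- The test forces the instruction to agree with the tape and to have a transition, and the
balanced checks force the new registers to encode the next tape. If the machine halts, the test asks
for a negative register, so no move exists. -/
theorem move_machineProg_iff {q : Q} {T : Tape Bool} {i : Q × Bool × Bool} {a' : Bool → ℝ} :
    (machineProg N).Move q (tapeRegs T) i a' ↔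
      i = (q, T.head, T.left.head) ∧ ∃ T', TM0.step N ⟨q, T⟩ = some ⟨(machineProg N).tgt i, T'⟩ ∧
        a' = tapeRegs T' := by
  obtain ⟨q₁, h, l⟩ := i
  have hop : ∀ q' s, N q T.head = some (q', s) →
      (machineProg N).op (q, T.head, T.left.head) = tapeOp T.head T.left.head s ∧
      (machineProg N).tgt (q, T.head, T.left.head) = q' := by
    intro q' s hN
    simp [machineProg, hN]
  constructor
  · rintro ⟨hq, ht, hb⟩
    obtain rfl : q₁ = q := hq
    obtain ⟨hN, rfl, rfl⟩ := sat_test_iff.1 ht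
    obtain ⟨⟨q', s⟩, hN⟩ := Option.isSome_iff_exists.1 hN
    obtain ⟨h1, h2⟩ := hop q' s hN
    refine ⟨rfl, applyStmt T s, ?_, ?_⟩
    · rw [step_eq_of_eq_some hN]
      exact congrArg _ (congrArg (TM0.Cfg.mk · _) h2.symm)
    · funext b
      have := hb b
      rw [h1] at this
      exact (balanced_tapeOp_iff this.1 this.2.1).1 this.2.2
  · rintro ⟨hi, T', hs, rfl⟩
    rw [Prod.mk.injEq, Prod.mk.injEq] at hi
    obtain ⟨rfl, rfl, rfl⟩ := hi
    rcases hN : N q₁ T.head with _ | ⟨q', s⟩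
    · simp [TM0.step, hN] at hs
    · rw [step_eq_of_eq_some hN, Option.some.injEq, TM0.Cfg.mk.injEq] at hs
      obtain ⟨-, rfl⟩ := hs
      refine ⟨rfl, sat_test_iff.2 ⟨by rw [hN]; rfl, rfl, rfl⟩, fun b =>
        ⟨tapeRegs_nonneg _ _, (tapeRegs_lt _ _).le, ?_⟩⟩
      rw [(hop q' s hN).1]
      exact (balanced_tapeOp_iff (tapeRegs_nonneg _ _) (tapeRegs_lt _ _).le).2 rfl

/-- An infinite computation of the program of a Turing machine stems from a computation of the
machine that does not halt. -/
theorem not_dom_of_isComputation {q : ℕ → Q} {ins : ℕ → Q × Bool × Bool} {a : ℕ → Bool → ℝ}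
    (h : (machineProg N).IsComputation q ins a) {T : Tape Bool} (h0 : a 0 = tapeRegs T) :
    ¬ (StateTransition.eval (TM0.step N) ⟨q 0, T⟩).Dom := by
  rw [StateTransition.not_dom_eval_iff]
  -- The tapes are built along with the computation, so it need not be known that the registers
  -- determine the tape.
  have hstep : ∀ (k : ℕ) (T : {T : Tape Bool // a k = tapeRegs T}),
      ∃ T' : {T : Tape Bool // a (k + 1) = tapeRegs T},
        TM0.step N ⟨q k, T.1⟩ = some ⟨q (k + 1), T'.1⟩ := by
    rintro k ⟨T, hT⟩
    have hm := h.move k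
    rw [hT, move_machineProg_iff] at hm
    obtain ⟨-, T', hs, ha⟩ := hm
    refine ⟨⟨T', ha⟩, ?_⟩
    rw [h.tgt]
    exact hs
  choose f hf using hstep
  let t : ∀ k, {T : Tape Bool // a k = tapeRegs T} := fun k =>
    Nat.rec ⟨T, h0⟩ (fun k T => f k T) k
  exact ⟨fun k => ⟨q k, (t k).1⟩, rfl, fun k => hf k (t k)⟩

theorem exists_isComputation_of_not_dom {c : TM0.Cfg Bool Q}
    (h : ¬ (StateTransition.eval (TM0.step N) c).Dom) :
    ∃ q ins a, (machineProg N).IsComputation q ins a ∧ q 0 = c.q ∧ a 0 = tapeRegs c.Tape ∧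
      ∀ k, a k false ≤ a k true := by
  obtain ⟨s, rfl, hs⟩ := StateTransition.not_dom_eval_iff.1 h
  have htgt : ∀ k, (machineProg N).tgt ((s k).q, (s k).Tape.head, (s k).Tape.left.head) =
      (s (k + 1)).q := by
    intro k
    have := hs k
    rcases hN : N (s k).q (s k).Tape.head with _ | ⟨q', t⟩
    · simp [TM0.step, hN] at this
    · rw [step_eq_of_eq_some hN, Option.some.injEq] at this
      rw [← this]
      simp [machineProg, hN]
  refine ⟨fun k => (s k).q, fun k => ((s k).q, (s k).Tape.head, (s k).Tape.left.head),
    fun k => tapeRegs (s k).Tape, ⟨fun k => ?_, fun k => (htgt k).symm⟩, rfl, rfl,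
    fun k => tapeRegs_le _⟩
  rw [move_machineProg_iff, htgt]
  exact ⟨rfl, _, hs k, rfl⟩

/-! ## A Turing machine with undecidable halting problem -/

/-- A finite stack machine can be simulated by a Turing machine with two tape symbols. -/
theorem exists_machine_of_stackMachine {K : Type} [DecidableEq K] [Fintype K] {Γ : K → Type}
    [∀ k, Fintype (Γ k)] {Λ σ : Type} [Inhabited Λ] [Inhabited σ] [Fintype σ]
    (M : Λ → TM2.Stmt Γ Λ σ) {S : Finset Λ} (hS : TM2.Supports M S) (k : K) :
    ∃ (Q : Type) (_ : Fintype Q) (_ : Inhabited Q) (N : TM0.Machine Bool Q)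
      (enc : TM2to1.Γ' K Γ → List Bool), ∀ L,
        (eval (TM0.step N) (TM0.init ((TM2to1.trInit k L).flatMap enc))).Dom ↔
          (eval (TM2.step M) (TM2.init k L)).Dom := by
  obtain ⟨n, enc, dec, enc0, encdec⟩ := TM1to1.exists_enc_dec (Γ := TM2to1.Γ' K Γ)
  have hS₁ := TM2to1.tr_supports M hS
  set M₁ := TM2to1.tr M
  have hS₂ := TM1to1.tr_supports (enc := enc) (dec := dec) M₁ hS₁
  set M₂ := TM1to1.tr enc dec M₁
  have hS₃ := TM1to0.tr_supports M₂ hS₂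
  set M₃ := TM1to0.tr M₂
  set S₃ := TM1to0.trStmts M₂ (TM1to1.trSupp M₁ (TM2to1.trSupp M S))
  classical
  let _ : Inhabited S₃ := ⟨⟨default, hS₃.1⟩⟩
  -- The states are restricted to the finite set that supports the machine; its computations never
  -- leave this set, so the default value outside is harmless.
  let g₁ : PointedMap (TM1to0.Λ' M₂) S₃ :=
    ⟨fun q => if h : q ∈ S₃ then ⟨q, h⟩ else default, dif_pos hS₃.1⟩
  let f : PointedMap Bool Bool := ⟨id, rfl⟩
  refine ⟨S₃, inferInstance, inferInstance, M₃.map f f g₁ Subtype.val, fun a => (enc a).toList,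
    fun L => ?_⟩
  have h₁ := tr_eval_dom (TM2to1.tr_respects M) (TM2to1.trCfg_init k L)
  have h₂ := tr_eval_dom (TM1to1.tr_respects (enc := enc) (dec := dec) (enc0 := enc0) M₁ encdec)
    (a₁ := TM1.init (TM2to1.trInit k L)) rfl
  have h₃ := tr_eval_dom (TM1to0.tr_respects M₂)
    (a₁ := TM1to1.trCfg enc enc0 (TM1.init (TM2to1.trInit k L))) rfl
  have h₄ := tr_eval_dom (TM0.Machine.map_respects M₃ f f g₁ Subtype.val hS₃ (fun _ => rfl)
    (fun q hq => congrArg Subtype.val (dif_pos hq : _ = (⟨q, hq⟩ : S₃))))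
    (a₁ := TM0.init ((TM2to1.trInit k L).flatMap fun a => (enc a).toList)) ⟨hS₃.1, rfl⟩
  rw [TM0.map_init, show (f : Bool → Bool) = id from rfl, List.map_id] at h₄
  exact h₄.trans (h₃.trans (h₂.trans h₁))

theorem exists_machine_of_code (c : ToPartrec.Code) :
    ∃ (Q : Type) (_ : Fintype Q) (_ : Inhabited Q) (N : TM0.Machine Bool Q)
      (enc : TM2to1.Γ' PartrecToTM2.K' (fun _ => PartrecToTM2.Γ') → List Bool), ∀ v,
        (eval (TM0.step N) (TM0.init
          ((TM2to1.trInit PartrecToTM2.K'.main (PartrecToTM2.trList v)).flatMap enc))).Dom ↔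
          (c.eval v).Dom := by
  -- The universal stack program starts at the default label, so this instance is what selects the
  -- code `c`.
  let _ : Inhabited PartrecToTM2.Λ' := ⟨PartrecToTM2.trNormal c PartrecToTM2.Cont'.halt⟩
  let _ : Fintype PartrecToTM2.K' :=
    ⟨{.main, .rev, .aux, .stack}, fun k => by cases k <;> simp⟩
  obtain ⟨Q, hf, hi, N, enc, h⟩ := exists_machine_of_stackMachine PartrecToTM2.tr
    (PartrecToTM2.tr_supports c PartrecToTM2.Cont'.halt) PartrecToTM2.K'.main
  refine ⟨Q, hf, hi, N, enc, fun v => (h _).trans ?_⟩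
  have : TM2.init PartrecToTM2.K'.main (PartrecToTM2.trList v) = PartrecToTM2.init c v := by
    simp only [TM2.init, PartrecToTM2.init]
    congr 1
    funext k
    cases k <;> rfl
  rw [this, PartrecToTM2.tr_eval]
  rfl

theorem trNat_two_pow (k : ℕ) : PartrecToTM2.trNat (2 ^ k) =
    List.replicate k PartrecToTM2.Γ'.bit0 ++ [PartrecToTM2.Γ'.bit1] := by
  let p : ℕ → PosNum := fun k => Nat.rec 1 (fun _ => PosNum.bit0) k
  have hp : ∀ k, (castPosNum (p k) : ℕ) = 2 ^ k := by
    intro k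
    induction k with
    | zero => rfl
    | succ k ih =>
      change (castPosNum (p k) + castPosNum (p k) : ℕ) = _
      rw [ih, pow_succ, mul_two]
  have hn : ((2 ^ k : ℕ) : Num) = Num.pos (p k) := by
    rw [← hp k]
    exact PosNum.of_to_nat (p k)
  rw [PartrecToTM2.trNat, hn, PartrecToTM2.trNum]
  clear hn
  induction k with
  | zero => rfl
  | succ k ih => exact congrArg (PartrecToTM2.Γ'.bit0 :: ·) ih

/-- The binary digits of 2 ^ k are k zeros and a one. On the reversed stack the one and the end mark
come first and the zeros follow, so only the number of repetitions depends on k. The first cell also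
carries the mark of the stack bottom. -/
theorem exists_trInit_two_pow (enc : TM2to1.Γ' PartrecToTM2.K' (fun _ => PartrecToTM2.Γ') →
    List Bool) : ∃ pre u : List Bool, ∀ k,
      (TM2to1.trInit PartrecToTM2.K'.main (PartrecToTM2.trList [2 ^ k])).flatMap enc =
        pre ++ (List.replicate k u).flatten := by
  let cell : PartrecToTM2.Γ' → TM2to1.Γ' PartrecToTM2.K' (fun _ => PartrecToTM2.Γ') := fun a =>
    (false, Function.update (fun _ => none) PartrecToTM2.K'.main (some a))
  refine ⟨enc (true, (cell .cons).2) ++ enc (cell .bit1), enc (cell .bit0), fun k => ?_⟩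
  have : (PartrecToTM2.trList [2 ^ k]).reverse =
      .cons :: .bit1 :: List.replicate k PartrecToTM2.Γ'.bit0 := by
    simp [trNat_two_pow]
  simp only [TM2to1.trInit, this, List.append_assoc]
  change enc (true, (cell .cons).2) ++ (enc (cell .bit1) ++
    ((List.replicate k PartrecToTM2.Γ'.bit0).map cell).flatMap enc) = _
  rw [List.map_replicate, List.flatMap, List.map_replicate]

theorem primrec_two_pow : Primrec fun k : ℕ => 2 ^ k :=
  (Primrec.nat_rec₁ 1 (Primrec.nat_mul.comp Primrec.snd (Primrec.const 2)).to₂).of_eq fun k => by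
    induction k with
    | zero => rfl
    | succ k ih => rw [pow_succ, ← ih]

/-- The code takes the logarithm of its input and then runs the program with this number on the
input 0. The inputs are powers of two for the sake of `exists_trInit_two_pow`. -/
theorem exists_code_halting : ∃ c : ToPartrec.Code,
    ¬ ComputablePred fun k : ℕ => (c.eval [2 ^ k]).Dom := by
  let f : ℕ →. ℕ := fun k => (Denumerable.ofNat Nat.Partrec.Code k).eval 0
  let lg : ℕ → ℕ := fun m => m.findGreatest fun j => 2 ^ j ≤ m
  have hf : Partrec f :=
    Nat.Partrec.Code.eval_part.comp (Primrec.ofNat _).to_comp (Computable.const 0)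
  have hlg : Primrec lg := Primrec.nat_findGreatest Primrec.id
    (Primrec.nat_le.comp (primrec_two_pow.comp Primrec.snd) Primrec.fst)
  have hlg' : ∀ k, lg (2 ^ k) = k := fun k =>
    (Nat.findGreatest_eq_iff.2 ⟨Nat.lt_two_pow_self.le, fun _ => le_rfl, fun j hj _ =>
      not_le.2 (Nat.pow_lt_pow_right one_lt_two hj)⟩)
  obtain ⟨c, hc⟩ := ToPartrec.Code.exists_code
    (Nat.Partrec'.part_iff₁.2 (hf.comp hlg.to_comp))
  have hdom : ∀ k, (c.eval [2 ^ k]).Dom ↔ (f k).Dom := by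
    intro k
    have := hc (2 ^ k ::ᵥ List.Vector.nil)
    change c.eval [2 ^ k] = _ at this
    rw [this]
    change (f (lg (2 ^ k))).Dom ↔ _
    rw [hlg']
  refine ⟨c, fun h => ComputablePred.halting_problem 0 ?_⟩
  refine ComputablePred.computable_of_manyOneReducible ⟨Encodable.encode, Computable.encode, ?_⟩ h
  intro d
  rw [hdom]
  simp [f]

/-- There is a Turing machine with two tape symbols whose halting problem is undecidable for a
sequence of inputs that consist of a fixed word followed by repetitions of another one. -/
theorem exists_machine_halting : ∃ (Q : Type) (_ : Fintype Q) (_ : Inhabited Q)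
    (N : TM0.Machine Bool Q) (pre u : List Bool), ¬ ComputablePred fun k : ℕ =>
      (eval (TM0.step N) (TM0.init (pre ++ (List.replicate k u).flatten))).Dom := by
  obtain ⟨c, hc⟩ := exists_code_halting
  obtain ⟨Q, hf, hi, N, enc, h⟩ := exists_machine_of_code c
  obtain ⟨pre, u, hpre⟩ := exists_trInit_two_pow enc
  refine ⟨Q, hf, hi, N, pre, u, ?_⟩
  simpa only [← hpre, h] using hc

/-- The numerator and the denominator of the number with a given binary expansion. -/
def binaryNum : List Bool → ℕ
  | [] => 0
  | b :: l => b.toNat * 2 ^ l.length + binaryNum l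

theorem binaryValue_eq (l : List Bool) : binaryValue l = binaryNum l / 2 ^ l.length := by
  induction l with
  | nil => simp [binaryValue, binaryNum]
  | cons b l ih =>
    simp only [binaryValue, binaryNum, ih, List.length_cons]
    push_cast
    field_simp
    ring

theorem binaryNum_append (l l' : List Bool) :
    binaryNum (l ++ l') = binaryNum l * 2 ^ l'.length + binaryNum l' := by
  induction l with
  | nil => simp [binaryNum]
  | cons b l ih =>
    simp only [List.cons_append, binaryNum, ih, List.length_append, pow_add]
    ring

theorem primrec_length_word (pre u : List Bool) :
    Primrec fun k : ℕ => 2 ^ (pre ++ (List.replicate k u).flatten).length :=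
  (primrec_two_pow.comp (Primrec.nat_add.comp (Primrec.const pre.length)
    (Primrec.nat_mul.comp Primrec.id (Primrec.const u.length)))).of_eq fun k => by simp

/-- Appending `u` acts on the numerator as a fixed affine map, which is iterated k times. -/
theorem primrec_binaryNum_word (pre u : List Bool) :
    Primrec fun k : ℕ => binaryNum (pre ++ (List.replicate k u).flatten) :=
  (Primrec.nat_rec₁ (binaryNum pre) (Primrec.nat_add.comp (Primrec.nat_mul.comp Primrec.snd
    (Primrec.const (2 ^ u.length))) (Primrec.const (binaryNum u))).to₂).of_eq fun k => by
    induction k with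
    | zero => simp
    | succ k ih =>
      rw [List.replicate_succ', List.flatten_append, ← List.append_assoc, binaryNum_append, ← ih]
      simp

/-! ## Undecidability -/

theorem exists_numbering {α : Type} [Fintype α] (a : α) :
    ∃ (N : ℕ) (φ : α ≃ Fin (N + 1)), φ a = 0 := by
  have : Nonempty α := ⟨a⟩
  obtain ⟨N, hN⟩ := Nat.exists_eq_succ_of_ne_zero (Fintype.card_ne_zero (α := α))
  let e : α ≃ Fin (N + 1) := Fintype.equivFinOfCardEq hN
  exact ⟨N, e.trans (Equiv.swap (e a) 0), by simp⟩

/-- An injection suffices: further clocks occur in no guard, invariant or reset of the game. -/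
theorem exists_clocks {n : ℕ} (hn : 4 ≤ n) : ∃ κ : Clk → Fin n, Function.Injective κ := by
  let f : Clk → Fin 4 := fun
    | .reg false => 0
    | .reg true => 1
    | .per => 2
    | .aux => 3
  have hf : Function.Injective f := by
    rintro ((_ | _) | _ | _) ((_ | _) | _ | _) h <;> simp_all [f]
  exact ⟨fun c => Fin.castLE hn (f c), (Fin.castLE_injective hn).comp hf⟩

variable {n : ℕ} (κ : Clk → Fin n)

/-- The numerators of the clock values that encode a tape with the word `w` to the right of the
head; their denominator is `2 ^ w.length`. -/
def initClocks (w : List Bool) (i : Fin n) : ℕ :=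
  if i = κ (.reg true) then 2 * 2 ^ w.length + 2 * binaryNum w
  else if i = κ .per then 4 * 2 ^ w.length else 0

variable {κ}

theorem initClocks_per (hκ : Function.Injective κ) (w : List Bool) :
    initClocks κ w (κ .per) = 4 * 2 ^ w.length := by
  simp [initClocks, hκ.eq_iff]

/-- As `per` starts at 4, the register values are the initial values of their clocks: 0 for the
empty left half, and 2 plus twice the binary fraction of `w` for the right half. -/
theorem initClocks_eq (hκ : Function.Injective κ) (w : List Bool) (b : Bool) :
    (initClocks κ w (κ (.reg b)) : ℝ) / (2 ^ w.length : ℕ) +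
      (4 - (initClocks κ w (κ .per) : ℝ) / (2 ^ w.length : ℕ)) = tapeRegs (Tape.mk₁ w) b := by
  have h2 : ((2 : ℝ) ^ w.length) ≠ 0 := by positivity
  have hright : (Tape.mk₁ w).right₀ = ListBlank.mk w := Tape.mk'_right₀ _ _
  have hleft : (Tape.mk₁ w).left = ListBlank.mk [] := Tape.mk'_left _ _
  rw [initClocks_per hκ]
  cases b
  · simp [initClocks, hκ.eq_iff, tapeRegs, hleft, tapeValue_mk, binaryValue, h2]
  · simp only [initClocks, if_true, tapeRegs, hright, tapeValue_mk, binaryValue_eq]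
    push_cast
    field_simp
    ring

/-- Value 1/2, an infinite computation of the program, and a computation of the machine that does
not halt are equivalent. The order of the registers, needed for the strategy, comes from
`tapeRegs_le`. -/
theorem isPositive_iff_not_dom {Q : Type} [Inhabited Q] {N : TM0.Machine Bool Q} {K M : ℕ}
    {φ : PLoc Q (Q × Bool × Bool) ≃ Fin (K + 1)} {ψ : PEdge Q (Q × Bool × Bool) ≃ Fin M}
    (hφ : φ (.main default) = 0) (hκ : Function.Injective κ) (w : List Bool) :
    ((machineProg N).toInstance φ ψ κ (initClocks κ w) (2 ^ w.length)).IsPositive ↔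
      ¬ (eval (TM0.step N) (TM0.init w)).Dom := by
  have hper := (initClocks_per hκ w).le
  have hd : 0 < 2 ^ w.length := by positivity
  have hP := wellFormed_machineProg N
  constructor
  · intro h
    obtain ⟨q, ins, a, hc, hq, ha⟩ :=
      Prog.exists_isComputation_of_isPositive hφ hκ hper hd hP h
    have := not_dom_of_isComputation hc (funext fun b => (ha b).trans (initClocks_eq hκ w b))
    rwa [hq] at this
  · intro h
    obtain ⟨q, ins, a, hc, hq, ha, hord⟩ := exists_isComputation_of_not_dom h
    exact Prog.isPositive_of_isComputation hφ hκ hper hd hP hc hq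
      (fun b => (congrFun ha b).trans (initClocks_eq hκ w b).symm) fun k => hord (k + 1)

theorem primrec_initClocks (κ : Clk → Fin n) (pre u : List Bool) :
    Primrec fun k : ℕ => initClocks κ (pre ++ (List.replicate k u).flatten) := by
  have hlen := (primrec_length_word pre u).comp (Primrec.fst (α := ℕ) (β := Fin n))
  have hnum := (primrec_binaryNum_word pre u).comp (Primrec.fst (α := ℕ) (β := Fin n))
  have heq : ∀ i : Fin n, PrimrecPred fun p : ℕ × Fin n => p.2 = i := fun i =>
    Primrec.eq.comp Primrec.snd (Primrec.const i)
  refine Primrec.fin_curry.2 (Primrec.of_eq (f := fun p : ℕ × Fin n =>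
    if p.2 = κ (.reg true) then _ else if p.2 = κ .per then _ else _) (Primrec.ite (heq _)
    (Primrec.nat_add.comp (Primrec.nat_mul.comp (Primrec.const 2) hlen)
      (Primrec.nat_mul.comp (Primrec.const 2) hnum))
    (Primrec.ite (heq _) (Primrec.nat_mul.comp (Primrec.const 4) hlen) (Primrec.const 0)))
    fun _ => rfl)

theorem primrec_toInstance {Q I : Type} (P : Prog Q I) {K M : ℕ} (φ : PLoc Q I ≃ Fin (K + 1))
    (ψ : PEdge Q I ≃ Fin M) (κ : Clk → Fin n) {x : ℕ → Fin n → ℕ} {d : ℕ → ℕ} (hx : Primrec x)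
    (hd : Primrec d) : Primrec fun k => P.toInstance φ ψ κ (x k) (d k) := by
  let c := P.toInstance φ ψ κ (x 0) (d 0)
  exact (Primrec.of_equiv_symm (e := Instance.equivProd n)).comp <|
    (Primrec.const c.initLoc).pair <| (Primrec.const c.otherLocs).pair <|
      (Primrec.const c.edges).pair <| hx.pair <| hd.pair <| (Primrec.const c.cmp).pair <|
        (Primrec.const c.num).pair (Primrec.const c.den)

/-- The halting problem of a Turing machine reduces to the reachability problem. -/
theorem exists_undecidable_instances (hn : 4 ≤ n) : ∃ c : ℕ → Instance n, Computable c ∧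
    (∀ k, (c k).IsQuantitative ∧ (c k).cmp = Cmp.eq ∧ (c k).num = 1 ∧ (c k).den = 2) ∧
      ¬ ComputablePred fun k => ¬ (c k).IsPositive := by
  obtain ⟨Q, _, _, N, pre, u, h⟩ := exists_machine_halting
  obtain ⟨κ, hκ⟩ := exists_clocks hn
  obtain ⟨K, φ, hφ⟩ := exists_numbering (PLoc.main default : PLoc Q (Q × Bool × Bool))
  let ψ := Fintype.equivFin (PEdge Q (Q × Bool × Bool))
  refine ⟨fun k => (machineProg N).toInstance φ ψ κ
      (initClocks κ (pre ++ (List.replicate k u).flatten))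
      (2 ^ (pre ++ (List.replicate k u).flatten).length),
    (primrec_toInstance _ φ ψ κ (primrec_initClocks κ pre u)
      (primrec_length_word pre u)).to_comp, fun k => ⟨?_, rfl, rfl, rfl⟩, ?_⟩
  · exact Prog.isQuantitative_toInstance _ hφ hκ (initClocks_per hκ _).le (by positivity)
  · simpa only [isPositive_iff_not_dom hφ hκ, not_not] using h

/-- Composing a decision procedure with the computable family `c` would decide the complement of
positivity along the family, that is, the halting problem. -/
theorem not_decidableOn {D : Instance n → Prop} {c : ℕ → Instance n} (hc : Computable c)
    (hD : ∀ k, D (c k)) (h : ¬ ComputablePred fun k => ¬ (c k).IsPositive) :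
    ¬ DecidableOn D fun c => c.IsPositive := by
  rintro ⟨f, hf, hfD⟩
  refine h (ComputablePred.computable_iff.2
    ⟨fun k => !f (c k), Primrec.not.to_comp.comp (hf.comp hc), funext fun k => ?_⟩)
  have := hfD _ (hD k)
  simp only at this
  simp [← this]

end STG

end

theorem theorem2 (n : ℕ) (hn : 4 ≤ n) :
    ¬ STG.DecidableOn (fun c : STG.Instance n => c.IsQuantitative) (fun c => c.IsPositive) ∧
    ¬ STG.DecidableOn
        (fun c : STG.Instance n =>
          c.IsQuantitative ∧ c.cmp = STG.Cmp.eq ∧ c.num = 1 ∧ c.den = 2)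
        (fun c => c.IsPositive) := by
  obtain ⟨c, hc, hD, h⟩ := STG.exists_undecidable_instances hn
  exact ⟨STG.not_decidableOn hc (fun k => (hD k).1) h, STG.not_decidableOn hc hD h⟩
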